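/- Write $\mathbb T^2=\mathbb R^2/\mathbb Z^2$. For $i=1,2$ let $R_i$ be the Riesz transform on $L^2(\mathbb T^2)$, given on Fourier coefficients by $c_0(R_if)=0$ and $c_k(R_if)=\frac{k_i}{|k|}c_k(f)$ for $k\in\mathbb Z^2\setminus\{0\}$. Let $W^{k,2}(\mathbb T^2)$ be the usual Sobolev space, let $W^{-k,2}(\mathbb T^2)$ be its dual space, and let $L\log L(\mathbb T^2)$ be the set of $f\in L^1(\mathbb T^2)$ with $\int_{\mathbb T^2}|f|\ln(e+|f|)<\infty$. Let $L>0$ and let $\rho_0^{+},\rho_0^-\in L^2_{loc}(\mathbb R^2)$ satisfy, for almost every $x=(x_1,x_2)$, $$\rho_0^\pm(x_1+1,x_2)=\rho_0^\pm(x_1,x_2)+L,\qquad \rho_0^\pm(x_1,x_2+1)=\rho_0^\pm(x_1,x_2),\qquad \partial_{x_1}\rho_0^\pm\ge 0,$$ with $\partial_{x_1}\rho_0^\pm\in L\log L(\mathbb T^2)$ (a distributional derivative). Let $\eta\in C_c^\infty(\mathbb R^2)$, $\eta\ge0$, $\int\eta=1$, and $\eta_\varepsilon=\varepsilon^{-2}\eta(\cdot/\varepsilon)$.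 For $\varepsilon\in(0,1]$ and $T>0$, a smooth solution on $[0,T)$ means a pair $\rho^{\pm,\varepsilon}\in C^\infty(\mathbb R^2\times[0,T))$ with, for $\rho^\varepsilon=\rho^{+,\varepsilon}-\rho^{-,\varepsilon}$, $$\partial_t\rho^{\pm,\varepsilon}-\varepsilon\Delta\rho^{\pm,\varepsilon}=\mp\,(R_1^2R_2^2\rho^\varepsilon)\,\partial_{x_1}\rho^{\pm,\varepsilon}\quad\text{in }\mathbb R^2\times(0,T),$$ $$\rho^{\pm,\varepsilon}(x,0)=\big((\rho_0^\pm-Lx_1)*\eta_\varepsilon\big)(x)+(L+\varepsilon)x_1,$$ such that for all $t\in[0,T)$ one has $\rho^{\pm,\varepsilon}(x_1+1,x_2,t)=\rho^{\pm,\varepsilon}(x_1,x_2,t)+L+\varepsilon$, $\rho^{\pm,\varepsilon}(x_1,x_2+1,t)=\rho^{\pm,\varepsilon}(x_1,x_2,t)$ and $\partial_{x_1}\rho^{\pm,\varepsilon}\ge0$. Then: (i) There is a constant $C>0$, independent of $T>0$ and of $\varepsilon\in(0,1]$, such that for all $T>0$, all $\varepsilon\in(0,1]$, every smooth solution on $[0,T)$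 and every $\psi\in L^2((0,T);W^{1,2}(\mathbb T^2))$, $$\left|\int_0^T\!\!\int_{\mathbb T^2}\psi\,R_1^2R_2^2(\partial_t\rho^\varepsilon)\,dx\,dt\right|\le C\,\|\psi\|_{L^2((0,T);W^{1,2}(\mathbb T^2))},$$ and moreover $R_1^2R_2^2(\partial_t\rho^\varepsilon)\in L^2((0,T);W^{-1,2}(\mathbb T^2))$ with norm at most $C$. (ii) For every $T>0$ there is a constant $C_T>0$, independent of $\varepsilon\in(0,1]$, such that for all $\varepsilon\in(0,1]$, every smooth solution on $[0,T)$ and every $\psi\in L^2((0,T);W^{2,2}(\mathbb T^2))$, $$\left|\int_0^T\!\!\int_{\mathbb T^2}\psi\,\partial_t\rho^{\pm,\varepsilon}\,dx\,dt\right|\le C_T\,\|\psi\|_{L^2((0,T);W^{2,2}(\mathbb T^2))},$$ and moreover $\partial_t\rho^{\pm,\varepsilon}\in L^2((0,T);W^{-2,2}(\mathbb T^2))$ with norm at most $C_T$. In both parts the inner integral over $\mathbb T^2$ is an integrable function of $t\in(0,T)$. -/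

import Mathlib

open MeasureTheory Set
open scoped ContDiff ENNReal

noncomputable section

namespace Dislocation

/-! ### The plane, the torus and periodic functions -/

/-- The plane `ℝ²`; coordinates `0` and `1` stand for `x₁` and `x₂`. -/
abbrev Plane := Fin 2 → ℝ

/-- The torus `ℝ² / ℤ²`. -/
abbrev Torus := UnitAddTorus (Fin 2)

/-- The normalised Haar measure of the torus, i.e. Lebesgue measure of the unit cell. -/
abbrev torusMeasure : Measure Torus :=
  Measure.pi fun _ : Fin 2 => (AddCircle.haarAddCircle : Measure UnitAddCircle)

/-- Real `L²(𝕋²)`. -/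
abbrev L2R := Lp ℝ 2 torusMeasure

/-- Complex `L²(𝕋²)`. -/
abbrev L2C := Lp ℂ 2 torusMeasure

/-- The unit vector `e_i` of the plane. -/
def e (i : Fin 2) : Plane := Pi.single i 1

/-- `ℤ²`-periodicity of a function on the plane. -/
def IsPeriodic (f : Plane → ℝ) : Prop := ∀ i x, f (x + e i) = f x

/-- The function on the torus induced by a function on the plane through its values on the
fundamental cell `(0,1]²`; for a periodic function this is the usual passage to the quotient. -/
def descend (f : Plane → ℝ) (x : Torus) : ℝ :=
  f (UnitAddTorus.measurableEquivPiIoc (fun _ : Fin 2 => (0 : ℝ)) x).1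

open Classical in
/-- The class in `L²(𝕋²)` of a square integrable function (and `0` for other functions). -/
def toL2 (f : Torus → ℝ) : L2R :=
  if h : MemLp f 2 torusMeasure then h.toLp f else 0

/-- The partial derivative `∂f/∂x_i`. -/
def pd (i : Fin 2) (f : Plane → ℝ) (x : Plane) : ℝ := fderiv ℝ f x (e i)

/-- The Laplacian. -/
def lap (f : Plane → ℝ) (x : Plane) : ℝ := pd 0 (pd 0 f) x + pd 1 (pd 1 f) x

/-- The time derivative `∂ρ/∂t` at time `t`, as a function of the space variable. -/
def dt (ρ : ℝ → Plane → ℝ) (t : ℝ) (x : Plane) : ℝ := deriv (fun s => ρ s x) t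

/-! ### Riesz transforms -/

/-- The Fourier symbol `k_i / |k|` of the Riesz transform `R_i` (`0` for `k = 0`). -/
def rieszSymbol (i : Fin 2) (k : Fin 2 → ℤ) : ℝ :=
  if k = 0 then 0 else (k i : ℝ) / Real.sqrt ((k 0 : ℝ) ^ 2 + (k 1 : ℝ) ^ 2)

theorem abs_rieszSymbol_le (i : Fin 2) (k : Fin 2 → ℤ) : |rieszSymbol i k| ≤ 1 := by
  unfold rieszSymbol
  split_ifs with h
  · simp
  · rw [abs_div, abs_of_nonneg (Real.sqrt_nonneg _)]
    refine div_le_one_of_le₀ (Real.abs_le_sqrt ?_) (Real.sqrt_nonneg _)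
    fin_cases i
    · simpa using sq_nonneg (k 1 : ℝ)
    · simpa using sq_nonneg (k 0 : ℝ)

theorem memℓp_riesz (i : Fin 2) (f : L2C) :
    Memℓp (fun k : Fin 2 → ℤ =>
      (rieszSymbol i k : ℂ) * UnitAddTorus.mFourierCoeff (d := Fin 2) f k) 2 := by
  refine Memℓp.mono' (lp.memℓp ((UnitAddTorus.mFourierBasis (d := Fin 2)).repr f)) fun k => ?_
  rw [UnitAddTorus.mFourierBasis_repr, norm_mul, Complex.norm_real, Real.norm_eq_abs]
  exact mul_le_of_le_one_left (norm_nonneg _) (abs_rieszSymbol_le i k)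

/-- The Riesz transform `R_i` on `L²(𝕋²)`: the function whose `k`-th Fourier coefficient is
`rieszSymbol i k * c_k(f)`. -/
def riesz (i : Fin 2) (f : L2C) : L2C :=
  (UnitAddTorus.mFourierBasis (d := Fin 2)).repr.symm ⟨_, memℓp_riesz i f⟩

theorem mFourierCoeff_riesz (i : Fin 2) (f : L2C) (k : Fin 2 → ℤ) :
    UnitAddTorus.mFourierCoeff (d := Fin 2) (riesz i f) k =
      (rieszSymbol i k : ℂ) * UnitAddTorus.mFourierCoeff (d := Fin 2) f k := by
  rw [← UnitAddTorus.mFourierBasis_repr, riesz, LinearIsometryEquiv.apply_symm_apply]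

/-- A real `L²` function regarded as a complex one. -/
def complexify (f : L2R) : L2C := Complex.ofRealCLM.compLp f

/-- The operator `R₁²R₂²` on real `L²(𝕋²)`. Its Fourier symbol is real and even, so it maps real
functions to real functions, and the real part only restores the type
(see `complexify_rieszSq`). -/
def rieszSq (f : L2R) : L2R :=
  Complex.reCLM.compLp (riesz 0 (riesz 0 (riesz 1 (riesz 1 (complexify f)))))

theorem rieszSymbol_neg (i : Fin 2) (k : Fin 2 → ℤ) :
    rieszSymbol i (-k) = -rieszSymbol i k := by
  simp only [rieszSymbol, neg_eq_zero, Pi.neg_apply, Int.cast_neg, neg_sq]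
  split_ifs <;> simp [neg_div]

theorem mFourierCoeff_star (g : Torus → ℂ) (k : Fin 2 → ℤ) :
    UnitAddTorus.mFourierCoeff (d := Fin 2) (fun x => star (g x)) k =
      star (UnitAddTorus.mFourierCoeff (d := Fin 2) g (-k)) := by
  unfold UnitAddTorus.mFourierCoeff
  rw [← starRingEnd_apply, ← integral_conj]
  congr 1
  funext x
  rw [UnitAddTorus.mFourier_neg, neg_neg]
  simp

theorem complexify_rieszSq (f : L2R) :
    complexify (rieszSq f) = riesz 0 (riesz 0 (riesz 1 (riesz 1 (complexify f)))) := by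
  set g := riesz 0 (riesz 0 (riesz 1 (riesz 1 (complexify f)))) with hg
  have hc : ∀ (u v : L2C), (u : Torus → ℂ) =ᵐ[torusMeasure] v → ∀ k,
      UnitAddTorus.mFourierCoeff (d := Fin 2) u k = UnitAddTorus.mFourierCoeff (d := Fin 2) v k :=
    fun u v h k => by rw [Lp.ext h]
  have hstar : ∀ (u : L2C) k, UnitAddTorus.mFourierCoeff (d := Fin 2) (star u : L2C) k =
      star (UnitAddTorus.mFourierCoeff (d := Fin 2) u (-k)) := by
    intro u k
    rw [← mFourierCoeff_star]
    refine integral_congr_ae ?_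
    filter_upwards [Lp.coeFn_star u] with x hx
    rw [hx, Pi.star_apply]
  have hf : star (complexify f) = complexify f := by
    refine Lp.ext ?_
    filter_upwards [Lp.coeFn_star (complexify f), Complex.ofRealCLM.coeFn_compLp f] with x h1 h2
    rw [h1, Pi.star_apply, complexify, h2]
    simp
  have hgs : star g = g := by
    apply (UnitAddTorus.mFourierBasis (d := Fin 2)).repr.injective
    ext k
    rw [UnitAddTorus.mFourierBasis_repr, UnitAddTorus.mFourierBasis_repr, hstar, hg]
    simp only [mFourierCoeff_riesz, rieszSymbol_neg]
    conv_rhs => rw [← hf, hstar]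
    simp
  refine Lp.ext ?_
  filter_upwards [Complex.ofRealCLM.coeFn_compLp (rieszSq f), Complex.reCLM.coeFn_compLp g,
    Lp.coeFn_star g] with x h1 h2 h3
  rw [hgs] at h3
  rw [complexify, h1, rieszSq, ← hg, h2]
  exact Complex.conj_eq_iff_re.mp h3.symm

/-! ### Sobolev spaces on the torus and their duals -/

/-- The test functions on the torus: smooth periodic functions on the plane. -/
def IsTest (φ : Plane → ℝ) : Prop := ContDiff ℝ ∞ φ ∧ IsPeriodic φ

/-- Multi-indices of length at most `k`. -/
abbrev MIdx (k : ℕ) := {α : Fin (k + 1) × Fin (k + 1) // (α.1 : ℕ) + α.2 ≤ k}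

/-- The multi-index `(0, 0)`. -/
def MIdx.zero (k : ℕ) : MIdx k := ⟨(0, 0), by simp⟩

/-- The derivative `∂^α φ` of a smooth function. -/
def mpd (a b : ℕ) (φ : Plane → ℝ) : Plane → ℝ := (pd 0)^[a] ((pd 1)^[b] φ)

/-- `g` is the weak derivative `∂₁^a ∂₂^b f` of `f` on the torus. -/
def IsWeakDeriv (a b : ℕ) (f g : L2R) : Prop :=
  ∀ φ : Plane → ℝ, IsTest φ →
    ∫ x, f x * descend (mpd a b φ) x ∂torusMeasure =
      (-1) ^ (a + b) * ∫ x, g x * descend φ x ∂torusMeasure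

theorem contDiff_pd (i : Fin 2) {φ : Plane → ℝ} (h : ContDiff ℝ ∞ φ) : ContDiff ℝ ∞ (pd i φ) :=
  (h.fderiv_right (m := ∞) (by simp)).clm_apply contDiff_const

theorem contDiff_mpd (a b : ℕ) {φ : Plane → ℝ} (h : ContDiff ℝ ∞ φ) :
    ContDiff ℝ ∞ (mpd a b φ) := by
  have key : ∀ (i : Fin 2) (n : ℕ) (φ : Plane → ℝ), ContDiff ℝ ∞ φ →
      ContDiff ℝ ∞ ((pd i)^[n] φ) := by
    intro i n
    induction n with
    | zero => exact fun φ h => h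
    | succ n ih => exact fun φ h => ih _ (contDiff_pd i h)
  exact key 0 a _ (key 1 b _ h)

theorem memLp_descend {φ : Plane → ℝ} (h : Continuous φ) :
    MemLp (descend φ) 2 torusMeasure := by
  obtain ⟨C, hC⟩ := (isCompact_univ_pi fun _ : Fin 2 =>
    (isCompact_Icc : IsCompact (Icc (0 : ℝ) 1))).exists_bound_of_continuousOn h.continuousOn
  refine MemLp.of_bound ?_ C (Filter.Eventually.of_forall fun x => ?_)
  · exact (h.measurable.comp (measurable_subtype_coe.comp
      (UnitAddTorus.measurableEquivPiIoc _).measurable)).aestronglyMeasurable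
  · refine hC _ fun i _ => ?_
    have := (UnitAddTorus.measurableEquivPiIoc (fun _ : Fin 2 => (0 : ℝ)) x).2 i
    exact ⟨this.1.le, this.2.trans_eq (zero_add 1)⟩

theorem integrable_mul_descend (f : L2R) {φ : Plane → ℝ} (h : ContDiff ℝ ∞ φ) :
    Integrable (fun x => f x * descend φ x) torusMeasure :=
  (Lp.memLp f).integrable_mul (memLp_descend h.continuous)

theorem integral_add_mul_descend (f g : L2R) {φ : Plane → ℝ} (h : ContDiff ℝ ∞ φ) :
    ∫ x, (f + g : L2R) x * descend φ x ∂torusMeasure =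
      ∫ x, f x * descend φ x ∂torusMeasure + ∫ x, g x * descend φ x ∂torusMeasure := by
  rw [← integral_add (integrable_mul_descend f h) (integrable_mul_descend g h)]
  refine integral_congr_ae ?_
  filter_upwards [Lp.coeFn_add f g] with x hx
  rw [hx, Pi.add_apply, add_mul]

theorem integral_smul_mul_descend (c : ℝ) (f : L2R) (φ : Plane → ℝ) :
    ∫ x, (c • f : L2R) x * descend φ x ∂torusMeasure =
      c * ∫ x, f x * descend φ x ∂torusMeasure := by
  rw [← integral_const_mul]
  refine integral_congr_ae ?_
  filter_upwards [Lp.coeFn_smul c f] with x hx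
  rw [hx, Pi.smul_apply, smul_eq_mul, mul_assoc]

/-- The Sobolev space `W^{k,2}(𝕋²)`. An element is the family `(∂^α f)_{|α| ≤ k}` of a function
`f ∈ L²(𝕋²)` all of whose weak derivatives of order at most `k` are in `L²(𝕋²)`; the norm is
`(∑_{|α| ≤ k} ‖∂^α f‖²)^{1/2}`. -/
def Sobolev (k : ℕ) : Submodule ℝ (PiLp 2 fun _ : MIdx k => L2R) where
  carrier := {F | ∀ α : MIdx k, IsWeakDeriv α.1.1 α.1.2 (F (MIdx.zero k)) (F α)}
  add_mem' := by
    intro F G hF hG α φ hφ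
    rw [PiLp.add_apply, PiLp.add_apply, integral_add_mul_descend _ _ (contDiff_mpd _ _ hφ.1),
      integral_add_mul_descend _ _ hφ.1, hF α φ hφ, hG α φ hφ, mul_add]
  zero_mem' := by
    intro α φ hφ
    have h : ∀ χ : Plane → ℝ, ∫ x, (0 : L2R) x * descend χ x ∂torusMeasure = 0 := by
      intro χ
      have := integral_smul_mul_descend 0 0 χ
      rwa [zero_smul, zero_mul] at this
    rw [PiLp.zero_apply, PiLp.zero_apply, h, h, mul_zero]
  smul_mem' := by
    intro c F hF α φ hφ
    rw [PiLp.smul_apply, PiLp.smul_apply, integral_smul_mul_descend, integral_smul_mul_descend,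
      hF α φ hφ]
    ring

/-- The inclusion of `W^{k,2}(𝕋²)` in `L²(𝕋²)`. -/
def Sobolev.fn (k : ℕ) : Sobolev k →L[ℝ] L2R :=
  (PiLp.proj 2 (fun _ : MIdx k => L2R) (MIdx.zero k)).comp (Sobolev k).subtypeL

/-- The element `v ↦ ∫ f v` of `W^{-k,2}(𝕋²)`, the dual space of `W^{k,2}(𝕋²)`, defined by
`f ∈ L²(𝕋²)`; the integral is written as the inner product of `L²(𝕋²)`. -/
def toDual (k : ℕ) (f : L2R) : StrongDual ℝ (Sobolev k) := (innerSL ℝ f).comp (Sobolev.fn k)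

theorem toDual_apply (k : ℕ) (f : L2R) (v : Sobolev k) :
    toDual k f v = ∫ x, Sobolev.fn k v x * f x ∂torusMeasure := by
  change inner ℝ f (Sobolev.fn k v) = _
  rw [L2.inner_def]
  rfl

/-! ### Initial data and the regularised system -/

/-- `g` is locally integrable and is the distributional derivative `∂f/∂x₁` on the plane. -/
def IsWeakPartialOne (f g : Plane → ℝ) : Prop :=
  LocallyIntegrable g ∧ ∀ φ : Plane → ℝ, ContDiff ℝ ∞ φ → HasCompactSupport φ →
    ∫ x, f x * pd 0 φ x = -∫ x, g x * φ x

/-- Membership in the Zygmund space `L log L(𝕋²)`. -/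
def MemLlogL (f : Torus → ℝ) : Prop :=
  Integrable f torusMeasure ∧
    Integrable (fun x => |f x| * Real.log (Real.exp 1 + |f x|)) torusMeasure

/-- The assumptions on an initial datum `ρ₀`: it is in `L²_loc(ℝ²)`, increases by `L` over a period
in `x₁`, is periodic in `x₂`, and `∂ρ₀/∂x₁` is a nonnegative function in `L log L(𝕋²)`. -/
structure IsInitialDatum (L : ℝ) (ρ₀ : Plane → ℝ) : Prop where
  memLp_loc : ∀ K : Set Plane, IsCompact K → MemLp ρ₀ 2 (volume.restrict K)
  shift_one : ∀ᵐ x, ρ₀ (x + e 0) = ρ₀ x + L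
  shift_two : ∀ᵐ x, ρ₀ (x + e 1) = ρ₀ x
  deriv_one : ∃ g, IsWeakPartialOne ρ₀ g ∧ (∀ᵐ x, 0 ≤ g x) ∧ MemLlogL (descend g)

/-- The profiles `η` of the mollifiers. -/
structure IsMollifier (η : Plane → ℝ) : Prop where
  contDiff : ContDiff ℝ ∞ η
  compact : HasCompactSupport η
  nonneg : ∀ x, 0 ≤ η x
  integral_eq_one : ∫ x, η x = 1

/-- The regularised initial datum
`ρ₀^ε(x) = (ρ₀ - L x₁) * η_ε (x) + (L + ε) x₁`, with `η_ε(y) = ε⁻² η(y / ε)`. -/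
def regDatum (η : Plane → ℝ) (L ε : ℝ) (ρ₀ : Plane → ℝ) (x : Plane) : ℝ :=
  (∫ y, (ρ₀ (x - y) - L * (x - y) 0) * ((ε ^ 2)⁻¹ * η (ε⁻¹ • y))) + (L + ε) * x 0

/-- `R₁²R₂² f` for a function `f` on the plane that is periodic and square integrable on a
period. -/
def rieszSqFn (f : Plane → ℝ) : L2R := rieszSq (toL2 (descend f))

/-- What is asked of each of `ρ^{+,ε}`, `ρ^{-,ε}` (first `s = 1`, then `s = -1`), where `u t`
stands for the velocity `R₁²R₂²(ρ^{+,ε} - ρ^{-,ε})` at time `t`: smoothness on `ℝ² × [0,T)`, the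
equation `∂ρ/∂t - ε Δρ = -s u ∂ρ/∂x₁`, the initial condition, growth `L + ε` over a period in
`x₁`, periodicity in `x₂`, and monotonicity in `x₁`. -/
structure IsComponent (η : Plane → ℝ) (L ε T s : ℝ) (u : ℝ → L2R) (ρ₀ : Plane → ℝ)
    (ρ : ℝ → Plane → ℝ) : Prop where
  smooth : ContDiffOn ℝ ∞ (fun p : ℝ × Plane => ρ p.1 p.2) (Ico 0 T ×ˢ univ)
  equation : ∀ t ∈ Ioo 0 T, ∀ᵐ x ∂torusMeasure,
    descend (dt ρ t) x - ε * descend (lap (ρ t)) x = -s * u t x * descend (pd 0 (ρ t)) x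
  initial : ∀ x, ρ 0 x = regDatum η L ε ρ₀ x
  shift_one : ∀ t ∈ Ico 0 T, ∀ x, ρ t (x + e 0) = ρ t x + (L + ε)
  shift_two : ∀ t ∈ Ico 0 T, ∀ x, ρ t (x + e 1) = ρ t x
  monotone : ∀ t ∈ Ico 0 T, ∀ x, 0 ≤ pd 0 (ρ t) x

/-- `(ρp, ρm) = (ρ^{+,ε}, ρ^{-,ε})` is a smooth solution of the regularised system on
`ℝ² × [0,T)` with regularised initial data. -/
structure IsSolution (η : Plane → ℝ) (L ε T : ℝ) (ρp₀ ρm₀ : Plane → ℝ)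
    (ρp ρm : ℝ → Plane → ℝ) : Prop where
  plus : IsComponent η L ε T 1 (fun t => rieszSqFn fun x => ρp t x - ρm t x) ρp₀ ρp
  minus : IsComponent η L ε T (-1) (fun t => rieszSqFn fun x => ρp t x - ρm t x) ρm₀ ρm

/-! ### The estimates -/

/-- The duality estimate with constant `C` for a family `f t`, `t ∈ (0,T)`, of functions in
`L²(𝕋²)`: for every `ψ ∈ L²((0,T); W^{k,2}(𝕋²))` the pairing is integrable in time and
`|∫_{(0,T)} ∫_{𝕋²} ψ f| ≤ C ‖ψ‖_{L²((0,T); W^{k,2}(𝕋²))}`. -/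
def DualityEstimate (k : ℕ) (T C : ℝ) (f : ℝ → L2R) : Prop :=
  ∀ ψ : ℝ → Sobolev k, MemLp ψ 2 (volume.restrict (Ioo 0 T)) →
    IntegrableOn (fun t => ∫ x, Sobolev.fn k (ψ t) x * f t x ∂torusMeasure) (Ioo 0 T) ∧
    |∫ t in Ioo 0 T, ∫ x, Sobolev.fn k (ψ t) x * f t x ∂torusMeasure| ≤
      C * (eLpNorm ψ 2 (volume.restrict (Ioo 0 T))).toReal

/-- The family `f` belongs to `L²((0,T); W^{-k,2}(𝕋²))` with norm at most `C`. -/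
def NegSobolevBound (k : ℕ) (T C : ℝ) (f : ℝ → L2R) : Prop :=
  MemLp (fun t => toDual k (f t)) 2 (volume.restrict (Ioo 0 T)) ∧
    eLpNorm (fun t => toDual k (f t)) 2 (volume.restrict (Ioo 0 T)) ≤ ENNReal.ofReal C

end Dislocation

end

/-!
Let `u = R₁²R₂²ρ` be the velocity. Testing the equations with `ln(∂₁ρ^± + δ)` bounds the time
derivative of the entropy `∑_± ∫ (∂₁ρ^± + δ) ln (∂₁ρ^± + δ)` by `-D/2 + O(δ)`, where
`D = ∑ k₁²k₂²/|k|⁴ · 4π²k₁² |c_k(ρ)|²`. The initial entropy is bounded uniformly in `ε` because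
mollification cannot increase it, so choosing `δ` of order `1/T` bounds `∫₀ᵀ D` independently of
`ε` and `T`. Moreover `D` controls the `W^{1,2}` norm of `u`, since
`(1 + |k|²) k₁²k₂²/|k|⁴ ≤ 4π²k₁²`.

The drift is handled by the limiting embedding `∫ a² ∂₁ρ^± ≤ Λ ‖a‖²_{W^{1,2}}`, where `Λ` depends
only on the entropy of `∂₁ρ^±`. By Cauchy–Schwarz with weight `∂₁ρ^±`, the drift
`∫ u ψ ∂₁ρ^±` is at most `Λ √D ‖ψ‖_{W^{1,2}}`. In part (i), self-adjointness moves `R₁²R₂²` onto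
`ψ` and the viscous term is again bounded by `√D ‖ψ‖_{W^{1,2}}`, as `k₁²k₂²/|k|⁴ · k_j² ≤ k₁²`.
In part (ii) it is bounded by the `L²` norm of `ρ^± - (L+ε) x₁`, for which the same embedding and
Gronwall's inequality give a bound depending on `T`.
-/

noncomputable section

namespace Dislocation

/-! ### Calculus on the torus -/

/-- The representative in the fundamental cell `(0,1]²` of a point of the torus. -/
def cellRep (x : Torus) : Plane :=
  (UnitAddTorus.measurableEquivPiIoc (fun _ : Fin 2 => (0 : ℝ)) x).1

/-- The quotient map from the plane to the torus. -/
def toTorus (x : Plane) : Torus := fun i => (x i : UnitAddCircle)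

theorem descend_apply (f : Plane → ℝ) (x : Torus) : descend f x = f (cellRep x) := rfl

theorem toTorus_cellRep (x : Torus) : toTorus (cellRep x) = x :=
  (UnitAddTorus.measurableEquivPiIoc (fun _ : Fin 2 => (0 : ℝ))).symm_apply_apply x

theorem cellRep_mem_Icc (x : Torus) : cellRep x ∈ Icc (0 : Plane) 1 := by
  have hx := (UnitAddTorus.measurableEquivPiIoc (fun _ : Fin 2 => (0 : ℝ)) x).2
  exact ⟨fun i => (hx i).1.le, fun i => (hx i).2.trans_eq (zero_add 1)⟩

theorem measurableEmbedding_cellRep : MeasurableEmbedding cellRep :=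
  (MeasurableEmbedding.subtype_coe (MeasurableSet.univ_pi' fun _ => measurableSet_Ioc)).comp
    (UnitAddTorus.measurableEquivPiIoc (fun _ : Fin 2 => (0 : ℝ))).measurableEmbedding

theorem measurePreserving_cellRep :
    MeasurePreserving cellRep torusMeasure (volume.restrict (Icc (0 : Plane) 1)) := by
  have hcell : volume.restrict {x : Plane | ∀ i, x i ∈ Ioc (0 : ℝ) (0 + 1)} =
      volume.restrict (Icc (0 : Plane) 1) := by
    refine Measure.restrict_congr_set ?_
    have hpi : {x : Plane | ∀ i, x i ∈ Ioc (0 : ℝ) (0 + 1)} =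
        univ.pi fun i => Ioc ((0 : Plane) i) ((1 : Plane) i) := by
      ext x
      simp
    rw [hpi]
    exact Measure.univ_pi_Ioc_ae_eq_Icc
  rw [← hcell]
  exact (measurePreserving_subtype_coe
    (MeasurableSet.univ_pi' fun _ => measurableSet_Ioc)).comp
      (UnitAddTorus.measurePreserving_equivPiIoc fun _ : Fin 2 => (0 : ℝ))

theorem integral_descend (f : Plane → ℝ) :
    ∫ x, descend f x ∂torusMeasure = ∫ x in Icc (0 : Plane) 1, f x :=
  measurePreserving_cellRep.integral_comp measurableEmbedding_cellRep f

theorem integrable_descend {f : Plane → ℝ} (h : Continuous f) :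
    Integrable (descend f) torusMeasure :=
  (memLp_descend h).integrable one_le_two

theorem integrable_descend_mul {f g : Plane → ℝ} (hf : Continuous f) (hg : Continuous g) :
    Integrable (fun x => descend f x * descend g x) torusMeasure :=
  integrable_descend (hf.mul hg)

theorem continuous_pd (i : Fin 2) {f : Plane → ℝ} (h : ContDiff ℝ 1 f) : Continuous (pd i f) :=
  (h.continuous_fderiv one_ne_zero).clm_apply continuous_const

theorem IsPeriodic.pd {f : Plane → ℝ} (hf : IsPeriodic f) (i : Fin 2) : IsPeriodic (pd i f) := by
  intro j x
  rw [Dislocation.pd, Dislocation.pd, ← fderiv_comp_add_right, funext (hf j)]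

theorem pd_mul {i : Fin 2} {f g : Plane → ℝ} {x : Plane} (hf : DifferentiableAt ℝ f x)
    (hg : DifferentiableAt ℝ g x) :
    pd i (fun y => f y * g y) x = f x * pd i g x + pd i f x * g x := by
  simp [pd, fderiv_fun_mul hf hg, mul_comm]

theorem setIntegral_Icc_pd (j : Fin 2) {f : Plane → ℝ} (h : ContDiff ℝ 1 f) :
    ∫ x in Icc (0 : Plane) 1, pd j f x =
      (∫ y in Icc (0 : Fin 1 → ℝ) 1, f (j.insertNth 1 y)) -
        ∫ y in Icc (0 : Fin 1 → ℝ) 1, f (j.insertNth 0 y) := by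
  have key := integral_divergence_of_hasFDerivAt_off_countable' (n := 1) (E := ℝ)
    (0 : Plane) 1 zero_le_one (Pi.single j f) (Pi.single j (fderiv ℝ f)) ∅ countable_empty
    (fun i => by
      obtain rfl | hij := eq_or_ne i j
      · simpa using h.continuous.continuousOn
      · simpa [hij] using continuous_zero.continuousOn)
    (fun x _ i => by
      obtain rfl | hij := eq_or_ne i j
      · simpa using (h.differentiable one_ne_zero x).hasFDerivAt
      · simpa [hij] using hasFDerivAt_zero x)
    (by
      refine Continuous.integrableOn_Icc (continuous_finsetSum _ fun i _ => ?_)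
      obtain rfl | hij := eq_or_ne i j
      · simpa using (h.continuous_fderiv one_ne_zero).clm_apply continuous_const
      · simpa [hij] using continuous_const)
  have hdiv (x : Plane) :
      ∑ i, (Pi.single j (fderiv ℝ f) : Fin 2 → Plane → Plane →L[ℝ] ℝ) i x (Pi.single i 1) =
        pd j f x := by
    rw [Finset.sum_eq_single j (fun i _ hij => by simp [hij]) (by simp)]
    simp [pd, e]
  simp only [hdiv] at key
  rw [key, Finset.sum_eq_single j (fun i _ hij => by simp [hij]) (by simp)]
  simp only [Pi.single_eq_same]
  rfl

theorem integral_descend_pd (j : Fin 2) {f : Plane → ℝ} (h : ContDiff ℝ 1 f)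
    (hp : IsPeriodic f) : ∫ x, descend (pd j f) x ∂torusMeasure = 0 := by
  have hface (y : Fin 1 → ℝ) : (j.insertNth 1 y : Plane) = (j.insertNth 0 y : Plane) + e j := by
    ext i
    fin_cases i <;> fin_cases j <;> simp [e, Fin.insertNth, Fin.succAboveCases]
  simp only [integral_descend, setIntegral_Icc_pd j h, hface, hp j _, sub_self]

theorem integral_descend_mul_pd (j : Fin 2) {f g : Plane → ℝ} (hf : ContDiff ℝ 1 f)
    (hg : ContDiff ℝ 1 g) (hfp : IsPeriodic f) (hgp : IsPeriodic g) :
    ∫ x, descend f x * descend (pd j g) x ∂torusMeasure =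
      -∫ x, descend (pd j f) x * descend g x ∂torusMeasure := by
  have hsplit (x : Torus) : descend (pd j fun y => f y * g y) x =
      descend f x * descend (pd j g) x + descend (pd j f) x * descend g x :=
    pd_mul (hf.differentiable one_ne_zero _) (hg.differentiable one_ne_zero _)
  have hzero := integral_descend_pd j (hf.mul hg) fun i x => by simp only [hfp i x, hgp i x]
  simp only [hsplit] at hzero
  rw [integral_add (integrable_descend_mul hf.continuous (continuous_pd j hg))
    (integrable_descend_mul (continuous_pd j hf) hg.continuous)] at hzero
  exact eq_neg_of_add_eq_zero_left hzero

theorem coeFn_toL2 {f : Plane → ℝ} (h : Continuous f) :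
    (toL2 (descend f) : Torus → ℝ) =ᵐ[torusMeasure] descend f := by
  rw [toL2, dif_pos (memLp_descend h)]
  exact MemLp.coeFn_toLp _

theorem integral_toL2_mul {f : Plane → ℝ} (h : Continuous f) (g : Torus → ℝ) :
    ∫ x, toL2 (descend f) x * g x ∂torusMeasure = ∫ x, descend f x * g x ∂torusMeasure := by
  refine integral_congr_ae ?_
  filter_upwards [coeFn_toL2 h] with x hx
  rw [hx]

theorem norm_sq_eq_integral {α : Type*} [MeasurableSpace α] {μ : Measure α} (f : Lp ℝ 2 μ) :
    ‖f‖ ^ 2 = ∫ x, f x ^ 2 ∂μ := by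
  rw [← real_inner_self_eq_norm_sq, L2.inner_def]
  simp [sq]

theorem norm_toL2_sq {f : Plane → ℝ} (h : Continuous f) :
    ‖toL2 (descend f)‖ ^ 2 = ∫ x, descend f x ^ 2 ∂torusMeasure := by
  rw [norm_sq_eq_integral]
  refine integral_congr_ae ?_
  filter_upwards [coeFn_toL2 h] with x hx
  rw [hx]

/-! ### Fourier coefficients -/

/-- The `k`-th Fourier coefficient of a real `L²` function on the torus. -/
def coeff (f : L2R) (k : Fin 2 → ℤ) : ℂ :=
  UnitAddTorus.mFourierCoeff (d := Fin 2) (complexify f) k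

theorem coeFn_complexify (f : L2R) :
    (complexify f : Torus → ℂ) =ᵐ[torusMeasure] fun x => (f x : ℂ) :=
  Complex.ofRealCLM.coeFn_compLp f

theorem hasSum_conj_coeff_mul_coeff (f g : L2R) :
    HasSum (fun k => starRingEnd ℂ (coeff f k) * coeff g k)
      ((∫ x, f x * g x ∂torusMeasure : ℝ) : ℂ) := by
  have h := UnitAddTorus.hasSum_prod_mFourierCoeff (d := Fin 2) (complexify f) (complexify g)
  convert! h using 1
  rw [← integral_complex_ofReal]
  refine integral_congr_ae ?_
  filter_upwards [coeFn_complexify f, coeFn_complexify g] with x hf hg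
  simp [hf, hg]

theorem hasSum_norm_coeff_sq (f : L2R) :
    HasSum (fun k => ‖coeff f k‖ ^ 2) (‖f‖ ^ 2) := by
  have h := UnitAddTorus.hasSum_sq_mFourierCoeff (d := Fin 2) (complexify f)
  rw [norm_sq_eq_integral]
  convert! h using 1
  refine integral_congr_ae ?_
  filter_upwards [coeFn_complexify f] with x hf
  simp [hf]

theorem sum_norm_coeff_sq_le (f : L2R) (S : Finset (Fin 2 → ℤ)) :
    ∑ k ∈ S, ‖coeff f k‖ ^ 2 ≤ ‖f‖ ^ 2 :=
  sum_le_hasSum S (fun _ _ => by positivity) (hasSum_norm_coeff_sq f)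

theorem norm_le_sqrt_mul_sqrt_of_hasSum {ι E : Type*} [SeminormedAddCommGroup E] {F : ι → E}
    {s : E} (h : HasSum F s) {a b : ι → ℝ} (hab : ∀ k, ‖F k‖ ≤ a k * b k) {A B : ℝ}
    (hA : ∀ S : Finset ι, ∑ k ∈ S, a k ^ 2 ≤ A) (hB : ∀ S : Finset ι, ∑ k ∈ S, b k ^ 2 ≤ B) :
    ‖s‖ ≤ √A * √B := by
  refine le_of_tendsto h.norm (Filter.Eventually.of_forall fun S => ?_)
  calc ‖∑ k ∈ S, F k‖
      ≤ ∑ k ∈ S, a k * b k := (norm_sum_le _ _).trans (Finset.sum_le_sum fun k _ => hab k)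
    _ ≤ √(∑ k ∈ S, a k ^ 2) * √(∑ k ∈ S, b k ^ 2) := Real.sum_mul_le_sqrt_mul_sqrt S a b
    _ ≤ √A * √B := by gcongr; exacts [hA S, hB S]

/-- The Fourier symbol `k₁² k₂² / |k|⁴` of `R₁²R₂²`. -/
def rieszSqSymbol (k : Fin 2 → ℤ) : ℝ := rieszSymbol 0 k ^ 2 * rieszSymbol 1 k ^ 2

theorem coeff_rieszSq (f : L2R) (k : Fin 2 → ℤ) :
    coeff (rieszSq f) k = rieszSqSymbol k * coeff f k := by
  rw [coeff, complexify_rieszSq]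
  simp only [mFourierCoeff_riesz, coeff, rieszSqSymbol]
  push_cast
  ring

theorem rieszSqSymbol_nonneg (k : Fin 2 → ℤ) : 0 ≤ rieszSqSymbol k := by
  unfold rieszSqSymbol
  positivity

theorem rieszSymbol_sq_le_one (i : Fin 2) (k : Fin 2 → ℤ) : rieszSymbol i k ^ 2 ≤ 1 :=
  (sq_le_one_iff_abs_le_one _).2 (abs_rieszSymbol_le i k)

theorem rieszSqSymbol_le_one (k : Fin 2 → ℤ) : rieszSqSymbol k ≤ 1 :=
  mul_le_one₀ (rieszSymbol_sq_le_one 0 k) (sq_nonneg _) (rieszSymbol_sq_le_one 1 k)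

theorem rieszSymbol_sq_mul (i : Fin 2) (k : Fin 2 → ℤ) :
    rieszSymbol i k ^ 2 * ((k 0 : ℝ) ^ 2 + (k 1 : ℝ) ^ 2) = (k i : ℝ) ^ 2 := by
  obtain rfl | hk := eq_or_ne k 0
  · simp
  have hpos : (k 0 : ℝ) ^ 2 + (k 1 : ℝ) ^ 2 ≠ 0 := by
    contrapose! hk
    obtain ⟨h0, h1⟩ := (add_eq_zero_iff_of_nonneg (sq_nonneg _) (sq_nonneg _)).1 hk
    ext i
    fin_cases i
    · simpa using h0
    · simpa using h1
  rw [rieszSymbol, if_neg hk, div_pow, Real.sq_sqrt (by positivity), div_mul_cancel₀ _ hpos]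

theorem rieszSqSymbol_mul_le (k : Fin 2 → ℤ) :
    rieszSqSymbol k * ((k 0 : ℝ) ^ 2 + (k 1 : ℝ) ^ 2) ≤ (k 0 : ℝ) ^ 2 :=
  calc rieszSqSymbol k * ((k 0 : ℝ) ^ 2 + (k 1 : ℝ) ^ 2)
      = (k 0 : ℝ) ^ 2 * rieszSymbol 1 k ^ 2 := by
        rw [rieszSqSymbol, mul_right_comm, rieszSymbol_sq_mul]
    _ ≤ (k 0 : ℝ) ^ 2 := mul_le_of_le_one_right (sq_nonneg _) (rieszSymbol_sq_le_one 1 k)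

theorem rieszSqSymbol_le_mul_sq (k : Fin 2 → ℤ) :
    rieszSqSymbol k ≤ rieszSqSymbol k * (k 0 : ℝ) ^ 2 := by
  obtain h | h := eq_or_ne (k 0) 0
  · simp [rieszSqSymbol, rieszSymbol, h]
  · refine le_mul_of_one_le_right (rieszSqSymbol_nonneg k) ?_
    exact_mod_cast (one_le_sq_iff_one_le_abs _).2 (Int.one_le_abs h)

/-- The phase `2π k·x`. -/
def phase (k : Fin 2 → ℤ) (x : Plane) : ℝ := 2 * Real.pi * (k 0 * x 0 + k 1 * x 1)

/-- The real trigonometric function `Re (z e^{2πi k·x})`. -/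
def wave (k : Fin 2 → ℤ) (z : ℂ) (x : Plane) : ℝ :=
  z.re * Real.cos (phase k x) - z.im * Real.sin (phase k x)

theorem phase_add_e (k : Fin 2 → ℤ) (i : Fin 2) (x : Plane) :
    phase k (x + e i) = phase k x + k i * (2 * Real.pi) := by
  fin_cases i <;> simp [phase, e] <;> ring

theorem contDiff_phase (k : Fin 2 → ℤ) : ContDiff ℝ ∞ (phase k) := by
  unfold phase
  fun_prop

theorem pd_phase (i : Fin 2) (k : Fin 2 → ℤ) (x : Plane) :
    pd i (phase k) x = 2 * Real.pi * k i := by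
  have hproj (j : Fin 2) :=
    (ContinuousLinearMap.proj (R := ℝ) (φ := fun _ : Fin 2 => ℝ) j).hasFDerivAt (x := x)
  have h : HasFDerivAt (phase k) _ x :=
    (((hproj 0).const_mul (k 0 : ℝ)).add ((hproj 1).const_mul (k 1 : ℝ))).const_mul (2 * Real.pi)
  rw [pd, h.fderiv]
  fin_cases i <;> simp [e]

theorem isTest_wave (k : Fin 2 → ℤ) (z : ℂ) : IsTest (wave k z) := by
  refine ⟨?_, fun i x => ?_⟩
  · exact (contDiff_const.mul (Real.contDiff_cos.comp (contDiff_phase k))).sub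
      (contDiff_const.mul (Real.contDiff_sin.comp (contDiff_phase k)))
  · rw [wave, phase_add_e, Real.cos_add_int_mul_two_pi, Real.sin_add_int_mul_two_pi, wave]

theorem pd_wave (i : Fin 2) (k : Fin 2 → ℤ) (z : ℂ) :
    pd i (wave k z) = wave k (2 * Real.pi * k i * Complex.I * z) := by
  funext x
  have hphase := ((contDiff_phase k).differentiable (by simp) x).hasFDerivAt
  have h : HasFDerivAt (wave k z) _ x :=
    (hphase.cos.const_mul z.re).sub (hphase.sin.const_mul z.im)
  have hi : fderiv ℝ (phase k) x (e i) = 2 * Real.pi * k i := pd_phase i k x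
  rw [pd, h.fderiv]
  simp only [sub_apply, smul_apply, hi, smul_eq_mul, neg_mul, mul_neg, wave, Complex.mul_re,
    Complex.re_ofNat, Complex.ofReal_re, Complex.im_ofNat, Complex.ofReal_im, mul_zero, sub_zero,
    Complex.intCast_re, Complex.mul_im, zero_mul, add_zero, Complex.intCast_im, Complex.I_re,
    Complex.I_im, mul_one, sub_self, zero_sub, zero_add]
  ring

theorem mpd_wave (a b : ℕ) (k : Fin 2 → ℤ) (z : ℂ) :
    mpd a b (wave k z) = wave k
      ((2 * Real.pi * k 0 * Complex.I) ^ a * (2 * Real.pi * k 1 * Complex.I) ^ b * z) := by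
  have hiter (i : Fin 2) (n : ℕ) (z : ℂ) :
      (pd i)^[n] (wave k z) = wave k ((2 * Real.pi * k i * Complex.I) ^ n * z) := by
    induction n generalizing z with
    | zero => simp
    | succ n ih => rw [Function.iterate_succ_apply, pd_wave, ih, pow_succ, mul_assoc (_ ^ n)]
  rw [mpd, hiter, hiter, mul_assoc (_ ^ a)]

theorem descend_wave (k : Fin 2 → ℤ) (z : ℂ) (x : Torus) :
    descend (wave k z) x = (z * starRingEnd ℂ (UnitAddTorus.mFourier (-k) x)).re := by
  have hexp (y : Plane) :
      UnitAddTorus.mFourier (-k) (toTorus y) = Complex.exp ((-phase k y : ℝ) * Complex.I) := by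
    simp only [UnitAddTorus.mFourier, ContinuousMap.coe_mk, Fin.prod_univ_two, toTorus,
      fourier_coe_apply, ← Complex.exp_add, phase]
    congr 1
    push_cast
    simp only [Pi.neg_apply, Int.cast_neg, mul_neg, neg_mul, div_one]
    ring
  rw [← congrArg (UnitAddTorus.mFourier (-k)) (toTorus_cellRep x), hexp, Complex.exp_mul_I,
    ← Complex.ofReal_cos, ← Complex.ofReal_sin, descend_apply, wave]
  simp [-Complex.ofReal_cos, -Complex.ofReal_sin]

theorem integral_mul_descend_wave (f : L2R) (k : Fin 2 → ℤ) (z : ℂ) :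
    ∫ x, f x * descend (wave k z) x ∂torusMeasure = (z * starRingEnd ℂ (coeff f k)).re := by
  have hint : Integrable (fun x => UnitAddTorus.mFourier (-k) x • complexify f x) torusMeasure :=
    ((Lp.memLp (complexify f)).integrable one_le_two).bdd_mul
      (UnitAddTorus.mFourier (-k)).continuous.aestronglyMeasurable
      (Filter.Eventually.of_forall fun x => (UnitAddTorus.mFourier (-k)).norm_coe_le_norm x)
  have hinner (w : ℂ) : (z * starRingEnd ℂ w).re = inner ℝ z w := by
    simp [Complex.inner, mul_comm]
  rw [hinner]
  refine Eq.trans (integral_congr_ae ?_) (integral_inner hint z)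
  filter_upwards [coeFn_complexify f] with x hx
  rw [descend_wave, hx, ← hinner]
  simp only [Complex.mul_re, Complex.conj_re, Complex.conj_im, mul_neg, sub_neg_eq_add, smul_eq_mul,
    map_mul, Complex.conj_ofReal, Complex.ofReal_re, Complex.ofReal_im, mul_zero, sub_zero,
    Complex.mul_im, neg_mul, zero_add]
  ring

theorem IsWeakDeriv.coeff_eq {a b : ℕ} {f g : L2R} (h : IsWeakDeriv a b f g)
    (k : Fin 2 → ℤ) :
    coeff g k = (2 * Real.pi * k 0 * Complex.I) ^ a * (2 * Real.pi * k 1 * Complex.I) ^ b *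
      coeff f k := by
  set m : ℂ := (2 * Real.pi * k 0 * Complex.I) ^ a * (2 * Real.pi * k 1 * Complex.I) ^ b with hm
  have hconj : starRingEnd ℂ m = (-1) ^ (a + b) * m := by
    simp only [hm, map_mul, map_pow, Complex.conj_ofReal, Complex.conj_I, map_intCast, map_ofNat,
      mul_neg, pow_add, neg_pow (_ * Complex.I)]
    ring
  have hpair (z : ℂ) : (z * starRingEnd ℂ (m * coeff f k)).re =
      (z * starRingEnd ℂ (coeff g k)).re := by
    have hz := h _ (isTest_wave k z)
    rw [mpd_wave, integral_mul_descend_wave, integral_mul_descend_wave, ← hm] at hz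
    have hsign : ((-1 : ℝ) ^ (a + b)) * (-1) ^ (a + b) = 1 := by
      rw [← mul_pow]; norm_num
    calc (z * starRingEnd ℂ (m * coeff f k)).re
        = (-1) ^ (a + b) * (m * z * starRingEnd ℂ (coeff f k)).re := by
          rw [map_mul, hconj, ← Complex.re_ofReal_mul]
          push_cast
          ring_nf
      _ = (z * starRingEnd ℂ (coeff g k)).re := by rw [hz, ← mul_assoc, hsign, one_mul]
  apply Complex.ext
  · simpa using (hpair 1).symm
  · simpa [add_comm] using (hpair Complex.I).symm

theorem isWeakDeriv_pd_zero {f : Plane → ℝ} (h : ContDiff ℝ 1 f) (hp : IsPeriodic f) :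
    IsWeakDeriv 1 0 (toL2 (descend f)) (toL2 (descend (pd 0 f))) := by
  intro φ hφ
  rw [integral_toL2_mul h.continuous, integral_toL2_mul (continuous_pd 0 h), pow_one, neg_one_mul]
  exact integral_descend_mul_pd 0 h (hφ.1.of_le (by simp)) hp hφ.2

theorem isWeakDeriv_pd_one {f : Plane → ℝ} (h : ContDiff ℝ 1 f) (hp : IsPeriodic f) :
    IsWeakDeriv 0 1 (toL2 (descend f)) (toL2 (descend (pd 1 f))) := by
  intro φ hφ
  rw [integral_toL2_mul h.continuous, integral_toL2_mul (continuous_pd 1 h), pow_one, neg_one_mul]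
  exact integral_descend_mul_pd 1 h (hφ.1.of_le (by simp)) hp hφ.2

theorem coeff_pd (j : Fin 2) {f : Plane → ℝ} (h : ContDiff ℝ 1 f) (hp : IsPeriodic f)
    (k : Fin 2 → ℤ) :
    coeff (toL2 (descend (pd j f))) k =
      2 * Real.pi * k j * Complex.I * coeff (toL2 (descend f)) k := by
  fin_cases j
  · simpa using (isWeakDeriv_pd_zero h hp).coeff_eq k
  · simpa using (isWeakDeriv_pd_one h hp).coeff_eq k

/-! ### A limiting Sobolev inequality against densities in `L log L` -/

/-- The Fourier weight `1 + |k|²` of the norm of `W^{1,2}(𝕋²)`. -/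
def freqWeight (k : Fin 2 → ℤ) : ℝ := 1 + (k 0 : ℝ) ^ 2 + (k 1 : ℝ) ^ 2

/-- The squared norm of `a` in `W^{1,2}(𝕋²)`, in the form `∑ (1 + |k|²) |c_k(a)|²`, is at most `A`.
The bound on finite partial sums contains the convergence of the series. -/
def H1Bound (a : L2R) (A : ℝ) : Prop :=
  ∀ S : Finset (Fin 2 → ℤ), ∑ k ∈ S, freqWeight k * ‖coeff a k‖ ^ 2 ≤ A

theorem one_le_freqWeight (k : Fin 2 → ℤ) : 1 ≤ freqWeight k := by
  rw [freqWeight, add_assoc]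
  exact le_add_of_nonneg_right (by positivity)

theorem freqWeight_pos (k : Fin 2 → ℤ) : 0 < freqWeight k :=
  one_pos.trans_le (one_le_freqWeight k)

theorem H1Bound.nonneg {a : L2R} {A : ℝ} (h : H1Bound a A) : 0 ≤ A := by simpa using h ∅

theorem H1Bound.norm_sq_le {a : L2R} {A : ℝ} (h : H1Bound a A) : ‖a‖ ^ 2 ≤ A :=
  hasSum_le_of_sum_le (hasSum_norm_coeff_sq a) fun S =>
    (Finset.sum_le_sum fun k _ =>
      le_mul_of_one_le_left (sq_nonneg _) (one_le_freqWeight k)).trans (h S)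

/-- The frequencies with `|k|_∞ ≤ 2^m`. -/
def freqBox (m : ℕ) : Finset (Fin 2 → ℤ) :=
  Fintype.piFinset fun _ => Finset.Icc (-(2 : ℤ) ^ m) (2 ^ m)

theorem mem_freqBox {m : ℕ} {k : Fin 2 → ℤ} : k ∈ freqBox m ↔ ∀ i, |k i| ≤ 2 ^ m := by
  simp [freqBox, abs_le]

theorem freqBox_mono : Monotone freqBox := fun m n hmn k hk => by
  rw [mem_freqBox] at hk ⊢
  exact fun i => (hk i).trans (pow_le_pow_right₀ one_le_two hmn)

theorem card_freqBox (m : ℕ) : (freqBox m).card = (2 * 2 ^ m + 1) ^ 2 := by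
  have hside : (Finset.Icc (-(2 : ℤ) ^ m) (2 ^ m)).card = 2 * 2 ^ m + 1 := by
    have hlen : (2 : ℤ) ^ m + 1 - -2 ^ m = ((2 * 2 ^ m + 1 : ℕ) : ℤ) := by
      push_cast
      ring
    rw [Int.card_Icc, hlen, Int.toNat_natCast]
  simp [freqBox, hside]

theorem two_pow_mul_two_pow (m : ℕ) : (2 : ℝ) ^ m * 2 ^ m = 4 ^ m := by
  rw [← mul_pow]
  norm_num

theorem four_pow_le_freqWeight {m : ℕ} {k : Fin 2 → ℤ} (h : k ∉ freqBox m) :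
    (4 : ℝ) ^ m ≤ freqWeight k := by
  rw [mem_freqBox] at h
  push Not at h
  obtain ⟨i, hi⟩ := h
  have hpow : (2 : ℝ) ^ m ≤ |(k i : ℝ)| := by exact_mod_cast hi.le
  have hweight : (k i : ℝ) ^ 2 ≤ freqWeight k := by
    rw [freqWeight]
    fin_cases i <;> simp only [Fin.zero_eta, Fin.mk_one] <;>
      linarith [sq_nonneg (k 0 : ℝ), sq_nonneg (k 1 : ℝ)]
  calc (4 : ℝ) ^ m = 2 ^ m * 2 ^ m := (two_pow_mul_two_pow m).symm
    _ ≤ |(k i : ℝ)| * |(k i : ℝ)| := by gcongr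
    _ = (k i : ℝ) ^ 2 := abs_mul_abs_self _ |>.trans (sq _).symm
    _ ≤ freqWeight k := hweight

theorem sum_inv_freqWeight_shell_le (m : ℕ) :
    ∑ k ∈ freqBox (m + 1) \ freqBox m, (freqWeight k)⁻¹ ≤ 36 := by
  calc ∑ k ∈ freqBox (m + 1) \ freqBox m, (freqWeight k)⁻¹
      ≤ ∑ _k ∈ freqBox (m + 1) \ freqBox m, ((4 : ℝ) ^ m)⁻¹ := by
        refine Finset.sum_le_sum fun k hk => ?_
        have := four_pow_le_freqWeight (Finset.mem_sdiff.1 hk).2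
        gcongr
    _ ≤ ∑ _k ∈ freqBox (m + 1), ((4 : ℝ) ^ m)⁻¹ :=
        Finset.sum_le_sum_of_subset_of_nonneg Finset.sdiff_subset fun _ _ _ => by positivity
    _ ≤ 36 := by
        have h1 : (1 : ℝ) ≤ 2 ^ m := one_le_pow₀ one_le_two
        rw [Finset.sum_const, nsmul_eq_mul, card_freqBox, ← div_eq_mul_inv,
          div_le_iff₀ (by positivity), ← two_pow_mul_two_pow, pow_succ 2 m]
        push_cast
        nlinarith

theorem sum_inv_freqWeight_le (m : ℕ) :
    ∑ k ∈ freqBox m, (freqWeight k)⁻¹ ≤ 36 * ((m : ℝ) + 1) := by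
  induction m with
  | zero =>
    calc ∑ k ∈ freqBox 0, (freqWeight k)⁻¹ ≤ ∑ _k ∈ freqBox 0, (1 : ℝ) :=
          Finset.sum_le_sum fun k _ => inv_le_one_of_one_le₀ (one_le_freqWeight k)
      _ ≤ 36 * ((0 : ℕ) + 1) := by
        rw [Finset.sum_const, nsmul_eq_mul, card_freqBox]
        norm_num
  | succ m ih =>
    rw [← Finset.sum_sdiff (freqBox_mono m.le_succ)]
    push_cast
    linarith [sum_inv_freqWeight_shell_le m]

/-- The partial sum over `|k|_∞ ≤ 2^m` of the Fourier series of `a`. -/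
def lowPart (a : L2R) (m : ℕ) : L2C :=
  ∑ k ∈ freqBox m, coeff a k • UnitAddTorus.mFourierLp 2 k

theorem ae_norm_lowPart_le_sum (a : L2R) (m : ℕ) :
    ∀ᵐ x ∂torusMeasure, ‖lowPart a m x‖ ≤ ∑ k ∈ freqBox m, ‖coeff a k‖ := by
  have hterm : ∀ᵐ x ∂torusMeasure, ∀ k,
      ‖(coeff a k • UnitAddTorus.mFourierLp 2 k : L2C) x‖ ≤ ‖coeff a k‖ := by
    refine ae_all_iff.2 fun k => ?_
    filter_upwards [Lp.coeFn_smul (coeff a k) (UnitAddTorus.mFourierLp 2 k : L2C),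
      UnitAddTorus.coeFn_mFourierLp 2 k] with x hsmul hmono
    rw [hsmul, Pi.smul_apply, hmono, norm_smul]
    exact mul_le_of_le_one_right (norm_nonneg _)
      (((UnitAddTorus.mFourier k).norm_coe_le_norm x).trans_eq UnitAddTorus.mFourier_norm)
  have hsum : (lowPart a m : Torus → ℂ) =ᵐ[torusMeasure]
      fun x => ∑ k ∈ freqBox m, (coeff a k • UnitAddTorus.mFourierLp 2 k : L2C) x :=
    Lp.coeFn_fun_finsetSum _ _
  filter_upwards [hterm, hsum] with x hx hsx
  rw [hsx]
  exact (norm_sum_le _ _).trans (Finset.sum_le_sum fun k _ => hx k)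

theorem H1Bound.ae_norm_lowPart_sq_le {a : L2R} {A : ℝ} (h : H1Bound a A) (m : ℕ) :
    ∀ᵐ x ∂torusMeasure, ‖lowPart a m x‖ ^ 2 ≤ 36 * (m + 1) * A := by
  filter_upwards [ae_norm_lowPart_le_sum a m] with x hx
  calc ‖lowPart a m x‖ ^ 2
      ≤ (∑ k ∈ freqBox m, ‖coeff a k‖) ^ 2 := by gcongr
    _ ≤ (∑ k ∈ freqBox m, (freqWeight k)⁻¹) *
          ∑ k ∈ freqBox m, freqWeight k * ‖coeff a k‖ ^ 2 :=
        Finset.sum_sq_le_sum_mul_sum_of_sq_le_mul _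
          (fun k _ => (inv_pos.2 (freqWeight_pos k)).le)
          (fun k _ => mul_nonneg (freqWeight_pos k).le (sq_nonneg _))
          fun k _ => by rw [inv_mul_cancel_left₀ (freqWeight_pos k).ne']
    _ ≤ 36 * (m + 1) * A :=
        mul_le_mul (sum_inv_freqWeight_le m) (h _)
          (Finset.sum_nonneg fun k _ => mul_nonneg (freqWeight_pos k).le (sq_nonneg _))
          (by positivity)

open Classical in
theorem mFourierCoeff_sub_lowPart (a : L2R) (m : ℕ) (k : Fin 2 → ℤ) :
    UnitAddTorus.mFourierCoeff (d := Fin 2) (complexify a - lowPart a m : L2C) k =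
      if k ∈ freqBox m then 0 else coeff a k := by
  have hrepr (l : Fin 2 → ℤ) :
      (UnitAddTorus.mFourierBasis (d := Fin 2)).repr (UnitAddTorus.mFourierLp 2 l) =
        lp.single 2 l 1 := by
    rw [← UnitAddTorus.coe_mFourierBasis, HilbertBasis.repr_self]
  rw [← UnitAddTorus.mFourierBasis_repr, map_sub, lowPart, map_sum]
  simp only [map_smul, hrepr]
  rw [lp.coeFn_sub, Pi.sub_apply, lp.coeFn_sum, Finset.sum_apply]
  simp only [lp.coeFn_smul, Pi.smul_apply, lp.coeFn_single, Pi.single_apply, smul_eq_mul,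
    mul_ite, mul_one, mul_zero]
  rw [UnitAddTorus.mFourierBasis_repr, Finset.sum_ite_eq]
  split_ifs <;> simp [coeff]

theorem H1Bound.integral_norm_sub_lowPart_sq_le {a : L2R} {A : ℝ} (h : H1Bound a A) (m : ℕ) :
    ∫ x, ‖(complexify a - lowPart a m : L2C) x‖ ^ 2 ∂torusMeasure ≤ A / 4 ^ m := by
  classical
  refine hasSum_le_of_sum_le
    (UnitAddTorus.hasSum_sq_mFourierCoeff (d := Fin 2) (complexify a - lowPart a m)) fun S => ?_
  rw [le_div_iff₀ (by positivity), Finset.sum_mul]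
  refine (Finset.sum_le_sum fun k _ => ?_).trans (h S)
  rw [mFourierCoeff_sub_lowPart, mul_comm]
  split_ifs with hk
  · simpa using mul_nonneg (freqWeight_pos k).le (sq_nonneg _)
  · gcongr
    exact four_pow_le_freqWeight hk

theorem ae_abs_le_norm_lowPart_add (a : L2R) (m : ℕ) :
    ∀ᵐ x ∂torusMeasure,
      |a x| ≤ ‖lowPart a m x‖ + ‖(complexify a - lowPart a m : L2C) x‖ := by
  filter_upwards [coeFn_complexify a, Lp.coeFn_sub (complexify a) (lowPart a m)] with x hx hsub
  rw [hsub, Pi.sub_apply, hx, ← Real.norm_eq_abs, ← Complex.norm_real]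
  exact norm_le_norm_add_norm_sub' _ _

theorem integrable_sq_mul {α : Type*} [MeasurableSpace α] {μ : Measure α} (a : Lp ℝ 2 μ)
    {g : α → ℝ} (hg : AEStronglyMeasurable g μ) {B : ℝ} (hB : ∀ x, |g x| ≤ B) :
    Integrable (fun x => a x ^ 2 * g x) μ :=
  (Lp.memLp a).integrable_sq.mul_bdd (c := B) hg (Filter.Eventually.of_forall hB)

/-- The index is chosen with `2 ^ n ≤ γ < 2 ^ (n + 1)`, so that `n ≤ 2 log γ`. -/
theorem sq_mul_le_add_sum {y γ w A : ℝ} {M : ℕ} {l r : ℕ → ℝ} (hA : 0 ≤ A) (hγ : 0 ≤ γ)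
    (hγM : γ < 2 ^ M) (hw : 0 ≤ w) (hγw : 1 ≤ γ → γ * (1 + 2 * Real.log γ) ≤ w)
    (hy : ∀ n, |y| ≤ l n + r n) (hl : ∀ n, l n ^ 2 ≤ 36 * (n + 1) * A) :
    y ^ 2 * γ ≤ y ^ 2 + 72 * A * w + ∑ n ∈ Finset.range M, 4 * 2 ^ n * r n ^ 2 := by
  have hterm_nonneg : ∀ n ∈ Finset.range M, 0 ≤ 4 * 2 ^ n * r n ^ 2 := fun n _ => by positivity
  obtain hγ1 | hγ1 := lt_or_ge γ 1
  · have hsum := Finset.sum_nonneg hterm_nonneg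
    have := mul_le_of_le_one_right (sq_nonneg y) hγ1.le
    have : 0 ≤ 72 * A * w := by positivity
    linarith
  obtain ⟨n, hn, hn'⟩ := exists_nat_pow_near hγ1 (one_lt_two : (1 : ℝ) < 2)
  have hnM : n ∈ Finset.range M :=
    Finset.mem_range.2 ((pow_lt_pow_iff_right₀ one_lt_two).1 (hn.trans_lt hγM))
  have hlog : (n : ℝ) ≤ 2 * Real.log γ := by
    have h2 := Real.log_le_log (by positivity) hn
    rw [Real.log_pow] at h2
    nlinarith [Real.log_two_gt_d9, (Nat.cast_nonneg n : (0 : ℝ) ≤ n)]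
  have hsq : y ^ 2 ≤ 2 * l n ^ 2 + 2 * r n ^ 2 := by
    rw [← sq_abs, ← mul_add]
    exact (pow_le_pow_left₀ (abs_nonneg y) (hy n) 2).trans (add_sq_le)
  calc y ^ 2 * γ ≤ (2 * (36 * (n + 1) * A) + 2 * r n ^ 2) * γ := by
        gcongr
        linarith [hl n]
    _ = 72 * A * (γ * (1 + n)) + 2 * r n ^ 2 * γ := by ring
    _ ≤ 72 * A * w + 2 * r n ^ 2 * 2 ^ (n + 1) := by
        gcongr
        exact (mul_le_mul_of_nonneg_left (by linarith) hγ).trans (hγw hγ1)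
    _ = 72 * A * w + 4 * 2 ^ n * r n ^ 2 := by ring
    _ ≤ 72 * A * w + ∑ n ∈ Finset.range M, 4 * 2 ^ n * r n ^ 2 := by
        gcongr
        exact Finset.single_le_sum hterm_nonneg hnM
    _ ≤ y ^ 2 + 72 * A * w + ∑ n ∈ Finset.range M, 4 * 2 ^ n * r n ^ 2 := by
        linarith [sq_nonneg y]

theorem H1Bound.sum_integral_sub_lowPart_le {a : L2R} {A : ℝ} (h : H1Bound a A) (M : ℕ) :
    ∑ n ∈ Finset.range M,
      ∫ x, 4 * 2 ^ n * ‖(complexify a - lowPart a n : L2C) x‖ ^ 2 ∂torusMeasure ≤ 8 * A := by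
  have hterm (n : ℕ) :
      ∫ x, 4 * 2 ^ n * ‖(complexify a - lowPart a n : L2C) x‖ ^ 2 ∂torusMeasure ≤
        4 * A * (1 / 2) ^ n := by
    rw [integral_const_mul]
    calc 4 * 2 ^ n * ∫ x, ‖(complexify a - lowPart a n : L2C) x‖ ^ 2 ∂torusMeasure
        ≤ 4 * 2 ^ n * (A / 4 ^ n) := by
          gcongr
          exact h.integral_norm_sub_lowPart_sq_le n
      _ = 4 * A * (1 / 2) ^ n := by
          rw [← two_pow_mul_two_pow, one_div, inv_pow]
          field_simp
  calc _ ≤ ∑ n ∈ Finset.range M, 4 * A * (1 / 2) ^ n := Finset.sum_le_sum fun n _ => hterm n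
    _ = 4 * A * ∑ n ∈ Finset.range M, (1 / 2 : ℝ) ^ n := (Finset.mul_sum _ _ _).symm
    _ ≤ 4 * A * 2 := by
        have := h.nonneg
        gcongr
        exact sum_geometric_two_le M
    _ = 8 * A := by ring

/-- Where `g ≈ 2 ^ n`, split `a` at the frequency `2 ^ n`: the low frequencies are bounded pointwise
by `A (n + 1) ≈ A (1 + log g)`, and the high ones have squared `L²` norm at most `A / 4 ^ n`, which
beats the weight `2 ^ n`. -/
theorem H1Bound.integral_sq_mul_le {a : L2R} {A : ℝ} (h : H1Bound a A) {g W : Torus → ℝ}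
    (hg : AEStronglyMeasurable g torusMeasure) (hg0 : ∀ x, 0 ≤ g x) {B : ℝ} (hB : ∀ x, g x ≤ B)
    (hW : Integrable W torusMeasure) (hW0 : ∀ x, 0 ≤ W x)
    (hgW : ∀ x, 1 ≤ g x → g x * (1 + 2 * Real.log (g x)) ≤ W x) :
    ∫ x, a x ^ 2 * g x ∂torusMeasure ≤ A * (9 + 72 * ∫ x, W x ∂torusMeasure) := by
  have hA := h.nonneg
  obtain ⟨M, hM⟩ := pow_unbounded_of_one_lt B (one_lt_two : (1 : ℝ) < 2)
  let r (n : ℕ) (x : Torus) : ℝ := ‖(complexify a - lowPart a n : L2C) x‖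
  have hr (n : ℕ) : Integrable (fun x => 4 * 2 ^ n * r n x ^ 2) torusMeasure :=
    ((Lp.memLp (complexify a - lowPart a n)).integrable_norm_pow (p := 2) two_ne_zero).const_mul _
  have hsum : Integrable (fun x => ∑ n ∈ Finset.range M, 4 * 2 ^ n * r n x ^ 2) torusMeasure :=
    integrable_finsetSum _ fun n _ => hr n
  have ha : Integrable (fun x => a x ^ 2) torusMeasure := (Lp.memLp a).integrable_sq
  have haW : Integrable (fun x => a x ^ 2 + 72 * A * W x) torusMeasure :=
    ha.add (hW.const_mul _)
  have hpointwise : ∀ᵐ x ∂torusMeasure, a x ^ 2 * g x ≤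
      a x ^ 2 + 72 * A * W x + ∑ n ∈ Finset.range M, 4 * 2 ^ n * r n x ^ 2 := by
    filter_upwards [ae_all_iff.2 (ae_abs_le_norm_lowPart_add a),
      ae_all_iff.2 h.ae_norm_lowPart_sq_le] with x hsplit hlow
    exact sq_mul_le_add_sum hA (hg0 x) ((hB x).trans_lt hM) (hW0 x) (hgW x) hsplit hlow
  calc ∫ x, a x ^ 2 * g x ∂torusMeasure
      ≤ ∫ x, (a x ^ 2 + 72 * A * W x + ∑ n ∈ Finset.range M, 4 * 2 ^ n * r n x ^ 2)
          ∂torusMeasure :=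
        integral_mono_ae
          (integrable_sq_mul a hg fun x => (abs_of_nonneg (hg0 x)).trans_le (hB x))
          (haW.add hsum) hpointwise
    _ = ‖a‖ ^ 2 + 72 * A * ∫ x, W x ∂torusMeasure +
          ∑ n ∈ Finset.range M, ∫ x, 4 * 2 ^ n * r n x ^ 2 ∂torusMeasure := by
        rw [integral_add haW hsum, integral_add ha (hW.const_mul _),
          integral_const_mul, integral_finsetSum _ fun n _ => hr n, norm_sq_eq_integral]
    _ ≤ A + 72 * A * ∫ x, W x ∂torusMeasure + 8 * A := by
        gcongr
        · exact h.norm_sq_le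
        · exact h.sum_integral_sub_lowPart_le M
    _ = A * (9 + 72 * ∫ x, W x ∂torusMeasure) := by ring

/-! ### Smooth functions on `ℝ² × [0,T)` -/

theorem fderiv_fderiv_apply_comm {E F : Type*} [NormedAddCommGroup E] [NormedSpace ℝ E]
    [NormedAddCommGroup F] [NormedSpace ℝ F] {f : E → F} {x : E} (h : ContDiffAt ℝ 2 f x)
    (v w : E) :
    fderiv ℝ (fun y => fderiv ℝ f y v) x w = fderiv ℝ (fun y => fderiv ℝ f y w) x v := by
  have hd : DifferentiableAt ℝ (fderiv ℝ f) x :=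
    (h.fderiv_right (m := 1) (by norm_num)).differentiableAt one_ne_zero
  have key (v : E) :
      fderiv ℝ (fun y => fderiv ℝ f y v) x = (fderiv ℝ (fderiv ℝ f) x).flip v := by
    ext w
    simp [fderiv_clm_apply hd (differentiableAt_const v)]
  rw [key, key]
  exact h.isSymmSndFDerivAt (by simp) w v

theorem pd_comm {f : Plane → ℝ} (h : ContDiff ℝ 2 f) (i j : Fin 2) :
    pd i (pd j f) = pd j (pd i f) :=
  funext fun _ => fderiv_fderiv_apply_comm h.contDiffAt (e j) (e i)

/-- Smoothness on `ℝ² × [0,T)`. -/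
def SmoothOn (T : ℝ) (G : ℝ → Plane → ℝ) : Prop :=
  ContDiffOn ℝ ∞ (fun p : ℝ × Plane => G p.1 p.2) (Ico 0 T ×ˢ univ)

theorem uniqueDiffOn_Ico_prod (T : ℝ) : UniqueDiffOn ℝ (Ico 0 T ×ˢ (univ : Set Plane)) :=
  (uniqueDiffOn_Ico 0 T).prod uniqueDiffOn_univ

section SpaceTime

variable {G : ℝ → Plane → ℝ} {t : ℝ} {x : Plane}

theorem pd_eq_fderivWithin {I : Set ℝ} (ht : t ∈ I)
    (h : DifferentiableWithinAt ℝ (fun p : ℝ × Plane => G p.1 p.2) (I ×ˢ univ) (t, x))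
    (i : Fin 2) :
    pd i (G t) x =
      fderivWithin ℝ (fun p : ℝ × Plane => G p.1 p.2) (I ×ˢ univ) (t, x) (0, e i) := by
  have hslice : HasFDerivWithinAt (fun y : Plane => (t, y)) (ContinuousLinearMap.inr ℝ ℝ Plane)
      univ x := (hasFDerivAt_prodMk_right t x).hasFDerivWithinAt
  have hcomp := h.hasFDerivWithinAt.comp x hslice fun _ _ => ⟨ht, mem_univ _⟩
  exact congrArg (· (e i)) (hasFDerivWithinAt_univ.1 hcomp).fderiv

theorem pd_eq_fderiv (h : DifferentiableAt ℝ (fun p : ℝ × Plane => G p.1 p.2) (t, x))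
    (i : Fin 2) :
    pd i (G t) x = fderiv ℝ (fun p : ℝ × Plane => G p.1 p.2) (t, x) (0, e i) :=
  congrArg (· (e i)) (h.hasFDerivAt.comp x (hasFDerivAt_prodMk_right t x)).fderiv

theorem hasDerivAt_fderiv (h : DifferentiableAt ℝ (fun p : ℝ × Plane => G p.1 p.2) (t, x)) :
    HasDerivAt (fun s => G s x) (fderiv ℝ (fun p : ℝ × Plane => G p.1 p.2) (t, x) (1, 0)) t := by
  have hslice : HasFDerivAt (fun s : ℝ => (s, x)) (ContinuousLinearMap.inl ℝ ℝ Plane) t :=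
    hasFDerivAt_prodMk_left t x
  exact (h.hasFDerivAt.comp t hslice).hasDerivAt

theorem dt_eq_fderiv (h : DifferentiableAt ℝ (fun p : ℝ × Plane => G p.1 p.2) (t, x)) :
    dt G t x = fderiv ℝ (fun p : ℝ × Plane => G p.1 p.2) (t, x) (1, 0) :=
  (hasDerivAt_fderiv h).deriv

end SpaceTime

namespace SmoothOn

variable {T : ℝ} {G : ℝ → Plane → ℝ}

theorem continuousOn (h : SmoothOn T G) :
    ContinuousOn (fun p : ℝ × Plane => G p.1 p.2) (Ico 0 T ×ˢ univ) :=
  ContDiffOn.continuousOn h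

theorem contDiff (h : SmoothOn T G) {t : ℝ} (ht : t ∈ Ico 0 T) : ContDiff ℝ ∞ (G t) :=
  contDiffOn_univ.1 <| ContDiffOn.comp (g := fun p : ℝ × Plane => G p.1 p.2) h
    (contDiff_prodMk_right t).contDiffOn fun _ _ => ⟨ht, mem_univ _⟩

theorem contDiffAt (h : SmoothOn T G) {t : ℝ} (ht : t ∈ Ioo 0 T) (x : Plane) :
    ContDiffAt ℝ ∞ (fun p : ℝ × Plane => G p.1 p.2) (t, x) :=
  ContDiffOn.contDiffAt h <| Filter.mem_of_superset
    ((isOpen_Ioo.prod isOpen_univ).mem_nhds ⟨ht, mem_univ x⟩)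
    (prod_mono Ioo_subset_Ico_self subset_rfl)

theorem differentiableAt (h : SmoothOn T G) {t : ℝ} (ht : t ∈ Ioo 0 T) (x : Plane) :
    DifferentiableAt ℝ (fun p : ℝ × Plane => G p.1 p.2) (t, x) :=
  (h.contDiffAt ht x).differentiableAt (by simp)

theorem pd (h : SmoothOn T G) (i : Fin 2) : SmoothOn T fun t => pd i (G t) :=
  ((h.fderivWithin (uniqueDiffOn_Ico_prod T) (m := ∞) (by simp)).clm_apply
    (contDiffOn_const (c := ((0 : ℝ), e i)))).congr fun p hp =>
      pd_eq_fderivWithin hp.1 (h.differentiableOn (by simp) p hp) i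

theorem hasDerivAt (h : SmoothOn T G) {t : ℝ} (ht : t ∈ Ioo 0 T) (x : Plane) :
    HasDerivAt (fun s => G s x) (dt G t x) t := by
  rw [dt_eq_fderiv (h.differentiableAt ht x)]
  exact hasDerivAt_fderiv (h.differentiableAt ht x)

theorem contDiffOn_dt (h : SmoothOn T G) :
    ContDiffOn ℝ ∞ (fun p : ℝ × Plane => dt G p.1 p.2) (Ioo 0 T ×ˢ univ) := by
  have hderiv : ContDiffOn ℝ ∞
      (fun p => fderiv ℝ (fun p : ℝ × Plane => G p.1 p.2) p (1, 0)) (Ioo 0 T ×ˢ univ) :=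
    fun p hp => (((h.contDiffAt hp.1 p.2).fderiv_right (by simp)).clm_apply
      contDiffAt_const).contDiffWithinAt
  exact hderiv.congr fun p hp => dt_eq_fderiv (h.differentiableAt hp.1 p.2)

theorem contDiff_dt (h : SmoothOn T G) {t : ℝ} (ht : t ∈ Ioo 0 T) : ContDiff ℝ ∞ (dt G t) :=
  contDiffOn_univ.1 <| h.contDiffOn_dt.comp (contDiff_prodMk_right t).contDiffOn
    fun _ _ => ⟨ht, mem_univ _⟩

theorem dt_pd (h : SmoothOn T G) (i : Fin 2) {t : ℝ} (ht : t ∈ Ioo 0 T) (x : Plane) :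
    dt (fun s => Dislocation.pd i (G s)) t x = Dislocation.pd i (dt G t) x := by
  have hnhds : Ioo 0 T ×ˢ (univ : Set Plane) ∈ nhds (t, x) :=
    (isOpen_Ioo.prod isOpen_univ).mem_nhds ⟨ht, mem_univ x⟩
  have hpd : (fun p : ℝ × Plane => Dislocation.pd i (G p.1) p.2) =ᶠ[nhds (t, x)]
      fun p => fderiv ℝ (fun p : ℝ × Plane => G p.1 p.2) p (0, e i) := by
    filter_upwards [hnhds] with p hp using pd_eq_fderiv (h.differentiableAt hp.1 p.2) i
  have hdt : (fun p : ℝ × Plane => dt G p.1 p.2) =ᶠ[nhds (t, x)]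
      fun p => fderiv ℝ (fun p : ℝ × Plane => G p.1 p.2) p (1, 0) := by
    filter_upwards [hnhds] with p hp using dt_eq_fderiv (h.differentiableAt hp.1 p.2)
  have hdt_diff : DifferentiableAt ℝ (fun p : ℝ × Plane => dt G p.1 p.2) (t, x) :=
    (h.contDiffOn_dt.contDiffAt hnhds).differentiableAt (by simp)
  rw [dt_eq_fderiv ((h.pd i).differentiableAt ht x), pd_eq_fderiv hdt_diff,
    hpd.fderiv_eq, hdt.fderiv_eq]
  exact fderiv_fderiv_apply_comm ((h.contDiffAt ht x).of_le (by norm_cast)) _ _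

theorem hasDerivAt_integral_descend (h : SmoothOn T G) {t : ℝ} (ht : t ∈ Ioo 0 T) :
    HasDerivAt (fun s => ∫ x, descend (G s) x ∂torusMeasure)
      (∫ x, descend (dt G t) x ∂torusMeasure) t := by
  obtain ⟨a, b, htab, hnhds, hab⟩ :=
    exists_Icc_mem_subset_of_mem_nhds (isOpen_Ioo.mem_nhds ht)
  have hI {s : ℝ} (hs : s ∈ Icc a b) : s ∈ Ico 0 T := Ioo_subset_Ico_self (hab hs)
  obtain ⟨C, hC⟩ := ((isCompact_Icc (a := a) (b := b)).prod
    (isCompact_Icc (a := (0 : Plane)) (b := 1))).exists_bound_of_continuousOn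
    (h.contDiffOn_dt.continuousOn.mono (prod_mono hab (subset_univ _)))
  refine (hasDerivAt_integral_of_dominated_loc_of_deriv_le (bound := fun _ => C)
    (F' := fun s x => descend (dt G s) x) hnhds ?_
    (integrable_descend (h.contDiff (hI htab)).continuous)
    (integrable_descend (h.contDiff_dt ht).continuous).aestronglyMeasurable
    (.of_forall fun x s hs => hC (s, cellRep x) ⟨hs, cellRep_mem_Icc x⟩)
    (integrable_const _) (.of_forall fun x s hs => h.hasDerivAt (hab hs) (cellRep x))).2
  filter_upwards [hnhds] with s hs
  exact (integrable_descend (h.contDiff (hI hs)).continuous).aestronglyMeasurable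

end SmoothOn

section ContinuityInTime

variable {G : ℝ → Plane → ℝ} {I : Set ℝ}

theorem continuousOn_slice (h : ContinuousOn (fun p : ℝ × Plane => G p.1 p.2) (I ×ˢ univ))
    {t : ℝ} (ht : t ∈ I) : Continuous (G t) :=
  continuousOn_univ.1 <|
    h.comp (Continuous.prodMk_right t).continuousOn fun _ _ => ⟨ht, mem_univ _⟩

theorem norm_toL2_descend_sub_le {f g : Plane → ℝ} (hf : Continuous f) (hg : Continuous g)
    {r : ℝ} (hr : 0 ≤ r) (h : ∀ x ∈ Icc (0 : Plane) 1, |f x - g x| ≤ r) :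
    ‖toL2 (descend f) - toL2 (descend g)‖ ≤ r := by
  have hbound : ∀ᵐ x ∂torusMeasure, ‖(toL2 (descend f) - toL2 (descend g) : L2R) x‖ ≤ r := by
    filter_upwards [Lp.coeFn_sub (toL2 (descend f)) (toL2 (descend g)), coeFn_toL2 hf,
      coeFn_toL2 hg] with x hsub hfx hgx
    rw [hsub, Pi.sub_apply, hfx, hgx]
    exact h _ (cellRep_mem_Icc x)
  simpa [measureUnivNNReal] using Lp.norm_le_of_ae_bound hr hbound

theorem continuousOn_toL2_descend
    (h : ContinuousOn (fun p : ℝ × Plane => G p.1 p.2) (I ×ˢ univ)) :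
    ContinuousOn (fun t => toL2 (descend (G t))) I := by
  intro t ht
  refine Metric.tendsto_nhds.2 fun r hr => ?_
  obtain ⟨v, hv, hclose⟩ := isCompact_Icc.mem_uniformity_of_prod
    (h.mono (prod_mono subset_rfl (subset_univ (Icc (0 : Plane) 1)))) ht
    (Metric.dist_mem_uniformity (half_pos hr))
  filter_upwards [hv, self_mem_nhdsWithin] with s hs hsI
  rw [dist_eq_norm]
  exact (norm_toL2_descend_sub_le (continuousOn_slice h hsI) (continuousOn_slice h ht)
    (half_pos hr).le fun x hx => (hclose s hs x hx).le).trans_lt (half_lt_self hr)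

theorem continuousOn_integral_descend
    (h : ContinuousOn (fun p : ℝ × Plane => G p.1 p.2) (I ×ˢ univ)) :
    ContinuousOn (fun t => ∫ x, descend (G t) x ∂torusMeasure) I := by
  have hinner : ContinuousOn (fun t => inner ℝ (indicatorConstLp 2 MeasurableSet.univ
      (measure_ne_top torusMeasure _) (1 : ℝ)) (toL2 (descend (G t)))) I :=
    continuousOn_const.inner (continuousOn_toL2_descend h)
  refine hinner.congr fun t ht => ?_
  beta_reduce
  rw [L2.inner_indicatorConstLp_one, setIntegral_univ]
  exact integral_congr_ae (coeFn_toL2 (continuousOn_slice h ht)).symm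

end ContinuityInTime

/-! ### Mollification of periodic functions -/

theorem measurable_toTorus : Measurable toTorus :=
  measurable_pi_lambda _ fun i => AddCircle.measurable_mk'.comp (measurable_pi_apply i)

theorem toTorus_sub (x y : Plane) : toTorus (x - y) = toTorus x - toTorus y := rfl

theorem exists_cellRep_toTorus (x : Plane) :
    ∃ k : Fin 2 → ℤ, cellRep (toTorus x) = x + (k 0 • e 0 + k 1 • e 1) := by
  have hcoord : ∀ i, ∃ n : ℤ, cellRep (toTorus x) i = x i + n := by
    intro i
    have hcoe : ((cellRep (toTorus x) i : ℝ) : UnitAddCircle) = (x i : UnitAddCircle) :=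
      congrFun (toTorus_cellRep (toTorus x)) i
    rw [eq_comm, QuotientAddGroup.eq, AddSubgroup.mem_zmultiples_iff] at hcoe
    obtain ⟨n, hn⟩ := hcoe
    exact ⟨n, by rw [zsmul_one] at hn; linarith⟩
  choose k hk using hcoord
  refine ⟨k, ?_⟩
  ext i
  rw [hk i]
  fin_cases i <;> simp [e]

/-- The group of the translations that leave `f` invariant almost everywhere. -/
def aePeriods (f : Plane → ℝ) : AddSubgroup Plane where
  carrier := {v | ∀ᵐ x, f (x + v) = f x}
  zero_mem' := by simp
  add_mem' := by
    intro v w hv hw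
    have hshift : ∀ᵐ x, f (x + v + w) = f (x + v) :=
      (measurePreserving_add_right volume v).quasiMeasurePreserving.ae hw
    change ∀ᵐ x, f (x + (v + w)) = f x
    filter_upwards [hshift, hv] with x hxw hxv
    rw [← add_assoc, hxw, hxv]
  neg_mem' := by
    intro v hv
    have hshift : ∀ᵐ x, f (x + -v + v) = f (x + -v) :=
      (measurePreserving_add_right volume (-v)).quasiMeasurePreserving.ae hv
    change ∀ᵐ x, f (x + -v) = f x
    filter_upwards [hshift] with x hx
    rw [← hx, neg_add_cancel_right]

theorem ae_eq_descend_toTorus {f : Plane → ℝ} (h : ∀ i, ∀ᵐ x, f (x + e i) = f x) :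
    ∀ᵐ x, f x = descend f (toTorus x) := by
  have hperiods : ∀ k : Fin 2 → ℤ, ∀ᵐ x, f (x + (k 0 • e 0 + k 1 • e 1)) = f x := fun k =>
    (aePeriods f).add_mem ((aePeriods f).zsmul_mem (h 0) _) ((aePeriods f).zsmul_mem (h 1) _)
  filter_upwards [ae_all_iff.2 hperiods] with x hx
  obtain ⟨k, hk⟩ := exists_cellRep_toTorus x
  rw [descend_apply, hk, hx k]

section Average

variable {X G : Type*} [MeasurableSpace X] [MeasurableSpace G] [AddGroup G] [MeasurableAdd₂ G]
  [MeasurableNeg G] {μ : Measure G} [SFinite μ] [μ.IsAddRightInvariant] {φ : X → G}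

theorem measurePreserving_snd_sub_fst (hφ : Measurable φ) (ν : Measure X)
    [IsProbabilityMeasure ν] :
    MeasurePreserving (fun p : X × G => p.2 - φ p.1) (ν.prod μ) μ := by
  refine measurePreserving_snd.comp <|
    (MeasurePreserving.id ν).skew_product (μc := μ) (g := fun y z => z - φ y)
      (measurable_snd.sub (hφ.comp measurable_fst)) (Filter.Eventually.of_forall fun y => ?_)
  simpa only [sub_eq_add_neg] using (measurePreserving_add_right μ (-φ y)).map_eq

/-- This is Jensen's inequality in the fibres followed by Fubini's theorem. -/
theorem integral_convex_average_le {F : G → ℝ} (hF : Integrable F μ) {s : Set ℝ} {Φ : ℝ → ℝ}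
    (hΦ : ConvexOn ℝ s Φ) (hc : ContinuousOn Φ s) (hs : IsClosed s) (hFs : ∀ᵐ z ∂μ, F z ∈ s)
    (hΦF : Integrable (fun z => Φ (F z)) μ) (hΦ0 : ∀ y ∈ s, 0 ≤ Φ y) (hφ : Measurable φ)
    (ν : Measure X) [IsProbabilityMeasure ν] :
    ∫ z, Φ (∫ y, F (z - φ y) ∂ν) ∂μ ≤ ∫ z, Φ (F z) ∂μ := by
  have hmp := measurePreserving_snd_sub_fst (μ := μ) hφ ν
  have hint : Integrable (fun p : X × G => F (p.2 - φ p.1)) (ν.prod μ) :=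
    hmp.integrable_comp_of_integrable hF
  have hintΦ : Integrable (fun p : X × G => Φ (F (p.2 - φ p.1))) (ν.prod μ) :=
    hmp.integrable_comp_of_integrable hΦF
  have hmem : ∀ᵐ z ∂μ, ∀ᵐ y ∂ν, F (z - φ y) ∈ s :=
    Measure.ae_ae_of_ae_prod
      (Measure.measurePreserving_swap.quasiMeasurePreserving.ae
        (hmp.quasiMeasurePreserving.ae hFs))
  have hpos : ∀ᵐ z ∂μ, 0 ≤ Φ (∫ y, F (z - φ y) ∂ν) := by
    filter_upwards [hmem, hint.prod_left_ae] with z hz hzint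
    exact hΦ0 _ (hΦ.1.integral_mem hs hz hzint)
  have hjensen : ∀ᵐ z ∂μ, Φ (∫ y, F (z - φ y) ∂ν) ≤ ∫ y, Φ (F (z - φ y)) ∂ν := by
    filter_upwards [hmem, hint.prod_left_ae, hintΦ.prod_left_ae] with z hz hzint hzΦ
    exact hΦ.map_integral_le hc hs hz hzint hzΦ
  calc ∫ z, Φ (∫ y, F (z - φ y) ∂ν) ∂μ
      ≤ ∫ z, ∫ y, Φ (F (z - φ y)) ∂ν ∂μ :=
        integral_mono_of_nonneg hpos hintΦ.integral_prod_right hjensen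
    _ = ∫ p, Φ (F (p.2 - φ p.1)) ∂(ν.prod μ) := (integral_prod_symm _ hintΦ).symm
    _ = ∫ z, Φ (F z) ∂μ := by
        rw [← hmp.map_eq] at hΦF
        conv_rhs => rw [← hmp.map_eq]
        exact (integral_map hmp.measurable.aemeasurable hΦF.aestronglyMeasurable).symm

end Average

section Convolution

open scoped Convolution

variable {f g ζ : Plane → ℝ}

theorem pd_convolution (hf : LocallyIntegrable f) (hζ : ContDiff ℝ 1 ζ)
    (hζc : HasCompactSupport ζ) (i : Fin 2) (x : Plane) :
    pd i (f ⋆[ContinuousLinearMap.mul ℝ ℝ] ζ) x =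
      (f ⋆[ContinuousLinearMap.mul ℝ ℝ] pd i ζ) x := by
  have hex := (hζc.fderiv (𝕜 := ℝ)).convolutionExists_right
    ((ContinuousLinearMap.mul ℝ ℝ).precompR Plane) hf (hζ.continuous_fderiv (by simp)) x
  rw [pd, (hζc.hasFDerivAt_convolution_right (ContinuousLinearMap.mul ℝ ℝ) hf hζ x).fderiv,
    convolution, ContinuousLinearMap.integral_apply hex]
  rfl

theorem pd_comp_const_sub (hζ : Differentiable ℝ ζ) (i : Fin 2) (x y : Plane) :
    pd i (fun y => ζ (x - y)) y = -pd i ζ (x - y) := by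
  have h := (hζ (x - y)).hasFDerivAt.comp y ((hasFDerivAt_id y).const_sub x)
  have h' : fderiv ℝ (fun y => ζ (x - y)) y = _ := h.fderiv
  simp [pd, h']

theorem IsWeakPartialOne.convolution_pd (h : IsWeakPartialOne f g) (hζ : ContDiff ℝ ∞ ζ)
    (hζc : HasCompactSupport ζ) (x : Plane) :
    (f ⋆[ContinuousLinearMap.mul ℝ ℝ] pd 0 ζ) x = (g ⋆[ContinuousLinearMap.mul ℝ ℝ] ζ) x := by
  have hw := h.2 (fun y => ζ (x - y)) (hζ.comp (contDiff_const.sub contDiff_id))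
    (hζc.comp_homeomorph (Homeomorph.subLeft x))
  simp only [pd_comp_const_sub (hζ.differentiable (by simp)), mul_neg, integral_neg,
    neg_inj] at hw
  exact hw

end Convolution

/-- The rescaled mollifier `η_ε`. -/
def scaled (η : Plane → ℝ) (ε : ℝ) (y : Plane) : ℝ := (ε ^ 2)⁻¹ * η (ε⁻¹ • y)

/-- The probability measure with density `η_ε`. -/
def mollMeasure (η : Plane → ℝ) (ε : ℝ) : Measure Plane :=
  volume.withDensity fun y => ENNReal.ofReal (scaled η ε y)

/-- The mollification `f * η_ε`. -/
def mollify (η : Plane → ℝ) (ε : ℝ) (f : Plane → ℝ) (x : Plane) : ℝ :=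
  ∫ y, f (x - y) * scaled η ε y

theorem mollify_eq_convolution (η : Plane → ℝ) (ε : ℝ) (f : Plane → ℝ) :
    mollify η ε f = convolution f (scaled η ε) (ContinuousLinearMap.mul ℝ ℝ) volume :=
  funext fun _ => convolution_mul_swap.symm

namespace IsMollifier

variable {η : Plane → ℝ} {ε : ℝ} {f g : Plane → ℝ}

theorem contDiff_scaled (hη : IsMollifier η) (ε : ℝ) : ContDiff ℝ ∞ (scaled η ε) :=
  contDiff_const.mul (hη.contDiff.comp (contDiff_const_smul _))

theorem hasCompactSupport_scaled (hη : IsMollifier η) (hε : 0 < ε) :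
    HasCompactSupport (scaled η ε) :=
  (hη.compact.comp_smul (inv_ne_zero hε.ne')).mul_left

theorem scaled_nonneg (hη : IsMollifier η) (ε : ℝ) (y : Plane) : 0 ≤ scaled η ε y :=
  mul_nonneg (inv_nonneg.2 (sq_nonneg _)) (hη.nonneg _)

theorem integrable_scaled (hη : IsMollifier η) (hε : 0 < ε) : Integrable (scaled η ε) :=
  (hη.contDiff_scaled ε).continuous.integrable_of_hasCompactSupport
    (hη.hasCompactSupport_scaled hε)

theorem integral_scaled (hη : IsMollifier η) (hε : 0 < ε) : ∫ y, scaled η ε y = 1 := by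
  unfold scaled
  rw [integral_const_mul, Measure.integral_comp_smul, hη.integral_eq_one]
  simp only [Module.finrank_fintype_fun_eq_card, Fintype.card_fin, inv_pow, inv_inv, abs_pow,
    sq_abs, smul_eq_mul, mul_one]
  field_simp

theorem isProbabilityMeasure (hη : IsMollifier η) (hε : 0 < ε) :
    IsProbabilityMeasure (mollMeasure η ε) := by
  constructor
  rw [mollMeasure, withDensity_apply _ MeasurableSet.univ, Measure.restrict_univ,
    ← ofReal_integral_eq_lintegral_ofReal (hη.integrable_scaled hε)
      (Filter.Eventually.of_forall (hη.scaled_nonneg ε)),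
    hη.integral_scaled hε, ENNReal.ofReal_one]

theorem integral_mollMeasure (hη : IsMollifier η) (f : Plane → ℝ) :
    ∫ y, f y ∂(mollMeasure η ε) = ∫ y, f y * scaled η ε y := by
  rw [mollMeasure, integral_withDensity_eq_integral_toReal_smul
    (hη.contDiff_scaled ε).continuous.measurable.ennreal_ofReal (by simp)]
  simp only [ENNReal.toReal_ofReal (hη.scaled_nonneg ε _), smul_eq_mul, mul_comm]

theorem descend_mollify (hη : IsMollifier η) (h : ∀ i, ∀ᵐ x, f (x + e i) = f x) (z : Torus) :
    descend (mollify η ε f) z = ∫ y, descend f (z - toTorus y) ∂(mollMeasure η ε) := by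
  rw [hη.integral_mollMeasure, descend_apply, mollify]
  have hae : ∀ᵐ y, f (cellRep z - y) = descend f (toTorus (cellRep z - y)) :=
    (Measure.measurePreserving_sub_left volume (cellRep z)).quasiMeasurePreserving.ae
      (ae_eq_descend_toTorus h)
  refine integral_congr_ae ?_
  filter_upwards [hae] with y hy
  rw [hy, toTorus_sub, toTorus_cellRep]

theorem integrable_sub_mul_scaled (hη : IsMollifier η) (hε : 0 < ε) (hf : LocallyIntegrable f)
    (x : Plane) : Integrable fun y => f (x - y) * scaled η ε y := by
  have h : Integrable fun y => f y * scaled η ε (x - y) :=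
    hf.integrable_smul_right_of_hasCompactSupport
      ((hη.contDiff_scaled ε).continuous.comp (continuous_const.sub continuous_id))
      ((hη.hasCompactSupport_scaled hε).comp_homeomorph (Homeomorph.subLeft x))
  simpa using h.comp_sub_left x

theorem mollify_sub_const (hη : IsMollifier η) (hε : 0 < ε) (hf : LocallyIntegrable f) (c : ℝ)
    (x : Plane) : mollify η ε (fun x => f x - c) x = mollify η ε f x - c := by
  simp only [mollify, sub_mul]
  rw [integral_sub (hη.integrable_sub_mul_scaled hε hf x) ((hη.integrable_scaled hε).const_mul c),
    integral_const_mul, hη.integral_scaled hε, mul_one]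

theorem mollify_nonneg (hη : IsMollifier η) (hf : ∀ᵐ x, 0 ≤ f x) (x : Plane) :
    0 ≤ mollify η ε f x := by
  have hae : ∀ᵐ y, 0 ≤ f (x - y) :=
    (Measure.measurePreserving_sub_left volume x).quasiMeasurePreserving.ae hf
  refine integral_nonneg_of_ae ?_
  filter_upwards [hae] with y hy using mul_nonneg hy (hη.scaled_nonneg ε y)

theorem contDiff_mollify (hη : IsMollifier η) (hε : 0 < ε) (hf : LocallyIntegrable f) :
    ContDiff ℝ ∞ (mollify η ε f) := by
  rw [mollify_eq_convolution]
  exact (hη.hasCompactSupport_scaled hε).contDiff_convolution_right _ hf (hη.contDiff_scaled ε)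

theorem pd_zero_mollify (hη : IsMollifier η) (hε : 0 < ε) (hf : LocallyIntegrable f)
    (hg : IsWeakPartialOne f g) (x : Plane) : pd 0 (mollify η ε f) x = mollify η ε g x := by
  have hsmooth := hη.contDiff_scaled ε
  have hcompact := hη.hasCompactSupport_scaled hε
  rw [mollify_eq_convolution, mollify_eq_convolution,
    pd_convolution hf (hsmooth.of_le (by simp)) hcompact,
    hg.convolution_pd hsmooth hcompact]

end IsMollifier

/-! ### The entropy density -/

/-- The shifted entropy density `(y + δ) log (y + δ)`. -/
def ent (δ y : ℝ) : ℝ := (y + δ) * Real.log (y + δ)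

theorem mul_log_le_mul_log {y z : ℝ} (hy : 0 ≤ y) (hyz : y ≤ z) (hz : 1 ≤ z) :
    y * Real.log y ≤ z * Real.log z := by
  rcases le_total y 1 with h | h
  · exact (mul_nonpos_of_nonneg_of_nonpos hy (Real.log_nonpos hy h)).trans
      (mul_nonneg (by linarith) (Real.log_nonneg hz))
  · exact mul_le_mul hyz (Real.log_le_log (by linarith) hyz) (Real.log_nonneg h) (by linarith)

theorem continuous_ent (δ : ℝ) : Continuous (ent δ) :=
  Real.continuous_mul_log.comp (continuous_add_const δ)

theorem convexOn_ent {δ : ℝ} (hδ : 0 ≤ δ) : ConvexOn ℝ (Ici 0) (ent δ) :=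
  (Real.convexOn_mul_log.translate_left δ).subset
    (fun _ hy => add_nonneg hδ (mem_Ici.1 hy)) (convex_Ici 0)

theorem ent_nonneg {δ y : ℝ} (h : 1 ≤ y + δ) : 0 ≤ ent δ y :=
  mul_nonneg (by linarith) (Real.log_nonneg h)

theorem ent_two_le {y : ℝ} (hy : 0 ≤ y) :
    ent 2 y ≤ y * Real.log (Real.exp 1 + y) + 2 * (y + 1) := by
  have hlog_exp : Real.log (y + 2) ≤ Real.log (Real.exp 1 + y) := by
    refine Real.log_le_log (by linarith) ?_
    linarith [Real.add_one_le_exp 1]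
  have hlog_lin : Real.log (y + 2) ≤ y + 1 := by
    linarith [Real.log_le_sub_one_of_pos (show 0 < y + 2 by linarith)]
  have := mul_le_mul_of_nonneg_left hlog_exp hy
  simp only [ent]
  linarith

theorem MemLlogL.integrable_ent_two {G : Torus → ℝ} (hG : MemLlogL G)
    (hG0 : ∀ᵐ z ∂torusMeasure, 0 ≤ G z) : Integrable (fun z => ent 2 (G z)) torusMeasure := by
  refine Integrable.mono' (hG.2.add ((hG.1.abs.add (integrable_const 1)).const_mul 2))
    ((continuous_ent 2).comp_aestronglyMeasurable hG.1.aestronglyMeasurable) ?_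
  filter_upwards [hG0] with z hz
  simp only [Pi.add_apply]
  rw [Real.norm_of_nonneg (ent_nonneg (by linarith)), abs_of_nonneg hz]
  exact ent_two_le hz

/-! ### The regularised initial data -/

theorem integrable_mul_of_hasCompactSupport {f φ : Plane → ℝ} (hf : LocallyIntegrable f)
    (hφ : Continuous φ) (hφc : HasCompactSupport φ) : Integrable fun x => f x * φ x :=
  hf.integrable_smul_right_of_hasCompactSupport hφ hφc

theorem hasCompactSupport_pd {φ : Plane → ℝ} (i : Fin 2) (hφ : HasCompactSupport φ) :
    HasCompactSupport (pd i φ) :=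
  hφ.fderiv_apply (𝕜 := ℝ) (e i)

namespace IsWeakPartialOne

variable {f g f' g' : Plane → ℝ}

theorem comp_add_right (h : IsWeakPartialOne f g) (v : Plane) :
    IsWeakPartialOne (fun x => f (x + v)) fun x => g (x + v) := by
  constructor
  · rw [locallyIntegrable_iff]
    intro K hK
    exact ((measurePreserving_add_right volume v).integrableOn_image
      (measurableEmbedding_addRight _)).1
      (h.1.integrableOn_isCompact (hK.image (continuous_add_const _)))
  · intro φ hφ hφc
    have hpd : ∀ x, pd 0 (fun x => φ (x - v)) x = pd 0 φ (x - v) := fun x => by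
      simp only [pd, sub_eq_add_neg, fderiv_comp_add_right]
    have hw := h.2 (fun x => φ (x - v)) (hφ.comp (contDiff_id.sub contDiff_const))
      (hφc.comp_homeomorph (Homeomorph.subRight v))
    rw [← integral_add_right_eq_self _ v, ← integral_add_right_eq_self (fun x => g x * _) v] at hw
    simpa only [hpd, add_sub_cancel_right] using hw

theorem ae_eq (hg : IsWeakPartialOne f g) (hg' : IsWeakPartialOne f' g') (h : f =ᵐ[volume] f') :
    g =ᵐ[volume] g' := by
  refine ae_eq_of_integral_contDiff_smul_eq hg.1 hg'.1 fun φ hφ hφc => ?_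
  have hpair : ∫ x, f x * pd 0 φ x = ∫ x, f' x * pd 0 φ x :=
    integral_congr_ae (h.mono fun x hx => by simp only [hx])
  rw [hg.2 φ hφ hφc, hg'.2 φ hφ hφc, neg_inj] at hpair
  simpa only [smul_eq_mul, mul_comm (φ _)] using hpair

theorem ae_periodic (h : IsWeakPartialOne f g) {i : Fin 2} (hp : ∀ᵐ x, f (x + e i) = f x) :
    ∀ᵐ x, g (x + e i) = g x :=
  (h.comp_add_right (e i)).ae_eq h hp

theorem sub (hf : LocallyIntegrable f) (hf' : LocallyIntegrable f') (h : IsWeakPartialOne f g)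
    (h' : IsWeakPartialOne f' g') :
    IsWeakPartialOne (fun x => f x - f' x) fun x => g x - g' x := by
  refine ⟨h.1.sub h'.1, fun φ hφ hφc => ?_⟩
  have hpd := (contDiff_pd 0 hφ).continuous
  have hpdc := hasCompactSupport_pd 0 hφc
  simp only [sub_mul]
  rw [integral_sub (integrable_mul_of_hasCompactSupport hf hpd hpdc)
      (integrable_mul_of_hasCompactSupport hf' hpd hpdc),
    integral_sub (integrable_mul_of_hasCompactSupport h.1 hφ.continuous hφc)
      (integrable_mul_of_hasCompactSupport h'.1 hφ.continuous hφc),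
    h.2 φ hφ hφc, h'.2 φ hφ hφc, neg_sub_neg, neg_sub]

end IsWeakPartialOne

theorem isWeakPartialOne_pd_zero {f : Plane → ℝ} (hf : ContDiff ℝ 1 f) :
    IsWeakPartialOne f (pd 0 f) := by
  have hpd := (continuous_pd 0 hf).locallyIntegrable (μ := volume)
  refine ⟨hpd, fun φ hφ hφc => ?_⟩
  exact integral_mul_fderiv_eq_neg_fderiv_mul_of_integrable
    (integrable_mul_of_hasCompactSupport hpd hφ.continuous hφc)
    (integrable_mul_of_hasCompactSupport hf.continuous.locallyIntegrable
      (contDiff_pd 0 hφ).continuous (hasCompactSupport_pd 0 hφc))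
    (integrable_mul_of_hasCompactSupport hf.continuous.locallyIntegrable hφ.continuous hφc)
    (fun x _ => hf.differentiable (by simp) x) (fun x _ => hφ.differentiable (by simp) x)

theorem contDiff_linear {n : WithTop ℕ∞} (c : ℝ) : ContDiff ℝ n fun x : Plane => c * x 0 :=
  contDiff_const.mul (contDiff_apply ℝ ℝ 0)

theorem pd_linear (i : Fin 2) (c : ℝ) (x : Plane) : pd i (fun x => c * x 0) x = c * e i 0 := by
  have h := (ContinuousLinearMap.proj (R := ℝ) (φ := fun _ : Fin 2 => ℝ) 0).hasFDerivAt
    (x := x).const_mul c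
  have h' : fderiv ℝ (fun x : Plane => c * x 0) x = _ := h.fderiv
  simp [pd, h']

/-- The part `f(x) - c x₁` of a function `f` that grows by `c` over a period in `x₁`. -/
def periodicPart (c : ℝ) (f : Plane → ℝ) (x : Plane) : ℝ := f x - c * x 0

theorem regDatum_eq (η : Plane → ℝ) (L ε : ℝ) (ρ₀ : Plane → ℝ) :
    regDatum η L ε ρ₀ = fun x => mollify η ε (periodicPart L ρ₀) x + (L + ε) * x 0 :=
  rfl

theorem periodicPart_regDatum (η : Plane → ℝ) (L ε : ℝ) (ρ₀ : Plane → ℝ) :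
    periodicPart (L + ε) (regDatum η L ε ρ₀) = mollify η ε (periodicPart L ρ₀) :=
  funext fun _ => add_sub_cancel_right _ _

/-- The entropy `∫ (∂₁f + δ) log (∂₁f + δ)` over a period. -/
def entropy (δ : ℝ) (f : Plane → ℝ) : ℝ := ∫ x, ent δ (descend (pd 0 f) x) ∂torusMeasure

/-- The energy `∫ (f - c x₁)²` over a period. -/
def energy (c : ℝ) (f : Plane → ℝ) : ℝ := ∫ x, descend (periodicPart c f) x ^ 2 ∂torusMeasure

namespace IsInitialDatum

variable {η ρ₀ g : Plane → ℝ} {L ε : ℝ}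

theorem locallyIntegrable (h : IsInitialDatum L ρ₀) : LocallyIntegrable ρ₀ := by
  rw [locallyIntegrable_iff]
  intro K hK
  have : IsFiniteMeasure (volume.restrict K) := ⟨by simpa using hK.measure_lt_top⟩
  exact (h.memLp_loc K hK).integrable (by norm_num)

theorem locallyIntegrable_periodicPart (h : IsInitialDatum L ρ₀) :
    LocallyIntegrable (periodicPart L ρ₀) :=
  h.locallyIntegrable.sub (contDiff_linear (n := 0) L).continuous.locallyIntegrable

theorem ae_periodic_periodicPart (h : IsInitialDatum L ρ₀) (i : Fin 2) :
    ∀ᵐ x, periodicPart L ρ₀ (x + e i) = periodicPart L ρ₀ x := by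
  fin_cases i
  · filter_upwards [h.shift_one] with x hx
    have he : (x + e 0) 0 = x 0 + 1 := by simp [e]
    simp only [periodicPart, hx, he, Fin.zero_eta]
    ring
  · filter_upwards [h.shift_two] with x hx
    have he : (x + e 1) 0 = x 0 := by simp [e]
    simp only [periodicPart, hx, he, Fin.mk_one]

theorem memLp_descend_periodicPart (h : IsInitialDatum L ρ₀) :
    MemLp (descend (periodicPart L ρ₀)) 2 torusMeasure := by
  have hlinear : MemLp (fun x : Plane => L * x 0) 2 (volume.restrict (Icc (0 : Plane) 1)) := by
    have hcont := (contDiff_linear (n := 0) L).continuous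
    obtain ⟨C, hC⟩ := (isCompact_Icc (a := (0 : Plane)) (b := 1)).exists_bound_of_continuousOn
      hcont.continuousOn
    have : IsFiniteMeasure (volume.restrict (Icc (0 : Plane) 1)) :=
      ⟨by simpa using isCompact_Icc.measure_lt_top⟩
    exact MemLp.of_bound hcont.aestronglyMeasurable C
      ((ae_restrict_iff' measurableSet_Icc).2 (Filter.Eventually.of_forall hC))
  exact ((h.memLp_loc _ isCompact_Icc).sub hlinear).comp_measurePreserving
    measurePreserving_cellRep

theorem isWeakPartialOne_periodicPart (h : IsInitialDatum L ρ₀) (hg : IsWeakPartialOne ρ₀ g) :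
    IsWeakPartialOne (periodicPart L ρ₀) fun x => g x - L := by
  have hlinear := contDiff_linear (n := 1) L
  have hpd : pd 0 (fun x : Plane => L * x 0) = fun _ => L :=
    funext fun x => by rw [pd_linear, e, Pi.single_eq_same, mul_one]
  have hL := hpd ▸ isWeakPartialOne_pd_zero hlinear
  exact hg.sub h.locallyIntegrable hlinear.continuous.locallyIntegrable hL

theorem pd_zero_regDatum (h : IsInitialDatum L ρ₀) (hη : IsMollifier η) (hε : 0 < ε)
    (hg : IsWeakPartialOne ρ₀ g) :
    pd 0 (regDatum η L ε ρ₀) = fun x => mollify η ε g x + ε := by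
  funext x
  have hloc := h.locallyIntegrable_periodicPart
  have hmoll : DifferentiableAt ℝ (mollify η ε (periodicPart L ρ₀)) x :=
    (hη.contDiff_mollify hε hloc).differentiable (by simp) x
  have hlinear : DifferentiableAt ℝ (fun x : Plane => (L + ε) * x 0) x :=
    (contDiff_linear (n := 1) (L + ε)).differentiable (by simp) x
  calc pd 0 (regDatum η L ε ρ₀) x
      = pd 0 (mollify η ε (periodicPart L ρ₀)) x + pd 0 (fun x => (L + ε) * x 0) x := by
        simp only [pd, regDatum_eq, fderiv_fun_add hmoll hlinear, add_apply]
    _ = mollify η ε g x + ε := by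
        rw [hη.pd_zero_mollify hε hloc (h.isWeakPartialOne_periodicPart hg),
          hη.mollify_sub_const hε hg.1, pd_linear, e, Pi.single_eq_same]
        ring

theorem entropy_regDatum_le (h : IsInitialDatum L ρ₀) (hη : IsMollifier η) (hε : 0 < ε)
    (hε1 : ε ≤ 1) (hg : IsWeakPartialOne ρ₀ g) (hg0 : ∀ᵐ x, 0 ≤ g x)
    (hgl : MemLlogL (descend g)) {δ : ℝ} (hδ : 0 < δ) (hδ1 : δ ≤ 1) :
    entropy δ (regDatum η L ε ρ₀) ≤ ∫ z, ent 2 (descend g z) ∂torusMeasure := by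
  have := hη.isProbabilityMeasure hε
  have hperiodic : ∀ i, ∀ᵐ x, g (x + e i) = g x := fun i => by
    filter_upwards [(h.isWeakPartialOne_periodicPart hg).ae_periodic
      (h.ae_periodic_periodicPart i)] with x hx
    linarith
  have hdescend0 : ∀ᵐ z ∂torusMeasure, 0 ≤ descend g z :=
    measurePreserving_cellRep.quasiMeasurePreserving.ae (ae_restrict_of_ae hg0)
  have hmoll0 := hη.mollify_nonneg (ε := ε) hg0
  have hcont := (hη.contDiff_mollify hε hg.1).continuous
  rw [entropy, h.pd_zero_regDatum hη hε hg]
  calc ∫ z, ent δ (descend (fun x => mollify η ε g x + ε) z) ∂torusMeasure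
      ≤ ∫ z, descend (fun x => ent 2 (mollify η ε g x)) z ∂torusMeasure := by
        refine integral_mono
          (integrable_descend ((continuous_ent δ).comp (hcont.add continuous_const)))
          (integrable_descend ((continuous_ent 2).comp hcont)) fun z => ?_
        have := hmoll0 (cellRep z)
        simp only [descend_apply]
        exact mul_log_le_mul_log (by linarith) (by linarith) (by linarith)
    _ = ∫ z, ent 2 (∫ y, descend g (z - toTorus y) ∂(mollMeasure η ε)) ∂torusMeasure :=
        integral_congr_ae (Filter.Eventually.of_forall fun z =>
          congrArg (ent 2) (hη.descend_mollify hperiodic z))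
    _ ≤ ∫ z, ent 2 (descend g z) ∂torusMeasure :=
        integral_convex_average_le hgl.1 (convexOn_ent zero_le_two)
          (continuous_ent 2).continuousOn isClosed_Ici hdescend0
          (hgl.integrable_ent_two hdescend0)
          (fun y hy => ent_nonneg (by linarith [mem_Ici.1 hy])) measurable_toTorus _

theorem energy_regDatum_le (h : IsInitialDatum L ρ₀) (hη : IsMollifier η) (hε : 0 < ε) :
    energy (L + ε) (regDatum η L ε ρ₀) ≤ energy L ρ₀ := by
  have := hη.isProbabilityMeasure hε
  have hmem := h.memLp_descend_periodicPart
  simp only [energy, periodicPart_regDatum, hη.descend_mollify h.ae_periodic_periodicPart]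
  exact integral_convex_average_le (Φ := fun y => y ^ 2) (hmem.integrable (by norm_num))
    (Even.convexOn_pow even_two) (by fun_prop) isClosed_univ (by simp) hmem.integrable_sq
    (fun y _ => sq_nonneg y) measurable_toTorus _

theorem exists_bound (h : IsInitialDatum L ρ₀) (hη : IsMollifier η) :
    ∃ K : ℝ, ∀ ε, 0 < ε → ε ≤ 1 →
      (∀ δ, 0 < δ → δ ≤ 1 → entropy δ (regDatum η L ε ρ₀) ≤ K) ∧
        energy (L + ε) (regDatum η L ε ρ₀) ≤ K := by
  obtain ⟨g, hg, hg0, hgl⟩ := h.deriv_one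
  exact ⟨max (∫ z, ent 2 (descend g z) ∂torusMeasure) (energy L ρ₀), fun ε hε hε1 =>
    ⟨fun δ hδ hδ1 => le_max_of_le_left (h.entropy_regDatum_le hη hε hε1 hg hg0 hgl hδ hδ1),
      le_max_of_le_right (h.energy_regDatum_le hη hε)⟩⟩

end IsInitialDatum

/-! ### Entropy production of a smooth component -/

theorem IsPeriodic.comp {f : Plane → ℝ} (h : IsPeriodic f) (F : ℝ → ℝ) :
    IsPeriodic fun x => F (f x) := fun i x => congrArg F (h i x)

theorem pd_add {i : Fin 2} {f g : Plane → ℝ} {x : Plane} (hf : DifferentiableAt ℝ f x)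
    (hg : DifferentiableAt ℝ g x) : pd i (fun y => f y + g y) x = pd i f x + pd i g x := by
  simp [pd, fderiv_fun_add hf hg]

theorem pd_sub {i : Fin 2} {f g : Plane → ℝ} {x : Plane} (hf : DifferentiableAt ℝ f x)
    (hg : DifferentiableAt ℝ g x) : pd i (fun y => f y - g y) x = pd i f x - pd i g x := by
  simp [pd, fderiv_fun_sub hf hg]

theorem pd_pd_sub (i : Fin 2) {f g : Plane → ℝ} (hf : ContDiff ℝ ∞ f) (hg : ContDiff ℝ ∞ g) :
    pd i (pd i fun x => f x - g x) = fun x => pd i (pd i f) x - pd i (pd i g) x := by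
  have hpd : pd i (fun x => f x - g x) = fun x => pd i f x - pd i g x :=
    funext fun x => pd_sub (hf.differentiable (by simp) x) (hg.differentiable (by simp) x)
  rw [hpd]
  exact funext fun x => pd_sub ((contDiff_pd i hf).differentiable (by simp) x)
    ((contDiff_pd i hg).differentiable (by simp) x)

theorem pd_comp {i : Fin 2} {f : Plane → ℝ} {x : Plane} {F : ℝ → ℝ} {F' : ℝ}
    (hF : HasDerivAt F F' (f x)) (hf : DifferentiableAt ℝ f x) :
    pd i (fun y => F (f y)) x = F' * pd i f x :=
  congrArg (· (e i)) (hF.comp_hasFDerivAt x hf.hasFDerivAt).fderiv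

theorem contDiff_lap {f : Plane → ℝ} (h : ContDiff ℝ ∞ f) : ContDiff ℝ ∞ (lap f) :=
  (contDiff_pd 0 (contDiff_pd 0 h)).add (contDiff_pd 1 (contDiff_pd 1 h))

theorem lap_eq_sum (f : Plane → ℝ) (x : Plane) : lap f x = ∑ i, pd i (pd i f) x := by
  rw [Fin.sum_univ_two, lap]

theorem lap_sub {f g : Plane → ℝ} (hf : ContDiff ℝ ∞ f) (hg : ContDiff ℝ ∞ g) :
    lap (fun x => f x - g x) = fun x => lap f x - lap g x := by
  funext x
  simp only [lap_eq_sum, pd_pd_sub _ hf hg, Finset.sum_sub_distrib]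

theorem pd_zero_lap {f : Plane → ℝ} (h : ContDiff ℝ ∞ f) : pd 0 (lap f) = lap (pd 0 f) := by
  funext x
  refine (pd_add ((contDiff_pd 0 (contDiff_pd 0 h)).differentiable (by simp) x)
    ((contDiff_pd 1 (contDiff_pd 1 h)).differentiable (by simp) x)).trans ?_
  rw [pd_comm ((contDiff_pd 1 h).of_le (WithTop.coe_le_coe.2 le_top)) 0 1,
    pd_comm (h.of_le (WithTop.coe_le_coe.2 le_top)) 0 1]
  rfl

theorem isPeriodic_lap {f : Plane → ℝ} (h : ∀ i, IsPeriodic (pd i f)) :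
    IsPeriodic (lap f) := fun i x => by
  simp only [lap, (h 0).pd 0 i x, (h 1).pd 1 i x]

theorem integral_descend_mul_lap {f g : Plane → ℝ} (hf : ContDiff ℝ ∞ f) (hg : ContDiff ℝ ∞ g)
    (hfp : IsPeriodic f) (hgp : ∀ i, IsPeriodic (pd i g)) :
    ∫ x, descend f x * descend (lap g) x ∂torusMeasure =
      -∑ i, ∫ x, descend (pd i f) x * descend (pd i g) x ∂torusMeasure := by
  have hint (i : Fin 2) :
      Integrable (fun x => descend f x * descend (pd i (pd i g)) x) torusMeasure :=
    integrable_descend_mul hf.continuous (contDiff_pd i (contDiff_pd i hg)).continuous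
  simp only [descend_apply, lap_eq_sum, Finset.mul_sum] at hint ⊢
  rw [integral_finsetSum _ fun i _ => hint i, ← Finset.sum_neg_distrib]
  exact Finset.sum_congr rfl fun i _ => integral_descend_mul_pd i (hf.of_le (by simp))
    ((contDiff_pd i hg).of_le (by simp)) hfp (hgp i)

/-- The function `log (∂₁f + δ)`, which is the derivative of `ent δ` at `∂₁f` up to the additive
constant `1`. -/
def logSlope (δ : ℝ) (f : Plane → ℝ) (x : Plane) : ℝ := Real.log (pd 0 f x + δ)

section LogSlope

variable {f : Plane → ℝ} {δ : ℝ}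

theorem contDiff_logSlope (hf : ContDiff ℝ ∞ f) (hpos : ∀ x, 0 < pd 0 f x + δ) :
    ContDiff ℝ ∞ (logSlope δ f) :=
  ((contDiff_pd 0 hf).add contDiff_const).log fun x => (hpos x).ne'

theorem isPeriodic_logSlope (hf : IsPeriodic (pd 0 f)) : IsPeriodic (logSlope δ f) :=
  hf.comp fun y => Real.log (y + δ)

theorem pd_logSlope_mul {x : Plane} (i : Fin 2) (hf : DifferentiableAt ℝ (pd 0 f) x)
    (hpos : 0 < pd 0 f x + δ) :
    pd i (logSlope δ f) x * (pd 0 f x + δ) = pd i (pd 0 f) x := by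
  have hlog : HasDerivAt (fun y => Real.log (y + δ)) (pd 0 f x + δ)⁻¹ (pd 0 f x) := by
    simpa using ((hasDerivAt_id (pd 0 f x)).add_const δ).log hpos.ne'
  have hcomp : pd i (logSlope δ f) x = (pd 0 f x + δ)⁻¹ * pd i (pd 0 f) x :=
    pd_comp (F := fun y => Real.log (y + δ)) hlog hf
  rw [hcomp]
  field_simp

/-- Two integrations by parts turn the integral into `∫ |∇ log (∂₁f + δ)|² (∂₁f + δ)`. -/
theorem integral_pd_logSlope_mul_lap_nonneg (hf : ContDiff ℝ ∞ f)
    (hfp : ∀ i, IsPeriodic (pd i f)) (hpos : ∀ x, 0 < pd 0 f x + δ) :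
    0 ≤ ∫ x, descend (pd 0 (logSlope δ f)) x * descend (lap f) x ∂torusMeasure := by
  have hl := contDiff_logSlope hf hpos
  have hlp : IsPeriodic (logSlope δ f) := isPeriodic_logSlope (hfp 0)
  have hθ := contDiff_pd 0 hf
  rw [← neg_neg (∫ x, _ ∂torusMeasure), ← integral_descend_mul_pd 0 (hl.of_le (by simp))
    ((contDiff_lap hf).of_le (by simp)) hlp (isPeriodic_lap hfp), pd_zero_lap hf,
    integral_descend_mul_lap hl hθ hlp fun i => (hfp 0).pd i, neg_neg]
  refine Finset.sum_nonneg fun i _ => integral_nonneg fun x => ?_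
  simp only [descend_apply, Pi.zero_apply]
  rw [← pd_logSlope_mul i (hθ.differentiable (by simp) _) (hpos _), ← mul_assoc, ← sq]
  exact mul_nonneg (sq_nonneg _) (hpos _).le

theorem integral_mul_pd_logSlope_mul_pd (u : L2R) (hf : ContDiff ℝ ∞ f)
    (hpos : ∀ x, 0 < pd 0 f x + δ) :
    ∫ x, u x * (descend (pd 0 (logSlope δ f)) x * descend (pd 0 f) x) ∂torusMeasure =
      ∫ x, u x * descend (pd 0 (pd 0 f)) x ∂torusMeasure -
        δ * ∫ x, u x * descend (pd 0 (logSlope δ f)) x ∂torusMeasure := by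
  have hθ := contDiff_pd 0 hf
  rw [← integral_const_mul, ← integral_sub (integrable_mul_descend _ (contDiff_pd 0 hθ))
    ((integrable_mul_descend _ (contDiff_pd 0 (contDiff_logSlope hf hpos))).const_mul δ)]
  refine integral_congr_ae (.of_forall fun x => ?_)
  simp only [descend_apply]
  rw [← pd_logSlope_mul 0 (hθ.differentiable (by simp) _) (hpos _)]
  ring

end LogSlope

theorem SmoothOn.ent {T δ : ℝ} {ρ : ℝ → Plane → ℝ} (h : SmoothOn T ρ)
    (hpos : ∀ t ∈ Ico 0 T, ∀ x, 0 < Dislocation.pd 0 (ρ t) x + δ) :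
    SmoothOn T fun t x => ent δ (Dislocation.pd 0 (ρ t) x) := by
  have hshift : ContDiffOn ℝ ∞ (fun p : ℝ × Plane => Dislocation.pd 0 (ρ p.1) p.2 + δ)
      (Ico 0 T ×ˢ univ) := ContDiffOn.add (h.pd 0) contDiffOn_const
  exact hshift.mul (hshift.log fun p hp => (hpos p.1 hp.1 p.2).ne')

theorem SmoothOn.continuousOn_entropy {T δ : ℝ} {ρ : ℝ → Plane → ℝ} (h : SmoothOn T ρ)
    (hpos : ∀ t ∈ Ico 0 T, ∀ x, 0 < Dislocation.pd 0 (ρ t) x + δ) :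
    ContinuousOn (fun t => entropy δ (ρ t)) (Ico 0 T) :=
  continuousOn_integral_descend (G := fun t x => Dislocation.ent δ (Dislocation.pd 0 (ρ t) x))
    (h.ent hpos).continuousOn

theorem SmoothOn.hasDerivAt_entropy {T δ t : ℝ} {ρ : ℝ → Plane → ℝ} (h : SmoothOn T ρ)
    (hpos : ∀ t ∈ Ico 0 T, ∀ x, 0 < Dislocation.pd 0 (ρ t) x + δ) (ht : t ∈ Ioo 0 T)
    (hpd : IsPeriodic (Dislocation.pd 0 (ρ t))) (hdt : IsPeriodic (dt ρ t)) :
    HasDerivAt (fun τ => entropy δ (ρ τ))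
      (-∫ x, descend (Dislocation.pd 0 (logSlope δ (ρ t))) x * descend (dt ρ t) x ∂torusMeasure)
      t := by
  have ht' := Ioo_subset_Ico_self ht
  have hl := contDiff_logSlope (h.contDiff ht') (hpos t ht')
  have hpd_add_one : Dislocation.pd 0 (fun y => logSlope δ (ρ t) y + 1) =
      Dislocation.pd 0 (logSlope δ (ρ t)) := by
    funext y
    simp [Dislocation.pd, fderiv_add_const]
  have hdt_ent (x : Plane) : dt (fun τ y => Dislocation.ent δ (Dislocation.pd 0 (ρ τ) y)) t x =
      (logSlope δ (ρ t) x + 1) * Dislocation.pd 0 (dt ρ t) x := by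
    have hshift := ((h.pd 0).hasDerivAt ht x).add_const δ
    rw [← h.dt_pd 0 ht x]
    refine (hshift.mul (hshift.log (hpos t ht' x).ne')).deriv.trans ?_
    have := (hpos t ht' x).ne'
    rw [logSlope]
    field_simp
  refine ((h.ent hpos).hasDerivAt_integral_descend ht).congr_deriv ?_
  rw [← hpd_add_one, ← integral_descend_mul_pd 0 ((hl.add contDiff_const).of_le (by simp))
    ((h.contDiff_dt ht).of_le (by simp)) ((isPeriodic_logSlope hpd).comp fun y => y + 1) hdt]
  exact integral_congr_ae (.of_forall fun x => hdt_ent _)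

section PeriodicPart

variable {f : Plane → ℝ} {c : ℝ}

theorem contDiff_periodicPart (hf : ContDiff ℝ ∞ f) (c : ℝ) : ContDiff ℝ ∞ (periodicPart c f) :=
  hf.sub (contDiff_linear c)

theorem pd_periodicPart (hf : Differentiable ℝ f) (c : ℝ) (i : Fin 2) :
    pd i (periodicPart c f) = fun x => pd i f x - c * e i 0 := by
  funext x
  rw [← pd_linear i c x]
  exact pd_sub (hf x) ((contDiff_linear (n := 1) c).differentiable one_ne_zero x)

theorem lap_periodicPart (hf : Differentiable ℝ f) (c : ℝ) : lap (periodicPart c f) = lap f := by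
  funext x
  simp only [lap, pd_periodicPart hf]
  simp only [pd, fderiv_sub_const]
  rfl

theorem IsPeriodic.pd_of_periodicPart (hf : Differentiable ℝ f)
    (hp : IsPeriodic (periodicPart c f)) (i : Fin 2) : IsPeriodic (Dislocation.pd i f) := by
  intro j x
  have := hp.pd i j x
  rwa [pd_periodicPart hf, sub_left_inj] at this

theorem integral_descend_pd_zero (hf : ContDiff ℝ ∞ f) (hp : IsPeriodic (periodicPart c f)) :
    ∫ x, descend (pd 0 f) x ∂torusMeasure = c := by
  have hzero := integral_descend_pd 0 ((contDiff_periodicPart hf c).of_le (by simp)) hp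
  rw [pd_periodicPart (hf.differentiable (by simp))] at hzero
  have hsub := integral_sub (integrable_descend (contDiff_pd 0 hf).continuous)
    (integrable_const (μ := torusMeasure) (c * e 0 0))
  exact sub_eq_zero.1 (by simpa [e] using hsub.symm.trans hzero)

end PeriodicPart

section L2

variable {f : Plane → ℝ}

theorem exists_abs_descend_le (hf : Continuous f) : ∃ B, ∀ x, |descend f x| ≤ B := by
  obtain ⟨B, hB⟩ := (isCompact_Icc (a := (0 : Plane)) (b := 1)).exists_bound_of_continuousOn
    hf.continuousOn
  exact ⟨B, fun x => hB _ (cellRep_mem_Icc x)⟩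

theorem integrable_mul_mul_descend (v : L2R) {w : Torus → ℝ} (hw : MemLp w 2 torusMeasure)
    (hf : Continuous f) :
    Integrable (fun x => v x * (w x * descend f x)) torusMeasure := by
  obtain ⟨B, hB⟩ := exists_abs_descend_le hf
  have hvw : Integrable (fun x => v x * w x) torusMeasure := (Lp.memLp v).integrable_mul hw
  simp only [← mul_assoc]
  exact hvw.mul_bdd (c := B) (memLp_descend hf).aestronglyMeasurable (.of_forall hB)

end L2

namespace IsComponent

variable {η : Plane → ℝ} {L ε T s : ℝ} {u : ℝ → L2R} {ρ₀ : Plane → ℝ} {ρ : ℝ → Plane → ℝ}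

theorem smoothOn (hc : IsComponent η L ε T s u ρ₀ ρ) : SmoothOn T ρ := hc.smooth

theorem contDiff (hc : IsComponent η L ε T s u ρ₀ ρ) {t : ℝ} (ht : t ∈ Ico 0 T) :
    ContDiff ℝ ∞ (ρ t) := hc.smoothOn.contDiff ht

theorem shift (hc : IsComponent η L ε T s u ρ₀ ρ) {t : ℝ} (ht : t ∈ Ico 0 T)
    (i : Fin 2) (x : Plane) : ρ t (x + e i) = ρ t x + (L + ε) * e i 0 := by
  fin_cases i
  · simpa [e] using hc.shift_one t ht x
  · simpa [e] using hc.shift_two t ht x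

theorem isPeriodic_periodicPart (hc : IsComponent η L ε T s u ρ₀ ρ) {t : ℝ} (ht : t ∈ Ico 0 T) :
    IsPeriodic (periodicPart (L + ε) (ρ t)) := fun i x => by
  simp only [periodicPart, hc.shift ht, Pi.add_apply]
  ring

theorem isPeriodic_pd (hc : IsComponent η L ε T s u ρ₀ ρ) {t : ℝ} (ht : t ∈ Ico 0 T)
    (i : Fin 2) : IsPeriodic (pd i (ρ t)) :=
  IsPeriodic.pd_of_periodicPart ((hc.contDiff ht).differentiable (by simp))
    (hc.isPeriodic_periodicPart ht) i

theorem isPeriodic_dt (hc : IsComponent η L ε T s u ρ₀ ρ) {t : ℝ} (ht : t ∈ Ioo 0 T) :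
    IsPeriodic (dt ρ t) := by
  intro i x
  have hshift : (fun τ => ρ τ (x + e i)) =ᶠ[nhds t] fun τ => ρ τ x + (L + ε) * e i 0 := by
    filter_upwards [isOpen_Ioo.mem_nhds ht] with τ hτ
    exact hc.shift (Ioo_subset_Ico_self hτ) i x
  rw [dt, hshift.deriv_eq, deriv_add_const, dt]

theorem integral_pd_zero (hc : IsComponent η L ε T s u ρ₀ ρ) {t : ℝ} (ht : t ∈ Ico 0 T) :
    ∫ x, descend (pd 0 (ρ t)) x ∂torusMeasure = L + ε :=
  integral_descend_pd_zero (hc.contDiff ht) (hc.isPeriodic_periodicPart ht)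

theorem add_pos (hc : IsComponent η L ε T s u ρ₀ ρ) {δ : ℝ} (hδ : 0 < δ) :
    ∀ t ∈ Ico 0 T, ∀ x, 0 < pd 0 (ρ t) x + δ := fun t ht x =>
  add_pos_of_nonneg_of_pos (hc.monotone t ht x) hδ

theorem integral_mul_dt (hc : IsComponent η L ε T s u ρ₀ ρ) {t : ℝ}
    (ht : t ∈ Ioo 0 T) {w : Torus → ℝ} (hw : MemLp w 2 torusMeasure) :
    ∫ x, w x * descend (dt ρ t) x ∂torusMeasure =
      ε * ∫ x, w x * descend (lap (ρ t)) x ∂torusMeasure -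
        s * ∫ x, u t x * (w x * descend (pd 0 (ρ t)) x) ∂torusMeasure := by
  have ht' := Ioo_subset_Ico_self ht
  have hlap : Integrable (fun x => w x * descend (lap (ρ t)) x) torusMeasure :=
    hw.integrable_mul (memLp_descend (contDiff_lap (hc.contDiff ht')).continuous)
  rw [← integral_const_mul, ← integral_const_mul, ← integral_sub (hlap.const_mul _)
    ((integrable_mul_mul_descend (u t) hw
      (contDiff_pd 0 (hc.contDiff ht')).continuous).const_mul _)]
  refine integral_congr_ae ?_
  filter_upwards [hc.equation t ht] with x hx
  linear_combination w x * hx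

theorem exists_hasDerivAt_entropy (hc : IsComponent η L ε T s u ρ₀ ρ) (hε : 0 ≤ ε) {δ : ℝ}
    (hδ : 0 < δ) {t : ℝ} (ht : t ∈ Ioo 0 T) :
    ∃ E' : ℝ, HasDerivAt (fun τ => entropy δ (ρ τ)) E' t ∧
      E' ≤ s * ∫ x, u t x * descend (pd 0 (pd 0 (ρ t))) x ∂torusMeasure -
        s * δ * ∫ x, u t x * descend (pd 0 (logSlope δ (ρ t))) x ∂torusMeasure := by
  have ht' := Ioo_subset_Ico_self ht
  have hρ := hc.contDiff ht'
  have hpos := hc.add_pos hδ t ht'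
  refine ⟨_, hc.smoothOn.hasDerivAt_entropy (hc.add_pos hδ) ht (hc.isPeriodic_pd ht' 0)
    (hc.isPeriodic_dt ht), ?_⟩
  have hdiffusion := mul_nonneg hε
    (integral_pd_logSlope_mul_lap_nonneg hρ (hc.isPeriodic_pd ht') hpos)
  rw [hc.integral_mul_dt ht
    (memLp_descend (contDiff_pd 0 (contDiff_logSlope hρ hpos)).continuous),
    integral_mul_pd_logSlope_mul_pd _ hρ hpos]
  linarith

end IsComponent

/-! ### The entropy inequality -/

section ScalarBounds

variable {δ y : ℝ}

theorem neg_one_le_ent (h : 0 < y + δ) : -1 ≤ ent δ y := by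
  have hlog := mul_le_mul_of_nonneg_left (Real.one_sub_inv_le_log_of_pos h) h.le
  rw [mul_sub, mul_inv_cancel₀ h.ne', mul_one] at hlog
  unfold ent
  linarith

theorem log_add_sq_le (hδ : 0 < δ) (hδ1 : δ ≤ 1) (hy : 0 ≤ y) :
    Real.log (y + δ) ^ 2 ≤ Real.log δ ^ 2 + 4 * (y + 1) := by
  have hpos : 0 < y + δ := by linarith
  rcases le_total (y + δ) 1 with hle | hle
  · have hlog := Real.log_nonpos hpos.le hle
    have hmono := Real.log_le_log hδ (show δ ≤ y + δ by linarith)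
    nlinarith
  · have hlog : Real.log (y + δ) ≤ 2 * √(y + δ) := by
      have := Real.log_le_sub_one_of_pos (Real.sqrt_pos.2 hpos)
      rw [Real.log_sqrt hpos.le] at this
      linarith
    have hsq := pow_le_pow_left₀ (Real.log_nonneg hle) hlog 2
    rw [mul_pow, Real.sq_sqrt hpos.le] at hsq
    nlinarith [sq_nonneg (Real.log δ)]

theorem sq_mul_log_sq_le (hδ : 0 < δ) (hδ1 : δ ≤ 1) : δ ^ 2 * Real.log δ ^ 2 ≤ 4 * δ := by
  have hs := Real.sqrt_pos.2 hδ
  have hlog : √δ * -Real.log δ ≤ 2 := by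
    have := mul_le_mul_of_nonneg_left (Real.one_sub_inv_le_log_of_pos hs) hs.le
    rw [Real.log_sqrt hδ.le, mul_sub, mul_inv_cancel₀ hs.ne', mul_one] at this
    linarith
  have hsq := pow_le_pow_left₀
    (mul_nonneg hs.le (neg_nonneg.2 (Real.log_nonpos hδ.le hδ1))) hlog 2
  rw [mul_pow, Real.sq_sqrt hδ.le, neg_sq] at hsq
  nlinarith

end ScalarBounds

/-- The Fourier terms of `dissipation v`. -/
def dissipationTerm (v : L2R) (k : Fin 2 → ℤ) : ℝ :=
  rieszSqSymbol k * (2 * Real.pi * k 0) ^ 2 * ‖coeff v k‖ ^ 2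

/-- The dissipation `‖R₁R₂ ∂v/∂x₁‖²` of the entropy, written as a Fourier series. It is `0` by
convention if the series diverges. -/
def dissipation (v : L2R) : ℝ := ∑' k, dissipationTerm v k

theorem dissipationTerm_nonneg (v : L2R) (k : Fin 2 → ℤ) : 0 ≤ dissipationTerm v k :=
  mul_nonneg (mul_nonneg (rieszSqSymbol_nonneg k) (sq_nonneg _)) (sq_nonneg _)

theorem dissipation_nonneg (v : L2R) : 0 ≤ dissipation v := tsum_nonneg (dissipationTerm_nonneg v)

theorem sum_dissipationTerm_le {v : L2R} (h : Summable (dissipationTerm v))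
    (S : Finset (Fin 2 → ℤ)) : ∑ k ∈ S, dissipationTerm v k ≤ dissipation v :=
  h.sum_le_tsum _ fun k _ => dissipationTerm_nonneg v k

theorem integral_mul_toL2 {φ : Plane → ℝ} (h : Continuous φ) (G : Torus → ℝ) :
    ∫ x, G x * toL2 (descend φ) x ∂torusMeasure = ∫ x, G x * descend φ x ∂torusMeasure := by
  simp only [mul_comm (G _)]
  exact integral_toL2_mul h G

theorem hasSum_dissipationTerm {φ : Plane → ℝ} (h : ContDiff ℝ ∞ φ) (hp : IsPeriodic φ) :
    HasSum (dissipationTerm (toL2 (descend φ)))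
      (-∫ x, rieszSq (toL2 (descend φ)) x * descend (pd 0 (pd 0 φ)) x ∂torusMeasure) := by
  have hsum := hasSum_conj_coeff_mul_coeff (rieszSq (toL2 (descend φ)))
    (toL2 (descend (pd 0 (pd 0 φ))))
  rw [integral_mul_toL2 (contDiff_pd 0 (contDiff_pd 0 h)).continuous] at hsum
  refine (Complex.hasSum_re hsum).neg.congr_fun fun k => ?_
  rw [coeff_rieszSq, coeff_pd 0 ((contDiff_pd 0 h).of_le (by simp)) (hp.pd 0),
    coeff_pd 0 (h.of_le (by simp)) hp, dissipationTerm, ← Complex.normSq_eq_norm_sq,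
    Complex.normSq_apply]
  simp only [map_mul, Complex.conj_ofReal, Complex.mul_re, Complex.ofReal_re, Complex.conj_re,
    Complex.ofReal_im, Complex.conj_im, mul_neg, zero_mul, neg_zero, sub_zero, Complex.re_ofNat,
    Complex.im_ofNat, mul_zero, Complex.intCast_re, Complex.mul_im, add_zero, Complex.intCast_im,
    Complex.I_re, Complex.I_im, mul_one, sub_self, zero_sub, zero_add, neg_mul, neg_neg, neg_sub,
    sub_neg_eq_add]
  ring

theorem h1Bound_rieszSq {v : L2R} (h : Summable (dissipationTerm v)) :
    H1Bound (rieszSq v) (dissipation v) := by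
  refine fun S => (Finset.sum_le_sum fun k _ => ?_).trans (sum_dissipationTerm_le h S)
  have hweight : freqWeight k * rieszSqSymbol k ≤ (2 * Real.pi * k 0) ^ 2 := by
    have hpi : 2 ≤ (2 * Real.pi) ^ 2 := by nlinarith [Real.pi_gt_three]
    rw [freqWeight, mul_pow]
    nlinarith [rieszSqSymbol_mul_le k, rieszSqSymbol_le_mul_sq k, rieszSqSymbol_le_one k,
      sq_nonneg (k 0 : ℝ)]
  calc freqWeight k * ‖coeff (rieszSq v) k‖ ^ 2
      = rieszSqSymbol k * (freqWeight k * rieszSqSymbol k) * ‖coeff v k‖ ^ 2 := by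
        rw [coeff_rieszSq, norm_mul, Complex.norm_real, mul_pow, Real.norm_eq_abs, sq_abs]
        ring
    _ ≤ dissipationTerm v k := by
        have := rieszSqSymbol_nonneg k
        rw [dissipationTerm]
        gcongr

theorem abs_integral_rieszSq_mul_pd_le {v : L2R} (h : Summable (dissipationTerm v))
    {l : Plane → ℝ} (hl : ContDiff ℝ 1 l) (hlp : IsPeriodic l) :
    |∫ x, rieszSq v x * descend (pd 0 l) x ∂torusMeasure| ≤
      √(dissipation v) * ‖toL2 (descend l)‖ := by
  have hsum := hasSum_conj_coeff_mul_coeff (rieszSq v) (toL2 (descend (pd 0 l)))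
  rw [integral_mul_toL2 (continuous_pd 0 hl)] at hsum
  rw [← Real.norm_eq_abs, ← Complex.norm_real, ← Real.sqrt_sq (norm_nonneg (toL2 (descend l)))]
  refine norm_le_sqrt_mul_sqrt_of_hasSum hsum
    (a := fun k => rieszSqSymbol k * |2 * Real.pi * k 0| * ‖coeff v k‖)
    (b := fun k => ‖coeff (toL2 (descend l)) k‖) (fun k => ?_) (fun S => ?_)
    (sum_norm_coeff_sq_le _)
  · rw [coeff_pd 0 hl hlp, coeff_rieszSq]
    simp [abs_of_nonneg (rieszSqSymbol_nonneg k), abs_mul, mul_assoc, mul_left_comm]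
  · refine (Finset.sum_le_sum fun k _ => ?_).trans (sum_dissipationTerm_le h S)
    have hsq : rieszSqSymbol k ^ 2 ≤ rieszSqSymbol k :=
      pow_le_of_le_one (rieszSqSymbol_nonneg k) (rieszSqSymbol_le_one k) two_ne_zero
    rw [mul_pow, mul_pow, sq_abs, dissipationTerm]
    gcongr

theorem integral_rieszSq_mul_pd_pd_sub {f g : Plane → ℝ} (hf : ContDiff ℝ ∞ f)
    (hg : ContDiff ℝ ∞ g) (hp : IsPeriodic fun x => f x - g x) :
    ∫ x, rieszSqFn (fun y => f y - g y) x * descend (pd 0 (pd 0 f)) x ∂torusMeasure -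
      ∫ x, rieszSqFn (fun y => f y - g y) x * descend (pd 0 (pd 0 g)) x ∂torusMeasure =
        -dissipation (toL2 (descend fun x => f x - g x)) := by
  rw [dissipation, (hasSum_dissipationTerm (hf.sub hg) hp).tsum_eq, neg_neg, ← integral_sub
    (integrable_mul_descend _ (contDiff_pd 0 (contDiff_pd 0 hf)))
    (integrable_mul_descend _ (contDiff_pd 0 (contDiff_pd 0 hg)))]
  simp only [descend_apply, pd_pd_sub 0 hf hg, mul_sub]
  rfl

section MonotoneFunction

variable {f : Plane → ℝ} {δ : ℝ}

theorem neg_one_le_entropy (hf : ContDiff ℝ 1 f) (hpos : ∀ x, 0 < pd 0 f x + δ) :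
    -1 ≤ entropy δ f := by
  calc (-1 : ℝ) = ∫ _, (-1 : ℝ) ∂torusMeasure := by simp
    _ ≤ entropy δ f := integral_mono (integrable_const _)
        (integrable_descend ((continuous_ent δ).comp (continuous_pd 0 hf)))
        fun x => neg_one_le_ent (hpos _)

theorem norm_toL2_logSlope_sq_le (hf : ContDiff ℝ ∞ f) (hmono : ∀ x, 0 ≤ pd 0 f x) (hδ : 0 < δ)
    (hδ1 : δ ≤ 1) :
    ‖toL2 (descend (logSlope δ f))‖ ^ 2 ≤
      Real.log δ ^ 2 + 4 * (∫ x, descend (pd 0 f) x ∂torusMeasure + 1) := by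
  have hl := (contDiff_logSlope hf fun x => add_pos_of_nonneg_of_pos (hmono x) hδ).continuous
  have hθ := integrable_descend (contDiff_pd 0 hf).continuous
  have hθ_add : Integrable (fun x => 4 * (descend (pd 0 f) x + 1)) torusMeasure :=
    (hθ.add (integrable_const _)).const_mul 4
  rw [norm_toL2_sq hl]
  calc ∫ x, descend (logSlope δ f) x ^ 2 ∂torusMeasure
      ≤ ∫ x, (Real.log δ ^ 2 + 4 * (descend (pd 0 f) x + 1)) ∂torusMeasure :=
        integral_mono (integrable_descend (hl.pow 2)) ((integrable_const _).add hθ_add)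
          fun x => log_add_sq_le hδ hδ1 (hmono _)
    _ = Real.log δ ^ 2 + 4 * (∫ x, descend (pd 0 f) x ∂torusMeasure + 1) := by
        rw [integral_add (integrable_const _) hθ_add, integral_const_mul,
          integral_add hθ (integrable_const _)]
        simp

theorem mul_abs_integral_rieszSq_mul_pd_logSlope_le {v : L2R} (h : Summable (dissipationTerm v))
    (hf : ContDiff ℝ ∞ f) (hmono : ∀ x, 0 ≤ pd 0 f x) (hp : IsPeriodic (pd 0 f)) (hδ : 0 < δ)
    (hδ1 : δ ≤ 1) :
    δ * |∫ x, rieszSq v x * descend (pd 0 (logSlope δ f)) x ∂torusMeasure| ≤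
      dissipation v / 4 + 4 * (∫ x, descend (pd 0 f) x ∂torusMeasure + 2) * δ := by
  have hl := contDiff_logSlope hf fun x => add_pos_of_nonneg_of_pos (hmono x) hδ
  have hcauchy := abs_integral_rieszSq_mul_pd_le h (hl.of_le (by simp)) (isPeriodic_logSlope hp)
  have hnorm := norm_toL2_logSlope_sq_le hf hmono hδ hδ1
  have hmean : 0 ≤ ∫ x, descend (pd 0 f) x ∂torusMeasure := integral_nonneg fun x => hmono _
  set D := √(dissipation v)
  set l := ‖toL2 (descend (logSlope δ f))‖
  set m := ∫ x, descend (pd 0 f) x ∂torusMeasure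
  calc δ * |∫ x, rieszSq v x * descend (pd 0 (logSlope δ f)) x ∂torusMeasure|
      ≤ δ * (D * l) := by gcongr
    _ ≤ D ^ 2 / 4 + δ ^ 2 * l ^ 2 := by linarith [sq_nonneg (D / 2 - δ * l)]
    _ ≤ D ^ 2 / 4 + δ ^ 2 * (Real.log δ ^ 2 + 4 * (m + 1)) := by gcongr
    _ ≤ dissipation v / 4 + 4 * (m + 2) * δ := by
        have hsq : δ ^ 2 ≤ δ := pow_le_of_le_one hδ.le hδ1 two_ne_zero
        rw [Real.sq_sqrt (dissipation_nonneg v)]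
        nlinarith [sq_mul_log_sq_le hδ hδ1]

end MonotoneFunction

/-- The sum of the entropies of the two components at time `t`. -/
def totalEntropy (δ : ℝ) (ρp ρm : ℝ → Plane → ℝ) (t : ℝ) : ℝ :=
  entropy δ (ρp t) + entropy δ (ρm t)

/-- The dissipation of `ρ^{+,ε} - ρ^{-,ε}` at time `t`. -/
def dissipationAt (ρp ρm : ℝ → Plane → ℝ) (t : ℝ) : ℝ :=
  dissipation (toL2 (descend fun x => ρp t x - ρm t x))

theorem dissipationAt_nonneg (ρp ρm : ℝ → Plane → ℝ) (t : ℝ) : 0 ≤ dissipationAt ρp ρm t :=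
  dissipation_nonneg _

namespace IsSolution

variable {η : Plane → ℝ} {L ε T δ t : ℝ} {ρp₀ ρm₀ : Plane → ℝ} {ρp ρm : ℝ → Plane → ℝ}

theorem smoothOn_sub (hs : IsSolution η L ε T ρp₀ ρm₀ ρp ρm) :
    SmoothOn T fun t x => ρp t x - ρm t x := ContDiffOn.sub hs.plus.smooth hs.minus.smooth

theorem isPeriodic_sub (hs : IsSolution η L ε T ρp₀ ρm₀ ρp ρm) (ht : t ∈ Ico 0 T) :
    IsPeriodic fun x => ρp t x - ρm t x := fun i x => by
  simp only [hs.plus.shift ht, hs.minus.shift ht]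
  ring

theorem summable_dissipationTerm (hs : IsSolution η L ε T ρp₀ ρm₀ ρp ρm) (ht : t ∈ Ico 0 T) :
    Summable (dissipationTerm (toL2 (descend fun x => ρp t x - ρm t x))) :=
  (hasSum_dissipationTerm (hs.smoothOn_sub.contDiff ht) (hs.isPeriodic_sub ht)).summable

theorem mul_abs_integral_velocity_mul_pd_logSlope_le (hs : IsSolution η L ε T ρp₀ ρm₀ ρp ρm)
    {s : ℝ} {u : ℝ → L2R} {ρ₀ : Plane → ℝ} {ρ : ℝ → Plane → ℝ}
    (hc : IsComponent η L ε T s u ρ₀ ρ) (hε1 : ε ≤ 1) (hδ : 0 < δ) (hδ1 : δ ≤ 1)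
    (ht : t ∈ Ico 0 T) :
    δ * |∫ x, rieszSqFn (fun x => ρp t x - ρm t x) x *
        descend (pd 0 (logSlope δ (ρ t))) x ∂torusMeasure| ≤
      dissipationAt ρp ρm t / 4 + 4 * (L + 3) * δ := by
  have hle := mul_abs_integral_rieszSq_mul_pd_logSlope_le (hs.summable_dissipationTerm ht)
    (hc.contDiff ht) (hc.monotone t ht) (hc.isPeriodic_pd ht 0) hδ hδ1
  rw [hc.integral_pd_zero ht] at hle
  rw [dissipationAt]
  have hmean : L + ε + 2 ≤ L + 3 := by linarith
  refine hle.trans ?_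
  gcongr

theorem exists_hasDerivAt_totalEntropy (hs : IsSolution η L ε T ρp₀ ρm₀ ρp ρm) (hε : 0 ≤ ε)
    (hε1 : ε ≤ 1) (hδ : 0 < δ) (hδ1 : δ ≤ 1) (ht : t ∈ Ioo 0 T) :
    ∃ E', HasDerivAt (totalEntropy δ ρp ρm) E' t ∧
      E' ≤ -(dissipationAt ρp ρm t / 2) + 8 * (L + 3) * δ := by
  have ht' := Ioo_subset_Ico_self ht
  obtain ⟨Ep, hEp, hEp_le⟩ := hs.plus.exists_hasDerivAt_entropy hε hδ ht
  obtain ⟨Em, hEm, hEm_le⟩ := hs.minus.exists_hasDerivAt_entropy hε hδ ht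
  have hmain := integral_rieszSq_mul_pd_pd_sub (hs.plus.contDiff ht') (hs.minus.contDiff ht')
    (hs.isPeriodic_sub ht')
  have herrp := hs.mul_abs_integral_velocity_mul_pd_logSlope_le hs.plus hε1 hδ hδ1 ht'
  have herrm := hs.mul_abs_integral_velocity_mul_pd_logSlope_le hs.minus hε1 hδ hδ1 ht'
  refine ⟨Ep + Em, hEp.add hEm, ?_⟩
  rw [dissipationAt] at herrp herrm ⊢
  set Ip := ∫ x, rieszSqFn (fun x => ρp t x - ρm t x) x *
    descend (pd 0 (logSlope δ (ρp t))) x ∂torusMeasure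
  set Im := ∫ x, rieszSqFn (fun x => ρp t x - ρm t x) x *
    descend (pd 0 (logSlope δ (ρm t))) x ∂torusMeasure
  have hIp := mul_le_mul_of_nonneg_left (neg_abs_le Ip) hδ.le
  have hIm := mul_le_mul_of_nonneg_left (le_abs_self Im) hδ.le
  linarith

theorem continuousOn_totalEntropy (hs : IsSolution η L ε T ρp₀ ρm₀ ρp ρm) (hδ : 0 < δ) :
    ContinuousOn (totalEntropy δ ρp ρm) (Ico 0 T) :=
  (hs.plus.smoothOn.continuousOn_entropy (hs.plus.add_pos hδ)).add
    (hs.minus.smoothOn.continuousOn_entropy (hs.minus.add_pos hδ))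

end IsSolution

theorem coeff_eq_inner (f : L2R) (k : Fin 2 → ℤ) :
    coeff f k = inner ℂ (UnitAddTorus.mFourierBasis (d := Fin 2) k) (complexify f) := by
  rw [← HilbertBasis.repr_apply_apply, UnitAddTorus.mFourierBasis_repr]
  rfl

theorem continuous_coeff (k : Fin 2 → ℤ) : Continuous fun f : L2R => coeff f k := by
  simp only [coeff_eq_inner]
  exact continuous_const.inner
    (ContinuousLinearMap.continuous (Complex.ofRealCLM.compLpL 2 torusMeasure))

theorem aemeasurable_dissipation {v : ℝ → L2R} {I : Set ℝ} (hv : ContinuousOn v I)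
    (hI : MeasurableSet I) : AEMeasurable (fun t => dissipation (v t)) (volume.restrict I) := by
  have hterm (k : Fin 2 → ℤ) :
      AEMeasurable (fun t => ENNReal.ofReal (dissipationTerm (v t) k)) (volume.restrict I) :=
    ((continuous_const.mul ((continuous_coeff k).norm.pow 2)).comp_continuousOn
      hv |>.aemeasurable hI).ennreal_ofReal
  have hsum (t : ℝ) : dissipation (v t) =
      (∑' k, ENNReal.ofReal (dissipationTerm (v t) k)).toReal := by
    rw [ENNReal.tsum_toReal_eq fun _ => ENNReal.ofReal_ne_top, dissipation]
    exact tsum_congr fun k => (ENNReal.toReal_ofReal (dissipationTerm_nonneg _ k)).symm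
  simp only [hsum]
  exact (AEMeasurable.tsum hterm).ennreal_toReal

theorem lintegral_Ioo_le_of_forall_Ioc {a b : ℝ} {K : ℝ≥0∞} {f : ℝ → ℝ≥0∞}
    (hf : AEMeasurable f (volume.restrict (Ioo a b)))
    (h : ∀ c ∈ Ioo a b, ∫⁻ t in Ioc a c, f t ≤ K) : ∫⁻ t in Ioo a b, f t ≤ K := by
  rcases le_or_gt b a with hba | hab
  · simp [Ioo_eq_empty_of_le hba]
  obtain ⟨c, -, hc, hc_lim⟩ := exists_seq_strictMono_tendsto' hab
  refine le_of_tendsto' ((aecover_Ioo_of_Ioc tendsto_const_nhds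
    hc_lim).lintegral_tendsto_of_countably_generated hf) fun n => ?_
  rw [Measure.restrict_restrict_of_subset (Ioc_subset_Ioo_right (hc n).2)]
  exact h _ (hc n)

theorem integrableOn_and_integral_le_of_hasDerivAt {a c : ℝ} {E φ : ℝ → ℝ} (hac : a ≤ c)
    (hE : ContinuousOn E (Icc a c)) (hφ : AEStronglyMeasurable φ (volume.restrict (Ioc a c)))
    (hφ0 : ∀ t ∈ Ioo a c, 0 ≤ φ t)
    (hE' : ∀ t ∈ Ioo a c, ∃ E', HasDerivAt E E' t ∧ E' ≤ -φ t) :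
    IntegrableOn φ (Ioc a c) ∧ ∫ t in a..c, φ t ≤ E a - E c := by
  have hderiv (t : ℝ) (ht : t ∈ Ioo a c) :
      HasDerivAt (fun t => -E t) (-deriv E t) t ∧ φ t ≤ -deriv E t := by
    obtain ⟨E', hd, hle⟩ := hE' t ht
    rw [hd.deriv]
    exact ⟨hd.neg, le_neg_of_le_neg hle⟩
  have hE'_int : IntegrableOn (fun t => -deriv E t) (Ioc a c) :=
    intervalIntegral.integrableOn_deriv_of_nonneg hE.neg (fun t ht => (hderiv t ht).1)
      fun t ht => (hφ0 t ht).trans (hderiv t ht).2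
  have hφ_int : IntegrableOn φ (Ioc a c) := by
    refine hE'_int.mono' hφ ?_
    rw [← restrict_Ioo_eq_restrict_Ioc]
    refine (ae_restrict_iff' measurableSet_Ioo).2 (.of_forall fun t ht => ?_)
    rw [Real.norm_of_nonneg (hφ0 t ht)]
    exact (hderiv t ht).2
  refine ⟨hφ_int, ?_⟩
  have hle := intervalIntegral.integral_le_sub_of_hasDeriv_right_of_le hac hE.neg
    (fun t ht => (hderiv t ht).1.hasDerivWithinAt)
    ((integrableOn_Icc_iff_integrableOn_Ioc).2 hφ_int) fun t ht => (hderiv t ht).2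
  simp only [Pi.neg_apply] at hle
  linarith

theorem lintegral_Ioo_le_of_hasDerivAt {a b m : ℝ} {E φ : ℝ → ℝ}
    (hE : ContinuousOn E (Ico a b)) (hφ : AEMeasurable φ (volume.restrict (Ioo a b)))
    (hφ0 : ∀ t ∈ Ioo a b, 0 ≤ φ t)
    (hE' : ∀ t ∈ Ioo a b, ∃ E', HasDerivAt E E' t ∧ E' ≤ -φ t) (hm : ∀ t ∈ Ioo a b, m ≤ E t) :
    ∫⁻ t in Ioo a b, ENNReal.ofReal (φ t) ≤ ENNReal.ofReal (E a - m) := by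
  refine lintegral_Ioo_le_of_forall_Ioc hφ.ennreal_ofReal fun c hc => ?_
  have hsub : Ioo a c ⊆ Ioo a b := Ioo_subset_Ioo_right hc.2.le
  obtain ⟨hint, hle⟩ := integrableOn_and_integral_le_of_hasDerivAt hc.1.le
    (hE.mono (Icc_subset_Ico_right hc.2))
    (hφ.mono_set (Ioc_subset_Ioo_right hc.2)).aestronglyMeasurable
    (fun t ht => hφ0 t (hsub ht)) fun t ht => hE' t (hsub ht)
  have hφ0_ae : 0 ≤ᵐ[volume.restrict (Ioc a c)] φ := by
    rw [← restrict_Ioo_eq_restrict_Ioc]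
    exact (ae_restrict_iff' measurableSet_Ioo).2 (.of_forall fun t ht => hφ0 t (hsub ht))
  rw [← ofReal_integral_eq_lintegral_ofReal hint hφ0_ae,
    ← intervalIntegral.integral_of_le hc.1.le]
  exact ENNReal.ofReal_le_ofReal (hle.trans (sub_le_sub_left (hm c hc) _))

theorem antitoneOn_Ico_of_hasDerivAt_nonpos {a b : ℝ} {E : ℝ → ℝ} (hE : ContinuousOn E (Ico a b))
    (hE' : ∀ t ∈ Ioo a b, ∃ E', HasDerivAt E E' t ∧ E' ≤ 0) : AntitoneOn E (Ico a b) := by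
  refine antitoneOn_of_deriv_nonpos (convex_Ico a b) hE (fun t ht => ?_) fun t ht => ?_ <;>
    obtain ⟨E', hd, hle⟩ := hE' t (interior_Ico.subset ht)
  · exact hd.differentiableAt.differentiableWithinAt
  · exact hd.deriv.trans_le hle

/-! ### A priori bounds -/

section WeightedBound

variable {f : Plane → ℝ} {δ : ℝ}

theorem integrable_sq_mul_descend (a : L2R) (hf : Continuous f) :
    Integrable (fun x => a x ^ 2 * descend f x) torusMeasure := by
  obtain ⟨B, hB⟩ := exists_abs_descend_le hf
  exact integrable_sq_mul a (integrable_descend hf).aestronglyMeasurable hB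

theorem H1Bound.integral_sq_mul_pd_le {a : L2R} {A : ℝ} (ha : H1Bound a A)
    (hf : ContDiff ℝ 1 f) (hmono : ∀ x, 0 ≤ pd 0 f x) (hδ : 0 < δ) :
    ∫ x, a x ^ 2 * descend (pd 0 f) x ∂torusMeasure ≤
      A * (9 + 72 * (∫ x, descend (pd 0 f) x ∂torusMeasure + (2 * entropy δ f + 2))) := by
  have hf' := continuous_pd 0 hf
  obtain ⟨B, hB⟩ := exists_abs_descend_le hf'
  have hθ : Integrable (descend (pd 0 f)) torusMeasure := integrable_descend hf'
  have hent : Integrable (fun x => ent δ (descend (pd 0 f) x)) torusMeasure :=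
    integrable_descend ((continuous_ent δ).comp hf')
  have hent_add : Integrable (fun x => 2 * ent δ (descend (pd 0 f) x) + 2) torusMeasure :=
    (hent.const_mul 2).add (integrable_const 2)
  have hW : ∫ x, (descend (pd 0 f) x + (2 * ent δ (descend (pd 0 f) x) + 2)) ∂torusMeasure =
      ∫ x, descend (pd 0 f) x ∂torusMeasure + (2 * entropy δ f + 2) := by
    rw [integral_add hθ hent_add, integral_add (hent.const_mul 2) (integrable_const 2),
      integral_const_mul, entropy]
    simp
  rw [← hW]
  refine ha.integral_sq_mul_le hθ.aestronglyMeasurable (fun x => hmono _)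
    (fun x => (le_abs_self _).trans (hB x)) (hθ.add hent_add) (fun x => ?_) fun x hx => ?_
  · have hent_ge : -1 ≤ ent δ (descend (pd 0 f) x) :=
      neg_one_le_ent (add_pos_of_nonneg_of_pos (hmono _) hδ)
    have hθ0 : 0 ≤ descend (pd 0 f) x := hmono _
    linarith
  · have hlog := mul_log_le_mul_log (y := descend (pd 0 f) x) (z := descend (pd 0 f) x + δ)
      (by linarith) (by linarith) (by linarith)
    rw [ent]
    linarith

theorem sq_integral_mul_mul_le {α : Type*} [MeasurableSpace α] {μ : Measure α} {f g θ : α → ℝ}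
    (hθ : ∀ x, 0 ≤ θ x) (hf : Integrable (fun x => f x ^ 2 * θ x) μ)
    (hg : Integrable (fun x => g x ^ 2 * θ x) μ)
    (hfg : Integrable (fun x => f x * (g x * θ x)) μ) :
    (∫ x, f x * (g x * θ x) ∂μ) ^ 2 ≤ (∫ x, f x ^ 2 * θ x ∂μ) * ∫ x, g x ^ 2 * θ x ∂μ := by
  have hquadratic (c : ℝ) : 0 ≤ (∫ x, f x ^ 2 * θ x ∂μ) * (c * c) +
      (2 * ∫ x, f x * (g x * θ x) ∂μ) * c + ∫ x, g x ^ 2 * θ x ∂μ := by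
    calc 0 ≤ ∫ x, (c * f x + g x) ^ 2 * θ x ∂μ :=
          integral_nonneg fun x => mul_nonneg (sq_nonneg _) (hθ x)
      _ = ∫ x, (c * c * (f x ^ 2 * θ x) + 2 * c * (f x * (g x * θ x)) + g x ^ 2 * θ x) ∂μ :=
          integral_congr_ae (.of_forall fun x => by ring)
      _ = _ := by
          rw [integral_add ((hf.const_mul _).fun_add (hfg.const_mul _)) hg,
            integral_add (hf.const_mul _) (hfg.const_mul _), integral_const_mul,
            integral_const_mul]
          ring
  have hdiscrim := discrim_le_zero hquadratic
  rw [discrim] at hdiscrim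
  linarith

theorem two_mul_abs_integral_mul_mul_le (v : L2R) {w : Plane → ℝ} {r : ℝ} (hw : Continuous w)
    (hf : Continuous f) (hf0 : ∀ x, 0 ≤ f x) (hr : 0 < r) :
    2 * |∫ x, v x * (descend w x * descend f x) ∂torusMeasure| ≤
      r * ∫ x, v x ^ 2 * descend f x ∂torusMeasure +
        r⁻¹ * ∫ x, descend w x ^ 2 * descend f x ∂torusMeasure := by
  have hA : 0 ≤ ∫ x, v x ^ 2 * descend f x ∂torusMeasure :=
    integral_nonneg fun x => mul_nonneg (sq_nonneg _) (hf0 _)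
  have hB : 0 ≤ ∫ x, descend w x ^ 2 * descend f x ∂torusMeasure :=
    integral_nonneg fun x => mul_nonneg (sq_nonneg _) (hf0 _)
  have hcauchy := sq_integral_mul_mul_le (f := v) (g := descend w) (θ := descend f)
    (fun x => hf0 _) (integrable_sq_mul_descend v hf) (integrable_descend ((hw.pow 2).mul hf))
    (integrable_mul_mul_descend v (memLp_descend hw) hf)
  set A := ∫ x, v x ^ 2 * descend f x ∂torusMeasure
  set B := ∫ x, descend w x ^ 2 * descend f x ∂torusMeasure
  refine (sq_le_sq₀ (by positivity) (by positivity)).1 ?_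
  have hsq : (r * A - r⁻¹ * B) ^ 2 = (r * A + r⁻¹ * B) ^ 2 - 4 * (A * B) := by
    field_simp
    ring
  rw [mul_pow, sq_abs]
  linarith [sq_nonneg (r * A - r⁻¹ * B)]

end WeightedBound

section Energy

variable {f : Plane → ℝ} {c : ℝ}

theorem energy_nonneg (c : ℝ) (f : Plane → ℝ) : 0 ≤ energy c f :=
  integral_nonneg fun _ => sq_nonneg _

theorem integral_periodicPart_mul_lap_nonpos (hf : ContDiff ℝ ∞ f)
    (hp : IsPeriodic (periodicPart c f)) :
    ∫ x, descend (periodicPart c f) x * descend (lap f) x ∂torusMeasure ≤ 0 := by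
  have hP := contDiff_periodicPart hf c
  rw [← lap_periodicPart (hf.differentiable (by simp)) c,
    integral_descend_mul_lap hP hP hp fun i => hp.pd i, neg_nonpos]
  exact Finset.sum_nonneg fun i _ => integral_nonneg fun x => mul_self_nonneg _

theorem integral_sq_periodicPart_mul_pd_zero (hf : ContDiff ℝ ∞ f)
    (hp : IsPeriodic (periodicPart c f)) :
    ∫ x, descend (periodicPart c f) x ^ 2 * descend (pd 0 f) x ∂torusMeasure =
      c * energy c f := by
  have hP := contDiff_periodicPart hf c
  have hcube (x : Torus) : descend (pd 0 fun y => periodicPart c f y ^ 3) x =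
      3 * (descend (periodicPart c f) x ^ 2 * descend (pd 0 f) x -
        c * descend (periodicPart c f) x ^ 2) := by
    have hcomp := pd_comp (i := 0) (f := periodicPart c f) (x := cellRep x) (hasDerivAt_pow 3 _)
      (hP.differentiable (by simp) _)
    rw [pd_periodicPart (hf.differentiable (by simp))] at hcomp
    refine hcomp.trans ?_
    simp only [descend_apply, e, Pi.single_eq_same]
    push_cast
    ring
  have hzero := integral_descend_pd 0 ((hP.pow 3).of_le (by simp)) (hp.comp fun z => z ^ 3)
  simp only [hcube] at hzero
  have hsq_int : Integrable (fun x => descend (periodicPart c f) x ^ 2) torusMeasure :=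
    integrable_descend (hP.continuous.pow 2)
  have hsq_pd_int : Integrable (fun x => descend (periodicPart c f) x ^ 2 * descend (pd 0 f) x)
      torusMeasure := integrable_descend ((hP.continuous.pow 2).mul (contDiff_pd 0 hf).continuous)
  rw [integral_const_mul, integral_sub hsq_pd_int (hsq_int.const_mul c), integral_const_mul]
    at hzero
  rw [energy]
  linarith

variable {T t : ℝ} {ρ : ℝ → Plane → ℝ}

theorem SmoothOn.sq_periodicPart (h : SmoothOn T ρ) (c : ℝ) :
    SmoothOn T fun t x => periodicPart c (ρ t) x ^ 2 :=
  ContDiffOn.pow (ContDiffOn.sub h ((contDiff_linear c).comp contDiff_snd).contDiffOn) 2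

theorem SmoothOn.continuousOn_energy (h : SmoothOn T ρ) (c : ℝ) :
    ContinuousOn (fun t => energy c (ρ t)) (Ico 0 T) :=
  continuousOn_integral_descend (G := fun t x => periodicPart c (ρ t) x ^ 2)
    (h.sq_periodicPart c).continuousOn

theorem SmoothOn.hasDerivAt_energy (h : SmoothOn T ρ) (c : ℝ) (ht : t ∈ Ioo 0 T) :
    HasDerivAt (fun t => energy c (ρ t))
      (2 * ∫ x, descend (periodicPart c (ρ t)) x * descend (dt ρ t) x ∂torusMeasure) t := by
  have hdt (x : Plane) : dt (fun t x => periodicPart c (ρ t) x ^ 2) t x =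
      2 * (periodicPart c (ρ t) x * dt ρ t x) := by
    refine (((h.hasDerivAt ht x).sub_const (c * x 0)).pow 2).deriv.trans ?_
    simp [periodicPart, mul_assoc]
  refine ((h.sq_periodicPart c).hasDerivAt_integral_descend ht).congr_deriv ?_
  simp only [← integral_const_mul, descend_apply, hdt]

end Energy

/-- The constant `Λ` of the weighted estimate `∫ a² ∂₁ρ ≤ Λ A` for `H1Bound a A`, where `ρ` has
slope at most `L + 1` per period and entropy at most `K`. -/
def weightConst (L K : ℝ) : ℝ := 9 + 72 * (L + 3 + 2 * K)

theorem weightConst_pos {L K : ℝ} (hL : 0 ≤ L) (hK : 0 ≤ K) : 0 < weightConst L K := by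
  rw [weightConst]
  positivity

namespace IsComponent

variable {η : Plane → ℝ} {L ε T s δ K t : ℝ} {u : ℝ → L2R} {ρ₀ : Plane → ℝ} {ρ : ℝ → Plane → ℝ}

theorem integral_sq_mul_pd_le (hc : IsComponent η L ε T s u ρ₀ ρ) (hε1 : ε ≤ 1) (hδ : 0 < δ)
    (ht : t ∈ Ico 0 T) (hK : entropy δ (ρ t) ≤ K) {a : L2R} {A : ℝ} (ha : H1Bound a A) :
    ∫ x, a x ^ 2 * descend (pd 0 (ρ t)) x ∂torusMeasure ≤ A * weightConst L K := by
  refine (ha.integral_sq_mul_pd_le ((hc.contDiff ht).of_le (by simp)) (hc.monotone t ht) hδ).trans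
    (mul_le_mul_of_nonneg_left ?_ ha.nonneg)
  rw [hc.integral_pd_zero ht, weightConst]
  linarith

theorem exists_hasDerivAt_energy (hc : IsComponent η L ε T s u ρ₀ ρ) (hs : |s| ≤ 1) (hL : 0 < L)
    (hε : 0 ≤ ε) (hε1 : ε ≤ 1) (hδ : 0 < δ) (ht : t ∈ Ioo 0 T) (hK : entropy δ (ρ t) ≤ K) {A : ℝ}
    (hu : H1Bound (u t) A) :
    ∃ y', HasDerivAt (fun t => energy (L + ε) (ρ t)) y' t ∧
      y' ≤ (L + 1) * weightConst L K * A + energy (L + ε) (ρ t) := by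
  have ht' := Ioo_subset_Ico_self ht
  have hρ := hc.contDiff ht'
  have hP := (contDiff_periodicPart hρ (L + ε)).continuous
  have hdiffusion := mul_nonpos_of_nonneg_of_nonpos hε
    (integral_periodicPart_mul_lap_nonpos hρ (hc.isPeriodic_periodicPart ht'))
  have hyoung := two_mul_abs_integral_mul_mul_le (u t) hP (contDiff_pd 0 hρ).continuous
    (hc.monotone t ht') (show 0 < L + 1 by linarith)
  rw [integral_sq_periodicPart_mul_pd_zero hρ (hc.isPeriodic_periodicPart ht')] at hyoung
  have hvelocity := mul_le_mul_of_nonneg_left (hc.integral_sq_mul_pd_le hε1 hδ ht' hK hu)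
    (show 0 ≤ L + 1 by linarith)
  have henergy : (L + 1)⁻¹ * ((L + ε) * energy (L + ε) (ρ t)) ≤ energy (L + ε) (ρ t) := by
    rw [inv_mul_le_iff₀ (by linarith)]
    exact mul_le_mul_of_nonneg_right (by linarith) (energy_nonneg _ _)
  refine ⟨_, hc.smoothOn.hasDerivAt_energy (L + ε) ht, ?_⟩
  rw [hc.integral_mul_dt ht (memLp_descend hP)]
  set I := ∫ x, u t x * (descend (periodicPart (L + ε) (ρ t)) x * descend (pd 0 (ρ t)) x)
    ∂torusMeasure
  have htransport : -(s * I) ≤ |I| := by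
    refine (neg_le_abs _).trans ?_
    rw [abs_mul]
    exact mul_le_of_le_one_left (abs_nonneg I) hs
  linarith

end IsComponent

namespace IsSolution

variable {η : Plane → ℝ} {L ε T δ t : ℝ} {ρp₀ ρm₀ : Plane → ℝ} {ρp ρm : ℝ → Plane → ℝ}

theorem neg_two_le_totalEntropy (hs : IsSolution η L ε T ρp₀ ρm₀ ρp ρm) (hδ : 0 < δ)
    (ht : t ∈ Ico 0 T) : -2 ≤ totalEntropy δ ρp ρm t := by
  have hp := neg_one_le_entropy ((hs.plus.contDiff ht).of_le (by simp)) (hs.plus.add_pos hδ t ht)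
  have hm := neg_one_le_entropy ((hs.minus.contDiff ht).of_le (by simp)) (hs.minus.add_pos hδ t ht)
  rw [totalEntropy]
  linarith

theorem exists_hasDerivAt_totalEntropy_sub (hs : IsSolution η L ε T ρp₀ ρm₀ ρp ρm) (hε : 0 ≤ ε)
    (hε1 : ε ≤ 1) (hδ : 0 < δ) (hδ1 : δ ≤ 1) (ht : t ∈ Ioo 0 T) :
    ∃ E', HasDerivAt (fun t => 2 * (totalEntropy δ ρp ρm t - 8 * (L + 3) * δ * t)) E' t ∧
      E' ≤ -dissipationAt ρp ρm t := by
  obtain ⟨E', hd, hle⟩ := hs.exists_hasDerivAt_totalEntropy hε hε1 hδ hδ1 ht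
  exact ⟨_, (hd.sub ((hasDerivAt_id t).const_mul _)).const_mul 2, by linarith⟩

theorem continuousOn_totalEntropy_sub (hs : IsSolution η L ε T ρp₀ ρm₀ ρp ρm) (hδ : 0 < δ) :
    ContinuousOn (fun t => 2 * (totalEntropy δ ρp ρm t - 8 * (L + 3) * δ * t)) (Ico 0 T) :=
  continuousOn_const.mul ((hs.continuousOn_totalEntropy hδ).sub (by fun_prop))

theorem totalEntropy_le (hs : IsSolution η L ε T ρp₀ ρm₀ ρp ρm) (hL : 0 < L) (hε : 0 ≤ ε)
    (hε1 : ε ≤ 1) (hδ : 0 < δ) (hδ1 : δ ≤ 1) (hδT : 8 * (L + 3) * δ * T ≤ 1) (ht : t ∈ Ico 0 T) :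
    totalEntropy δ ρp ρm t ≤ totalEntropy δ ρp ρm 0 + 1 := by
  have hanti := antitoneOn_Ico_of_hasDerivAt_nonpos (hs.continuousOn_totalEntropy_sub hδ)
    fun t ht => by
      obtain ⟨E', hd, hle⟩ := hs.exists_hasDerivAt_totalEntropy_sub hε hε1 hδ hδ1 ht
      exact ⟨E', hd, hle.trans (neg_nonpos.2 (dissipation_nonneg _))⟩
  have hle := hanti ⟨le_rfl, ht.1.trans_lt ht.2⟩ ht ht.1
  have htT : 8 * (L + 3) * δ * t ≤ 8 * (L + 3) * δ * T :=
    mul_le_mul_of_nonneg_left ht.2.le (by positivity)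
  simp only [mul_zero, sub_zero] at hle
  linarith

theorem neg_three_le_totalEntropy_sub (hs : IsSolution η L ε T ρp₀ ρm₀ ρp ρm) (hL : 0 < L)
    (hδ : 0 < δ) (hδT : 8 * (L + 3) * δ * T ≤ 1) (ht : t ∈ Ico 0 T) :
    -3 ≤ totalEntropy δ ρp ρm t - 8 * (L + 3) * δ * t := by
  have htT : 8 * (L + 3) * δ * t ≤ 8 * (L + 3) * δ * T :=
    mul_le_mul_of_nonneg_left ht.2.le (by positivity)
  linarith [hs.neg_two_le_totalEntropy hδ ht]

theorem lintegral_dissipationAt_le (hs : IsSolution η L ε T ρp₀ ρm₀ ρp ρm) (hL : 0 < L)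
    (hε : 0 ≤ ε) (hε1 : ε ≤ 1) (hδ : 0 < δ) (hδ1 : δ ≤ 1) (hδT : 8 * (L + 3) * δ * T ≤ 1) :
    ∫⁻ t in Ioo 0 T, ENNReal.ofReal (dissipationAt ρp ρm t) ≤
      ENNReal.ofReal (2 * (totalEntropy δ ρp ρm 0 + 3)) := by
  have hmeas : AEMeasurable (dissipationAt ρp ρm) (volume.restrict (Ioo 0 T)) :=
    aemeasurable_dissipation ((continuousOn_toL2_descend hs.smoothOn_sub.continuousOn).mono
      Ioo_subset_Ico_self) measurableSet_Ioo
  refine (lintegral_Ioo_le_of_hasDerivAt (hs.continuousOn_totalEntropy_sub hδ) hmeas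
    (fun t _ => dissipation_nonneg _)
    (fun t ht => hs.exists_hasDerivAt_totalEntropy_sub hε hε1 hδ hδ1 ht) (m := -6)
    fun t ht => ?_).trans_eq ?_
  · linarith [hs.neg_three_le_totalEntropy_sub hL hδ hδT (Ioo_subset_Ico_self ht)]
  · congr 1
    ring

theorem energy_le (hs : IsSolution η L ε T ρp₀ ρm₀ ρp ρm) (hL : 0 < L) (hε : 0 ≤ ε) (hε1 : ε ≤ 1)
    (hδ : 0 < δ) (hδ1 : δ ≤ 1) (hδT : 8 * (L + 3) * δ * T ≤ 1) {s : ℝ} {ρ₀ : Plane → ℝ}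
    {ρ : ℝ → Plane → ℝ}
    (hc : IsComponent η L ε T s (fun t => rieszSqFn fun x => ρp t x - ρm t x) ρ₀ ρ) (hs1 : |s| ≤ 1)
    {K : ℝ} (hK0 : 0 ≤ K) (hK : ∀ t ∈ Ico 0 T, entropy δ (ρ t) ≤ K) (ht : t ∈ Ico 0 T) :
    energy (L + ε) (ρ t) ≤ Real.exp T * (energy (L + ε) (ρ 0) +
      2 * ((L + 1) * weightConst L K) * (totalEntropy δ ρp ρm 0 + 3)) := by
  set C := (L + 1) * weightConst L K
  have hC0 : 0 ≤ C := mul_nonneg (by linarith) (weightConst_pos hL.le hK0).le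
  set E : ℝ → ℝ := fun t => 2 * (totalEntropy δ ρp ρm t - 8 * (L + 3) * δ * t) with hE
  set y : ℝ → ℝ := fun t => energy (L + ε) (ρ t)
  have hanti : AntitoneOn (fun t => Real.exp (-t) * y t + C * E t) (Ico 0 T) := by
    refine antitoneOn_Ico_of_hasDerivAt_nonpos (ContinuousOn.add (ContinuousOn.mul (by fun_prop)
      (hc.smoothOn.continuousOn_energy _)) (continuousOn_const.mul
      (hs.continuousOn_totalEntropy_sub hδ))) fun t ht => ?_
    have ht' := Ioo_subset_Ico_self ht
    obtain ⟨E', hE', hE'_le⟩ := hs.exists_hasDerivAt_totalEntropy_sub hε hε1 hδ hδ1 ht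
    obtain ⟨y', hy', hy'_le⟩ := hc.exists_hasDerivAt_energy hs1 hL hε hε1 hδ ht (hK t ht')
      (h1Bound_rieszSq (hs.summable_dissipationTerm ht'))
    refine ⟨_, ((hasDerivAt_neg t).exp.mul hy').add (hE'.const_mul C), ?_⟩
    have hexp : Real.exp (-t) ≤ 1 := Real.exp_le_one_iff.2 (neg_nonpos.2 ht.1.le)
    calc Real.exp (-t) * -1 * y t + Real.exp (-t) * y' + C * E'
        ≤ Real.exp (-t) * -1 * y t + Real.exp (-t) * (C * dissipationAt ρp ρm t + y t) +
            C * -dissipationAt ρp ρm t := by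
          gcongr
          exact hy'_le
      _ = (Real.exp (-t) - 1) * (C * dissipationAt ρp ρm t) := by ring
      _ ≤ 0 := mul_nonpos_of_nonpos_of_nonneg (sub_nonpos.2 hexp)
          (mul_nonneg hC0 (dissipation_nonneg _))
  have hle := hanti ⟨le_rfl, ht.1.trans_lt ht.2⟩ ht ht.1
  have hlower := mul_le_mul_of_nonneg_left (hs.neg_three_le_totalEntropy_sub hL hδ hδT ht) hC0
  have hbound : Real.exp (-t) * y t ≤ y 0 + 2 * C * (totalEntropy δ ρp ρm 0 + 3) := by
    simp only [hE, mul_zero, sub_zero, neg_zero, Real.exp_zero, one_mul] at hle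
    linarith
  have hnonneg := (mul_nonneg (Real.exp_pos (-t)).le (energy_nonneg _ _)).trans hbound
  calc y t = Real.exp t * (Real.exp (-t) * y t) := by
        rw [← mul_assoc, ← Real.exp_add, add_neg_cancel, Real.exp_zero, one_mul]
    _ ≤ Real.exp T * (y 0 + 2 * C * (totalEntropy δ ρp ρm 0 + 3)) :=
        (mul_le_mul_of_nonneg_left hbound (Real.exp_pos t).le).trans
          (mul_le_mul_of_nonneg_right (Real.exp_le_exp.2 ht.2.le) hnonneg)

end IsSolution

/-! ### Bounds on the time derivatives at a fixed time -/

section L2Operators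

theorem coeff_sub (f g : L2R) (k : Fin 2 → ℤ) : coeff (f - g) k = coeff f k - coeff g k := by
  have hsub : complexify (f - g) = complexify f - complexify g :=
    map_sub (Complex.ofRealCLM.compLpL 2 torusMeasure) f g
  simp only [coeff_eq_inner, hsub, inner_sub_right]

theorem norm_coeff_rieszSq_le (f : L2R) (k : Fin 2 → ℤ) : ‖coeff (rieszSq f) k‖ ≤ ‖coeff f k‖ := by
  rw [coeff_rieszSq, norm_mul, Complex.norm_real, Real.norm_of_nonneg (rieszSqSymbol_nonneg k)]
  exact mul_le_of_le_one_left (norm_nonneg _) (rieszSqSymbol_le_one k)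

theorem norm_rieszSq_sub_le (f g : L2R) : ‖rieszSq f - rieszSq g‖ ≤ ‖f - g‖ := by
  refine (sq_le_sq₀ (norm_nonneg _) (norm_nonneg _)).1 ?_
  refine hasSum_le (fun k => ?_) (hasSum_norm_coeff_sq _) (hasSum_norm_coeff_sq _)
  rw [coeff_sub, coeff_sub, coeff_rieszSq, coeff_rieszSq, ← mul_sub, ← coeff_sub, ← coeff_rieszSq]
  gcongr
  exact norm_coeff_rieszSq_le _ k

theorem continuous_rieszSq : Continuous rieszSq :=
  (LipschitzWith.of_dist_le_mul (K := 1) fun f g => by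
    simpa [dist_eq_norm] using norm_rieszSq_sub_le f g).continuous

theorem continuous_toDual (k : ℕ) : Continuous (toDual k) :=
  (innerSL ℝ (E := L2R)).continuous.clm_comp continuous_const

theorem integral_mul_rieszSq (f g : L2R) :
    ∫ x, f x * rieszSq g x ∂torusMeasure = ∫ x, rieszSq f x * g x ∂torusMeasure := by
  have hsum := hasSum_conj_coeff_mul_coeff f (rieszSq g)
  have hterm (k : Fin 2 → ℤ) : (starRingEnd ℂ) (coeff f k) * coeff (rieszSq g) k =
      (starRingEnd ℂ) (coeff (rieszSq f) k) * coeff g k := by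
    rw [coeff_rieszSq, coeff_rieszSq, map_mul, Complex.conj_ofReal]
    ring
  simp only [hterm] at hsum
  exact_mod_cast hsum.unique (hasSum_conj_coeff_mul_coeff (rieszSq f) g)

theorem H1Bound.rieszSq {a : L2R} {A : ℝ} (h : H1Bound a A) : H1Bound (rieszSq a) A := fun S => by
  refine (Finset.sum_le_sum fun k _ => ?_).trans (h S)
  have := freqWeight_pos k
  gcongr
  exact norm_coeff_rieszSq_le a k

theorem abs_integral_mul_le_norm_mul_norm {α : Type*} [MeasurableSpace α] {μ : Measure α}
    (f g : Lp ℝ 2 μ) : |∫ x, f x * g x ∂μ| ≤ ‖f‖ * ‖g‖ := by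
  have hinner : ∫ x, f x * g x ∂μ = inner ℝ g f := by
    rw [L2.inner_def]
    rfl
  rw [hinner, mul_comm]
  exact abs_real_inner_le_norm g f

theorem abs_integral_mul_lap_le (f : L2R) {φ : Plane → ℝ} (hφ : ContDiff ℝ ∞ φ) {c : ℝ}
    (h : ∀ j, |∫ x, f x * descend (pd j (pd j φ)) x ∂torusMeasure| ≤ c) :
    |∫ x, f x * descend (lap φ) x ∂torusMeasure| ≤ 2 * c := by
  have hsum : ∫ x, f x * descend (lap φ) x ∂torusMeasure =
      ∑ j, ∫ x, f x * descend (pd j (pd j φ)) x ∂torusMeasure := by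
    rw [← integral_finsetSum _ fun j _ =>
      integrable_mul_descend f (contDiff_pd j (contDiff_pd j hφ))]
    simp only [descend_apply, lap_eq_sum, Finset.mul_sum]
  rw [hsum]
  refine (Finset.abs_sum_le_sum_abs _ _).trans ((Finset.sum_le_sum fun j _ => h j).trans_eq ?_)
  simp

theorem rieszSqSymbol_mul_sq_le (k : Fin 2 → ℤ) (j : Fin 2) :
    rieszSqSymbol k * (k j : ℝ) ^ 2 ≤ (k 0 : ℝ) ^ 2 := by
  refine le_trans ?_ (rieszSqSymbol_mul_le k)
  gcongr
  · exact rieszSqSymbol_nonneg k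
  · fin_cases j <;> simp [sq_nonneg]

end L2Operators

namespace Sobolev

variable {n : ℕ}

/-- The weak derivative `∂₁^a ∂₂^b v` of an element `v` of the Sobolev space `W^{n,2}(𝕋²)`. -/
def weakDeriv (v : Sobolev n) (a b : ℕ) (h : a + b ≤ n) : L2R :=
  (v : PiLp 2 fun _ : MIdx n => L2R) ⟨(⟨a, by omega⟩, ⟨b, by omega⟩), h⟩

theorem isWeakDeriv (v : Sobolev n) {a b : ℕ} (h : a + b ≤ n) :
    IsWeakDeriv a b (fn n v) (weakDeriv v a b h) :=
  v.2 ⟨(⟨a, by omega⟩, ⟨b, by omega⟩), h⟩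

theorem norm_weakDeriv_le (v : Sobolev n) {a b : ℕ} (h : a + b ≤ n) :
    ‖weakDeriv v a b h‖ ≤ ‖v‖ :=
  PiLp.norm_apply_le (v : PiLp 2 fun _ : MIdx n => L2R) _

theorem norm_fn_sq_add_le (v : Sobolev n) (hn : 1 ≤ n) :
    ‖fn n v‖ ^ 2 + ‖weakDeriv v 1 0 hn‖ ^ 2 + ‖weakDeriv v 0 1 hn‖ ^ 2 ≤ ‖v‖ ^ 2 := by
  classical
  let F : PiLp 2 fun _ : MIdx n => L2R := v
  let α₁ : MIdx n := ⟨(⟨1, by omega⟩, ⟨0, by omega⟩), hn⟩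
  let α₂ : MIdx n := ⟨(⟨0, by omega⟩, ⟨1, by omega⟩), hn⟩
  have hsum : ∑ α ∈ {MIdx.zero n, α₁, α₂}, ‖F α‖ ^ 2 ≤ ∑ α, ‖F α‖ ^ 2 :=
    Finset.sum_le_sum_of_subset_of_nonneg (Finset.subset_univ _) fun _ _ _ => sq_nonneg _
  rw [Finset.sum_insert (by simp [MIdx.zero, α₁, α₂, Fin.ext_iff]),
    Finset.sum_insert (by simp [α₁, α₂, Fin.ext_iff]), Finset.sum_singleton, ← add_assoc,
    ← PiLp.norm_sq_eq_of_L2] at hsum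
  exact hsum

theorem norm_coeff_weakDeriv (v : Sobolev n) {a b : ℕ} (h : a + b ≤ n)
    (k : Fin 2 → ℤ) : ‖coeff (weakDeriv v a b h) k‖ =
      |2 * Real.pi * k 0| ^ a * |2 * Real.pi * k 1| ^ b * ‖coeff (fn n v) k‖ := by
  rw [(isWeakDeriv v h).coeff_eq k]
  simp [abs_mul]

theorem h1Bound (v : Sobolev n) (hn : 1 ≤ n) : H1Bound (fn n v) (‖v‖ ^ 2) := by
  intro S
  have hweight (k : Fin 2 → ℤ) : freqWeight k * ‖coeff (fn n v) k‖ ^ 2 ≤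
      ‖coeff (fn n v) k‖ ^ 2 + ‖coeff (weakDeriv v 1 0 hn) k‖ ^ 2 +
        ‖coeff (weakDeriv v 0 1 hn) k‖ ^ 2 := by
    have hpi : 1 ≤ (2 * Real.pi) ^ 2 := one_le_pow₀ (by linarith [Real.two_le_pi])
    have hle (i : Fin 2) : (k i : ℝ) ^ 2 ≤ (2 * Real.pi * k i) ^ 2 := by
      rw [mul_pow]
      exact le_mul_of_one_le_left (sq_nonneg _) hpi
    rw [norm_coeff_weakDeriv, norm_coeff_weakDeriv, pow_zero, pow_one, pow_zero, pow_one, one_mul,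
      mul_one, mul_pow, mul_pow, sq_abs, sq_abs, freqWeight, add_mul, add_mul, one_mul]
    exact add_le_add (add_le_add_right (mul_le_mul_of_nonneg_right (hle 0) (sq_nonneg _)) _)
      (mul_le_mul_of_nonneg_right (hle 1) (sq_nonneg _))
  calc ∑ k ∈ S, freqWeight k * ‖coeff (fn n v) k‖ ^ 2
      ≤ ∑ k ∈ S, ‖coeff (fn n v) k‖ ^ 2 + ∑ k ∈ S, ‖coeff (weakDeriv v 1 0 hn) k‖ ^ 2 +
          ∑ k ∈ S, ‖coeff (weakDeriv v 0 1 hn) k‖ ^ 2 := by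
        rw [← Finset.sum_add_distrib, ← Finset.sum_add_distrib]
        exact Finset.sum_le_sum fun k _ => hweight k
    _ ≤ ‖fn n v‖ ^ 2 + ‖weakDeriv v 1 0 hn‖ ^ 2 + ‖weakDeriv v 0 1 hn‖ ^ 2 := by
        gcongr <;> exact sum_norm_coeff_sq_le _ S
    _ ≤ ‖v‖ ^ 2 := norm_fn_sq_add_le v hn

theorem exists_norm_coeff_eq (v : Sobolev n) (hn : 1 ≤ n) (j : Fin 2) :
    ∃ g : L2R, ‖g‖ ≤ ‖v‖ ∧ ∀ k, ‖coeff g k‖ = |2 * Real.pi * k j| * ‖coeff (fn n v) k‖ := by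
  fin_cases j
  · exact ⟨_, norm_weakDeriv_le v (a := 1) (b := 0) hn, fun k => by
      simp [norm_coeff_weakDeriv v (a := 1) (b := 0) hn]⟩
  · exact ⟨_, norm_weakDeriv_le v (a := 0) (b := 1) (by omega), fun k => by
      simp [norm_coeff_weakDeriv v (a := 0) (b := 1) (by omega)]⟩

theorem exists_integral_mul_pd_pd_eq (v : Sobolev n) (hn : 2 ≤ n) (j : Fin 2) :
    ∃ g : L2R, ‖g‖ ≤ ‖v‖ ∧ ∀ φ, IsTest φ →
      ∫ x, fn n v x * descend (pd j (pd j φ)) x ∂torusMeasure =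
        ∫ x, g x * descend φ x ∂torusMeasure := by
  fin_cases j
  · exact ⟨_, norm_weakDeriv_le v (a := 2) (b := 0) hn, fun φ hφ => by
      simpa using! isWeakDeriv v (a := 2) (b := 0) hn φ hφ⟩
  · exact ⟨_, norm_weakDeriv_le v (a := 0) (b := 2) (by omega), fun φ hφ => by
      simpa using! isWeakDeriv v (a := 0) (b := 2) (by omega) φ hφ⟩

theorem abs_integral_mul_lap_le (v : Sobolev n) (hn : 2 ≤ n) {φ : Plane → ℝ}
    (hφ : IsTest φ) :
    |∫ x, fn n v x * descend (lap φ) x ∂torusMeasure| ≤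
      2 * (‖v‖ * ‖toL2 (descend φ)‖) := by
  refine Dislocation.abs_integral_mul_lap_le _ hφ.1 fun j => ?_
  obtain ⟨g, hg, hg_eq⟩ := exists_integral_mul_pd_pd_eq v hn j
  rw [hg_eq φ hφ, ← integral_mul_toL2 hφ.1.continuous]
  exact (abs_integral_mul_le_norm_mul_norm g _).trans (by gcongr)

theorem abs_integral_rieszSq_mul_pd_pd_le (v : Sobolev n) (hn : 1 ≤ n) {φ : Plane → ℝ}
    (hφ : IsTest φ) (j : Fin 2) :
    |∫ x, rieszSq (fn n v) x * descend (pd j (pd j φ)) x ∂torusMeasure| ≤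
      ‖v‖ * √(dissipation (toL2 (descend φ))) := by
  obtain ⟨g, hg, hg_coeff⟩ := exists_norm_coeff_eq v hn j
  have hpd := contDiff_pd j hφ.1
  have hsum := hasSum_conj_coeff_mul_coeff (rieszSq (fn n v))
    (toL2 (descend (pd j (pd j φ))))
  rw [integral_mul_toL2 (contDiff_pd j hpd).continuous] at hsum
  rw [← Real.norm_eq_abs, ← Complex.norm_real, ← Real.sqrt_sq (norm_nonneg v)]
  refine norm_le_sqrt_mul_sqrt_of_hasSum hsum (a := fun k => ‖coeff g k‖)
    (b := fun k => rieszSqSymbol k * |2 * Real.pi * k j| * ‖coeff (toL2 (descend φ)) k‖)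
    (fun k => ?_) (fun S => (sum_norm_coeff_sq_le g S).trans (by gcongr)) fun S => ?_
  · rw [hg_coeff, coeff_rieszSq, coeff_pd j (hpd.of_le (by simp)) (hφ.2.pd j),
      coeff_pd j (hφ.1.of_le (by simp)) hφ.2]
    simp only [map_mul, norm_mul, RCLike.norm_conj, Complex.norm_real, Complex.norm_I,
      Real.norm_of_nonneg (rieszSqSymbol_nonneg k), Complex.norm_ofNat, Complex.norm_intCast,
      Real.norm_eq_abs, abs_mul, Nat.abs_ofNat, mul_one]
    apply le_of_eq
    ring
  · refine (Finset.sum_le_sum fun k _ => ?_).trans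
      (sum_dissipationTerm_le (hasSum_dissipationTerm hφ.1 hφ.2).summable S)
    calc (rieszSqSymbol k * |2 * Real.pi * k j| * ‖coeff (toL2 (descend φ)) k‖) ^ 2
        = rieszSqSymbol k * ((2 * Real.pi) ^ 2 * (rieszSqSymbol k * (k j : ℝ) ^ 2)) *
            ‖coeff (toL2 (descend φ)) k‖ ^ 2 := by
          rw [mul_pow, mul_pow, sq_abs]
          ring
      _ ≤ rieszSqSymbol k * ((2 * Real.pi) ^ 2 * (k 0 : ℝ) ^ 2) *
            ‖coeff (toL2 (descend φ)) k‖ ^ 2 := by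
          gcongr
          · exact rieszSqSymbol_nonneg k
          · exact rieszSqSymbol_mul_sq_le k j
      _ = dissipationTerm (toL2 (descend φ)) k := by rw [dissipationTerm, mul_pow _ (k 0 : ℝ)]

theorem abs_integral_rieszSq_mul_lap_le (v : Sobolev n) (hn : 1 ≤ n) {φ : Plane → ℝ}
    (hφ : IsTest φ) :
    |∫ x, rieszSq (fn n v) x * descend (lap φ) x ∂torusMeasure| ≤
      2 * (‖v‖ * √(dissipation (toL2 (descend φ)))) :=
  Dislocation.abs_integral_mul_lap_le _ hφ.1 (abs_integral_rieszSq_mul_pd_pd_le v hn hφ)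

end Sobolev

section TimeDerivative

variable {η : Plane → ℝ} {L ε T s δ K t : ℝ} {u : ℝ → L2R} {ρ₀ ρp₀ ρm₀ : Plane → ℝ}
  {ρ ρp ρm : ℝ → Plane → ℝ}

theorem IsComponent.abs_integral_velocity_mul_pd_le (hc : IsComponent η L ε T s u ρ₀ ρ)
    (hL : 0 ≤ L) (hε1 : ε ≤ 1) (hδ : 0 < δ) (ht : t ∈ Ico 0 T) (hK0 : 0 ≤ K)
    (hK : entropy δ (ρ t) ≤ K) {a b : L2R} {A B : ℝ} (ha : H1Bound a A) (hb : H1Bound b B) :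
    |∫ x, a x * (b x * descend (pd 0 (ρ t)) x) ∂torusMeasure| ≤
      weightConst L K * (√A * √B) := by
  have hθ := (contDiff_pd 0 (hc.contDiff ht)).continuous
  have hθ0 (x : Torus) : 0 ≤ descend (pd 0 (ρ t)) x := hc.monotone t ht _
  have hcauchy := sq_integral_mul_mul_le hθ0 (integrable_sq_mul_descend a hθ)
    (integrable_sq_mul_descend b hθ) (integrable_mul_mul_descend a (Lp.memLp b) hθ)
  have ha_le := hc.integral_sq_mul_pd_le hε1 hδ ht hK ha
  have hb_le := hc.integral_sq_mul_pd_le hε1 hδ ht hK hb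
  have hΛ := weightConst_pos hL hK0
  have hA := ha.nonneg
  have hB := hb.nonneg
  refine (sq_le_sq₀ (abs_nonneg _) (by positivity)).1 ?_
  rw [sq_abs, mul_pow, mul_pow, Real.sq_sqrt hA, Real.sq_sqrt hB]
  refine hcauchy.trans ((mul_le_mul ha_le hb_le (integral_nonneg fun x =>
    mul_nonneg (sq_nonneg _) (hθ0 x)) (by positivity)).trans_eq ?_)
  ring

theorem IsComponent.norm_toDual_dt_le (hc : IsComponent η L ε T s u ρ₀ ρ) (hs : |s| ≤ 1)
    (hL : 0 ≤ L) (hε : 0 ≤ ε) (hε1 : ε ≤ 1) (hδ : 0 < δ) (ht : t ∈ Ioo 0 T) (hK0 : 0 ≤ K)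
    (hK : entropy δ (ρ t) ≤ K) {A : ℝ} (hu : H1Bound (u t) A) :
    ‖toDual 2 (toL2 (descend (dt ρ t)))‖ ≤
      2 * √(energy (L + ε) (ρ t)) + weightConst L K * √A := by
  have ht' := Ioo_subset_Ico_self ht
  have hρ := hc.contDiff ht'
  have hP := contDiff_periodicPart hρ (L + ε)
  have hΛ := weightConst_pos hL hK0
  refine ContinuousLinearMap.opNorm_le_bound _ (by positivity) fun v => ?_
  have hlap := Sobolev.abs_integral_mul_lap_le v le_rfl ⟨hP, hc.isPeriodic_periodicPart ht'⟩
  rw [lap_periodicPart (hρ.differentiable (by simp)), ← Real.sqrt_sq (norm_nonneg (toL2 _)),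
    norm_toL2_sq hP.continuous] at hlap
  have hdrift := hc.abs_integral_velocity_mul_pd_le hL hε1 hδ ht' hK0 hK hu
    (Sobolev.h1Bound v one_le_two)
  rw [Real.sqrt_sq (norm_nonneg v)] at hdrift
  rw [toDual_apply, integral_mul_toL2 (hc.smoothOn.contDiff_dt ht).continuous,
    hc.integral_mul_dt ht (Lp.memLp _), Real.norm_eq_abs]
  refine (abs_sub _ _).trans ?_
  rw [abs_mul, abs_mul, abs_of_nonneg hε, add_mul]
  refine add_le_add (((mul_le_of_le_one_left (abs_nonneg _) hε1).trans hlap).trans_eq ?_)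
    (((mul_le_of_le_one_left (abs_nonneg _) hs).trans hdrift).trans_eq (by ring))
  rw [energy]
  ring

theorem integral_mul_descend_sub (w : L2R) {f g : Plane → ℝ} (hf : ContDiff ℝ ∞ f)
    (hg : ContDiff ℝ ∞ g) :
    ∫ x, w x * descend (fun y => f y - g y) x ∂torusMeasure =
      ∫ x, w x * descend f x ∂torusMeasure - ∫ x, w x * descend g x ∂torusMeasure := by
  rw [← integral_sub (integrable_mul_descend w hf) (integrable_mul_descend w hg)]
  exact integral_congr_ae (.of_forall fun x => mul_sub _ _ _)

theorem SmoothOn.dt_sub {f g : ℝ → Plane → ℝ} (hf : SmoothOn T f) (hg : SmoothOn T g)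
    (ht : t ∈ Ioo 0 T) :
    Dislocation.dt (fun t x => f t x - g t x) t = fun x => dt f t x - dt g t x :=
  funext fun x => ((hf.hasDerivAt ht x).sub (hg.hasDerivAt ht x)).deriv

namespace IsSolution

theorem integral_mul_dt_sub (hs : IsSolution η L ε T ρp₀ ρm₀ ρp ρm) (ht : t ∈ Ioo 0 T)
    (w : L2R) :
    ∫ x, w x * descend (dt (fun t x => ρp t x - ρm t x) t) x ∂torusMeasure =
      ε * ∫ x, w x * descend (lap fun x => ρp t x - ρm t x) x ∂torusMeasure -
        (∫ x, rieszSqFn (fun x => ρp t x - ρm t x) x *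
            (w x * descend (pd 0 (ρp t)) x) ∂torusMeasure +
          ∫ x, rieszSqFn (fun x => ρp t x - ρm t x) x *
            (w x * descend (pd 0 (ρm t)) x) ∂torusMeasure) := by
  have hp := hs.plus.contDiff (Ioo_subset_Ico_self ht)
  have hm := hs.minus.contDiff (Ioo_subset_Ico_self ht)
  rw [hs.plus.smoothOn.dt_sub hs.minus.smoothOn ht, lap_sub hp hm,
    integral_mul_descend_sub w (hs.plus.smoothOn.contDiff_dt ht) (hs.minus.smoothOn.contDiff_dt ht),
    integral_mul_descend_sub w (contDiff_lap hp) (contDiff_lap hm),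
    hs.plus.integral_mul_dt ht (Lp.memLp w), hs.minus.integral_mul_dt ht (Lp.memLp w)]
  ring

theorem norm_toDual_rieszSqFn_dt_le (hs : IsSolution η L ε T ρp₀ ρm₀ ρp ρm) (hL : 0 ≤ L)
    (hε : 0 ≤ ε) (hε1 : ε ≤ 1) (hδ : 0 < δ) (ht : t ∈ Ioo 0 T) (hK0 : 0 ≤ K)
    (hKp : entropy δ (ρp t) ≤ K) (hKm : entropy δ (ρm t) ≤ K) :
    ‖toDual 1 (rieszSqFn (dt (fun t x => ρp t x - ρm t x) t))‖ ≤
      (2 + 2 * weightConst L K) * √(dissipationAt ρp ρm t) := by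
  have ht' := Ioo_subset_Ico_self ht
  have hu := h1Bound_rieszSq (hs.summable_dissipationTerm ht')
  have hΛ := weightConst_pos hL hK0
  refine ContinuousLinearMap.opNorm_le_bound _ (by positivity) fun v => ?_
  have hw : H1Bound (rieszSq (Sobolev.fn 1 v)) (‖v‖ ^ 2) := (Sobolev.h1Bound v le_rfl).rieszSq
  have hlap := Sobolev.abs_integral_rieszSq_mul_lap_le v le_rfl
    ⟨hs.smoothOn_sub.contDiff ht', hs.isPeriodic_sub ht'⟩
  have hdriftp := hs.plus.abs_integral_velocity_mul_pd_le hL hε1 hδ ht' hK0 hKp hu hw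
  have hdriftm := hs.minus.abs_integral_velocity_mul_pd_le hL hε1 hδ ht' hK0 hKm hu hw
  rw [Real.sqrt_sq (norm_nonneg v)] at hdriftp hdriftm
  rw [toDual_apply, rieszSqFn, integral_mul_rieszSq,
    integral_mul_toL2 (hs.smoothOn_sub.contDiff_dt ht).continuous, hs.integral_mul_dt_sub ht,
    Real.norm_eq_abs]
  refine (abs_sub _ _).trans ?_
  rw [abs_mul, abs_of_nonneg hε]
  refine (add_le_add ((mul_le_of_le_one_left (abs_nonneg _) hε1).trans hlap)
    ((abs_add_le _ _).trans (add_le_add hdriftp hdriftm))).trans_eq ?_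
  rw [dissipationAt]
  ring

end IsSolution

end TimeDerivative

/-! ### From bounds at a fixed time to bounds in time -/

section TimeIntegration

theorem negSobolevBound_sqrt {k : ℕ} {T G : ℝ} {f : ℝ → L2R} {g : ℝ → ℝ}
    (hf : ContinuousOn f (Ioo 0 T)) (hG : 0 ≤ G) (h : ∀ t ∈ Ioo 0 T, ‖toDual k (f t)‖ ^ 2 ≤ g t)
    (hg : ∫⁻ t in Ioo 0 T, ENNReal.ofReal (g t) ≤ ENNReal.ofReal G) :
    NegSobolevBound k T (√G) f := by
  have hmeas : AEStronglyMeasurable (fun t => toDual k (f t)) (volume.restrict (Ioo 0 T)) :=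
    (continuous_toDual k).comp_aestronglyMeasurable (hf.aestronglyMeasurable measurableSet_Ioo)
  have hint : ∫⁻ t in Ioo 0 T, ‖toDual k (f t)‖ₑ ^ 2 ≤ ENNReal.ofReal G := by
    refine (setLIntegral_mono' measurableSet_Ioo fun t ht => ?_).trans hg
    rw [← ofReal_norm, ← ENNReal.ofReal_pow (norm_nonneg _)]
    exact ENNReal.ofReal_le_ofReal (h t ht)
  have hnorm : eLpNorm (fun t => toDual k (f t)) 2 (volume.restrict (Ioo 0 T)) ≤
      ENNReal.ofReal √G := by
    rw [eLpNorm_eq_lintegral_rpow_enorm_toReal two_ne_zero ENNReal.ofNat_ne_top, Real.sqrt_eq_rpow,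
      ← ENNReal.ofReal_rpow_of_nonneg hG (by norm_num)]
    simp only [ENNReal.toReal_ofNat, ENNReal.rpow_ofNat]
    gcongr
  exact ⟨⟨hmeas, hnorm.trans_lt ENNReal.ofReal_lt_top⟩, hnorm⟩

theorem integrable_and_abs_integral_apply_le {E α : Type*} [NormedAddCommGroup E] [NormedSpace ℝ E]
    [MeasurableSpace α] {μ : Measure α} {F : α → StrongDual ℝ E} {ψ : α → E} (hF : MemLp F 2 μ)
    (hψ : MemLp ψ 2 μ) :
    Integrable (fun t => F t (ψ t)) μ ∧
      |∫ t, F t (ψ t) ∂μ| ≤ (eLpNorm F 2 μ).toReal * (eLpNorm ψ 2 μ).toReal := by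
  have hmeas : AEStronglyMeasurable (fun t => F t (ψ t)) μ :=
    (ContinuousLinearMap.id ℝ (StrongDual ℝ E)).aestronglyMeasurable_comp₂ hF.1 hψ.1
  have hholder : eLpNorm (fun t => F t (ψ t)) 1 μ ≤ eLpNorm F 2 μ * eLpNorm ψ 2 μ := by
    simpa using eLpNorm_le_eLpNorm_mul_eLpNorm'_of_norm (p := 2) (q := 2) (r := 1) hF.1 hψ.1
      (fun (l : StrongDual ℝ E) v => l v) 1
      (Filter.Eventually.of_forall fun t => by simpa using (F t).le_opNorm (ψ t))
  have hfin := ENNReal.mul_ne_top hF.2.ne hψ.2.ne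
  refine ⟨memLp_one_iff_integrable.1 ⟨hmeas, hholder.trans_lt hfin.lt_top⟩, ?_⟩
  rw [eLpNorm_one_eq_lintegral_enorm] at hholder
  rw [← Real.norm_eq_abs, ← ENNReal.toReal_mul]
  exact (norm_integral_le_lintegral_norm _).trans (ENNReal.toReal_mono hfin (by
    simpa only [ofReal_norm] using hholder))

theorem NegSobolevBound.dualityEstimate {k : ℕ} {T C : ℝ} {f : ℝ → L2R} (hC : 0 ≤ C)
    (h : NegSobolevBound k T C f) : DualityEstimate k T C f := by
  intro ψ hψ
  simp only [← toDual_apply]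
  obtain ⟨hint, hle⟩ := integrable_and_abs_integral_apply_le h.1 hψ
  exact ⟨hint, hle.trans (mul_le_mul_of_nonneg_right (ENNReal.toReal_le_of_le_ofReal hC h.2)
    ENNReal.toReal_nonneg)⟩

theorem lintegral_ofReal_add_const_mul_le {α : Type*} [MeasurableSpace α] {μ : Measure α}
    [IsFiniteMeasure μ] {a b G : ℝ} {g : α → ℝ} (ha : 0 ≤ a) (hb : 0 ≤ b) (hG : 0 ≤ G)
    (hg : ∫⁻ t, ENNReal.ofReal (g t) ∂μ ≤ ENNReal.ofReal G) :
    ∫⁻ t, ENNReal.ofReal (a + b * g t) ∂μ ≤ ENNReal.ofReal (a * μ.real univ + b * G) := by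
  calc ∫⁻ t, ENNReal.ofReal (a + b * g t) ∂μ
      ≤ ∫⁻ t, (ENNReal.ofReal a + ENNReal.ofReal b * ENNReal.ofReal (g t)) ∂μ :=
        lintegral_mono fun t => ENNReal.ofReal_add_le.trans_eq (by rw [ENNReal.ofReal_mul hb])
    _ = ENNReal.ofReal a * μ univ + ENNReal.ofReal b * ∫⁻ t, ENNReal.ofReal (g t) ∂μ := by
        rw [lintegral_add_left measurable_const, lintegral_const_mul' _ _ ENNReal.ofReal_ne_top,
          lintegral_const]
    _ ≤ ENNReal.ofReal a * μ univ + ENNReal.ofReal b * ENNReal.ofReal G := by gcongr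
    _ = ENNReal.ofReal (a * μ.real univ + b * G) := by
        rw [ENNReal.ofReal_add (by positivity) (by positivity), ENNReal.ofReal_mul ha,
          ENNReal.ofReal_mul hb, ofReal_measureReal]

end TimeIntegration

/-! ### Uniform estimates -/

section UniformEstimates

variable {η : Plane → ℝ} {L ε T δ K : ℝ} {ρp₀ ρm₀ : Plane → ℝ} {ρp ρm : ℝ → Plane → ℝ}

theorem exists_pos_le_one_mul_le_one {c : ℝ} (hc : 0 < c) : ∃ δ, 0 < δ ∧ δ ≤ 1 ∧ c * δ ≤ 1 :=
  ⟨min 1 c⁻¹, lt_min one_pos (inv_pos.2 hc), min_le_left _ _, by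
    rw [← le_inv_mul_iff₀ hc, mul_one]
    exact min_le_right _ _⟩

namespace IsSolution

theorem entropy_le (hs : IsSolution η L ε T ρp₀ ρm₀ ρp ρm) (hL : 0 < L) (hε : 0 ≤ ε) (hε1 : ε ≤ 1)
    (hδ : 0 < δ) (hδ1 : δ ≤ 1) (hδT : 8 * (L + 3) * δ * T ≤ 1) (hK : totalEntropy δ ρp ρm 0 ≤ K)
    {t : ℝ} (ht : t ∈ Ico 0 T) : entropy δ (ρp t) ≤ K + 2 ∧ entropy δ (ρm t) ≤ K + 2 := by
  have htotal := hs.totalEntropy_le hL hε hε1 hδ hδ1 hδT ht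
  have hp := neg_one_le_entropy ((hs.plus.contDiff ht).of_le (by simp)) (hs.plus.add_pos hδ t ht)
  have hm := neg_one_le_entropy ((hs.minus.contDiff ht).of_le (by simp)) (hs.minus.add_pos hδ t ht)
  rw [totalEntropy] at htotal
  constructor <;> linarith

theorem lintegral_add_const_mul_dissipationAt_le (hs : IsSolution η L ε T ρp₀ ρm₀ ρp ρm)
    (hL : 0 < L) (hε : 0 ≤ ε) (hε1 : ε ≤ 1) (hδ : 0 < δ) (hδ1 : δ ≤ 1)
    (hδT : 8 * (L + 3) * δ * T ≤ 1) (hT : 0 ≤ T) (hK0 : 0 ≤ K) (hK : totalEntropy δ ρp ρm 0 ≤ K)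
    {a b : ℝ} (ha : 0 ≤ a) (hb : 0 ≤ b) :
    ∫⁻ t in Ioo 0 T, ENNReal.ofReal (a + b * dissipationAt ρp ρm t) ≤
      ENNReal.ofReal (a * T + b * (2 * (K + 3))) := by
  have hdissipation := (hs.lintegral_dissipationAt_le hL hε hε1 hδ hδ1 hδT).trans
    (ENNReal.ofReal_le_ofReal (q := 2 * (K + 3)) (by linarith))
  simpa [hT] using lintegral_ofReal_add_const_mul_le ha hb (by positivity) hdissipation

theorem negSobolevBound_rieszSqFn_dt (hs : IsSolution η L ε T ρp₀ ρm₀ ρp ρm) (hL : 0 < L)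
    (hε : 0 ≤ ε) (hε1 : ε ≤ 1) (hδ : 0 < δ) (hδ1 : δ ≤ 1) (hδT : 8 * (L + 3) * δ * T ≤ 1)
    (hT : 0 ≤ T) (hK0 : 0 ≤ K) (hK : totalEntropy δ ρp ρm 0 ≤ K) :
    NegSobolevBound 1 T (√((2 + 2 * weightConst L (K + 2)) ^ 2 * (2 * (K + 3))))
      fun t => rieszSqFn (dt (fun t x => ρp t x - ρm t x) t) := by
  set B := 2 + 2 * weightConst L (K + 2)
  refine negSobolevBound_sqrt (g := fun t => 0 + B ^ 2 * dissipationAt ρp ρm t)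
    (continuous_rieszSq.comp_continuousOn
      (continuousOn_toL2_descend hs.smoothOn_sub.contDiffOn_dt.continuousOn))
    (by positivity) (fun t ht => ?_) ?_
  · obtain ⟨hp, hm⟩ := hs.entropy_le hL hε hε1 hδ hδ1 hδT hK (Ioo_subset_Ico_self ht)
    have hnorm := hs.norm_toDual_rieszSqFn_dt_le hL.le hε hε1 hδ ht (by positivity) hp hm
    rw [zero_add, ← Real.sq_sqrt (dissipationAt_nonneg ρp ρm t), ← mul_pow]
    gcongr
  · simpa using hs.lintegral_add_const_mul_dissipationAt_le hL hε hε1 hδ hδ1 hδT hT hK0 hK le_rfl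
      (sq_nonneg B)

theorem negSobolevBound_dt (hs : IsSolution η L ε T ρp₀ ρm₀ ρp ρm) (hL : 0 < L) (hε : 0 ≤ ε)
    (hε1 : ε ≤ 1) (hδ : 0 < δ) (hδ1 : δ ≤ 1) (hδT : 8 * (L + 3) * δ * T ≤ 1) (hT : 0 ≤ T)
    (hK0 : 0 ≤ K) (hK : totalEntropy δ ρp ρm 0 ≤ K) {s K' : ℝ} {ρ₀ : Plane → ℝ}
    {ρ : ℝ → Plane → ℝ}
    (hc : IsComponent η L ε T s (fun t => rieszSqFn fun x => ρp t x - ρm t x) ρ₀ ρ) (hs1 : |s| ≤ 1)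
    (hK'0 : 0 ≤ K') (hK' : ∀ t ∈ Ico 0 T, entropy δ (ρ t) ≤ K') (hρ : energy (L + ε) (ρ 0) ≤ K) :
    NegSobolevBound 2 T
      (√(8 * (Real.exp T * (K + 2 * ((L + 1) * weightConst L K') * (K + 3))) * T +
        2 * weightConst L K' ^ 2 * (2 * (K + 3))))
      fun t => toL2 (descend (dt ρ t)) := by
  have hΛ := weightConst_pos hL.le hK'0
  set Λ := weightConst L K'
  set Y := Real.exp T * (K + 2 * ((L + 1) * Λ) * (K + 3))
  have hY : 0 ≤ Y := by positivity
  refine negSobolevBound_sqrt (g := fun t => 8 * Y + 2 * Λ ^ 2 * dissipationAt ρp ρm t)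
    (continuousOn_toL2_descend hc.smoothOn.contDiffOn_dt.continuousOn) (by positivity)
    (fun t ht => ?_)
    (hs.lintegral_add_const_mul_dissipationAt_le hL hε hε1 hδ hδ1 hδT hT hK0 hK (by positivity)
      (by positivity))
  have ht' := Ioo_subset_Ico_self ht
  have henergy : energy (L + ε) (ρ t) ≤ Y :=
    (hs.energy_le hL hε hε1 hδ hδ1 hδT hc hs1 hK'0 hK' ht').trans (by simp only [Y]; gcongr)
  have hnorm : ‖toDual 2 (toL2 (descend (dt ρ t)))‖ ≤
      2 * √(energy (L + ε) (ρ t)) + Λ * √(dissipationAt ρp ρm t) :=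
    hc.norm_toDual_dt_le hs1 hL.le hε hε1 hδ ht hK'0 (hK' t ht')
      (h1Bound_rieszSq (hs.summable_dissipationTerm ht'))
  calc ‖toDual 2 (toL2 (descend (dt ρ t)))‖ ^ 2
      ≤ (2 * √Y + Λ * √(dissipationAt ρp ρm t)) ^ 2 := by
        gcongr
        exact hnorm.trans (by gcongr)
    _ ≤ 2 * ((2 * √Y) ^ 2 + (Λ * √(dissipationAt ρp ρm t)) ^ 2) := add_sq_le
    _ = 8 * Y + 2 * Λ ^ 2 * dissipationAt ρp ρm t := by
        rw [mul_pow, mul_pow, Real.sq_sqrt (dissipationAt_nonneg ρp ρm t),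
          Real.sq_sqrt hY]
        ring

end IsSolution

theorem exists_initial_bound (hη : IsMollifier η) (hp : IsInitialDatum L ρp₀)
    (hm : IsInitialDatum L ρm₀) :
    ∃ K, 0 ≤ K ∧ ∀ T ε, 0 < ε → ε ≤ 1 → ∀ ρp ρm : ℝ → Plane → ℝ,
      IsSolution η L ε T ρp₀ ρm₀ ρp ρm →
        (∀ δ, 0 < δ → δ ≤ 1 → totalEntropy δ ρp ρm 0 ≤ K) ∧
          energy (L + ε) (ρp 0) ≤ K ∧ energy (L + ε) (ρm 0) ≤ K := by
  obtain ⟨Kp, hKp⟩ := hp.exists_bound hη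
  obtain ⟨Km, hKm⟩ := hm.exists_bound hη
  refine ⟨|Kp| + |Km|, by positivity, fun T ε hε hε1 ρp ρm hs => ?_⟩
  obtain ⟨hentropyp, henergyp⟩ := hKp ε hε hε1
  obtain ⟨hentropym, henergym⟩ := hKm ε hε hε1
  simp only [totalEntropy, funext hs.plus.initial, funext hs.minus.initial]
  exact ⟨fun δ hδ hδ1 => add_le_add ((hentropyp δ hδ hδ1).trans (le_abs_self _))
      ((hentropym δ hδ hδ1).trans (le_abs_self _)),
    (henergyp.trans (le_abs_self _)).trans (le_add_of_nonneg_right (abs_nonneg _)),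
    (henergym.trans (le_abs_self _)).trans (le_add_of_nonneg_left (abs_nonneg _))⟩

theorem exists_negSobolevBound_rieszSqFn_dt (hη : IsMollifier η) (hL : 0 < L)
    (hp : IsInitialDatum L ρp₀) (hm : IsInitialDatum L ρm₀) :
    ∃ C, 0 < C ∧ ∀ T, 0 < T → ∀ ε, 0 < ε → ε ≤ 1 → ∀ ρp ρm : ℝ → Plane → ℝ,
      IsSolution η L ε T ρp₀ ρm₀ ρp ρm →
        NegSobolevBound 1 T C fun t => rieszSqFn (dt (fun s x => ρp s x - ρm s x) t) := by
  obtain ⟨K, hK0, hK⟩ := exists_initial_bound hη hp hm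
  have hΛ := weightConst_pos hL.le (show 0 ≤ K + 2 by positivity)
  refine ⟨√((2 + 2 * weightConst L (K + 2)) ^ 2 * (2 * (K + 3))), by positivity,
    fun T hT ε hε hε1 ρp ρm hs => ?_⟩
  obtain ⟨δ, hδ, hδ1, hδT⟩ := exists_pos_le_one_mul_le_one (show 0 < 8 * (L + 3) * T by positivity)
  exact hs.negSobolevBound_rieszSqFn_dt hL hε.le hε1 hδ hδ1 (by linarith) hT.le hK0
    ((hK T ε hε hε1 ρp ρm hs).1 δ hδ hδ1)

theorem exists_negSobolevBound_dt (hη : IsMollifier η) (hL : 0 < L) (hp : IsInitialDatum L ρp₀)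
    (hm : IsInitialDatum L ρm₀) (hT : 0 < T) :
    ∃ C, 0 < C ∧ ∀ ε, 0 < ε → ε ≤ 1 → ∀ ρp ρm : ℝ → Plane → ℝ,
      IsSolution η L ε T ρp₀ ρm₀ ρp ρm →
        NegSobolevBound 2 T C (fun t => toL2 (descend (dt ρp t))) ∧
          NegSobolevBound 2 T C fun t => toL2 (descend (dt ρm t)) := by
  obtain ⟨K, hK0, hK⟩ := exists_initial_bound hη hp hm
  obtain ⟨δ, hδ, hδ1, hδT⟩ := exists_pos_le_one_mul_le_one (show 0 < 8 * (L + 3) * T by positivity)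
  have hK2 : 0 ≤ K + 2 := by positivity
  have hΛ := weightConst_pos hL.le hK2
  refine ⟨√(8 * (Real.exp T * (K + 2 * ((L + 1) * weightConst L (K + 2)) * (K + 3))) * T +
    2 * weightConst L (K + 2) ^ 2 * (2 * (K + 3))), by positivity, fun ε hε hε1 ρp ρm hs => ?_⟩
  obtain ⟨hentropy, henergyp, henergym⟩ := hK T ε hε hε1 ρp ρm hs
  have hE0 := hentropy δ hδ hδ1
  have hδT' : 8 * (L + 3) * δ * T ≤ 1 := by linarith
  have hE {t : ℝ} (ht : t ∈ Ico 0 T) := hs.entropy_le hL hε.le hε1 hδ hδ1 hδT' hE0 ht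
  exact ⟨hs.negSobolevBound_dt hL hε.le hε1 hδ hδ1 hδT' hT.le hK0 hE0 hs.plus (by simp) hK2
      (fun t ht => (hE ht).1) henergyp,
    hs.negSobolevBound_dt hL hε.le hε1 hδ hδ1 hδT' hT.le hK0 hE0 hs.minus (by simp) hK2
      (fun t ht => (hE ht).2) henergym⟩

end UniformEstimates

end Dislocation

end

open Dislocation in
theorem mainTheorem7 (η : Plane → ℝ) (hη : IsMollifier η) (L : ℝ) (hL : 0 < L)
    (ρp₀ ρm₀ : Plane → ℝ) (hp : IsInitialDatum L ρp₀) (hm : IsInitialDatum L ρm₀) :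
    (∃ C : ℝ, 0 < C ∧ ∀ T : ℝ, 0 < T → ∀ ε : ℝ, 0 < ε → ε ≤ 1 →
      ∀ ρp ρm : ℝ → Plane → ℝ, IsSolution η L ε T ρp₀ ρm₀ ρp ρm →
        DualityEstimate 1 T C (fun t => rieszSqFn (dt (fun s x => ρp s x - ρm s x) t)) ∧
        NegSobolevBound 1 T C (fun t => rieszSqFn (dt (fun s x => ρp s x - ρm s x) t))) ∧
    (∀ T : ℝ, 0 < T → ∃ C : ℝ, 0 < C ∧ ∀ ε : ℝ, 0 < ε → ε ≤ 1 →
      ∀ ρp ρm : ℝ → Plane → ℝ, IsSolution η L ε T ρp₀ ρm₀ ρp ρm →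
        (DualityEstimate 2 T C (fun t => toL2 (descend (dt ρp t))) ∧
          NegSobolevBound 2 T C (fun t => toL2 (descend (dt ρp t)))) ∧
        (DualityEstimate 2 T C (fun t => toL2 (descend (dt ρm t))) ∧
          NegSobolevBound 2 T C (fun t => toL2 (descend (dt ρm t))))) := by
  obtain ⟨C, hC, h⟩ := exists_negSobolevBound_rieszSqFn_dt hη hL hp hm
  refine ⟨⟨C, hC, fun T hT ε hε hε1 ρp ρm hs => ?_⟩, fun T hT => ?_⟩
  · have hbound := h T hT ε hε hε1 ρp ρm hs
    exact ⟨hbound.dualityEstimate hC.le, hbound⟩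
  · obtain ⟨C, hC, h⟩ := exists_negSobolevBound_dt hη hL hp hm hT
    refine ⟨C, hC, fun ε hε hε1 ρp ρm hs => ?_⟩
    obtain ⟨hplus, hminus⟩ := h ε hε hε1 ρp ρm hs
    exact ⟨⟨hplus.dualityEstimate hC.le, hplus⟩, ⟨hminus.dualityEstimate hC.le, hminus⟩⟩
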